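/- **Conventions.** All of $n,k_1,k_2,t$ are positive integers. A $k$-partition of $[n]=\{1,\dots,n\}$ is a set of $k$ pairwise disjoint non-empty subsets (blocks) with union $[n]$; $\Pi_{n,k}$ is the set of all of them, and $S(n,k)=|\Pi_{n,k}|$ is the Stirling number of the second kind. Families $\mathcal F_1\subseteq\Pi_{n,k_1}$ and $\mathcal F_2\subseteq\Pi_{n,k_2}$ are *cross $t$-intersecting* if $|F_1\cap F_2|\ge t$ (at least $t$ common blocks) for all $F_1\in\mathcal F_1$, $F_2\in\mathcal F_2$, and *non-trivial* if fewer than $t$ blocks belong to all members of $\mathcal F_1\cup\mathcal F_2$. Put $$L(k,t)=(t+1)+(k-t+1)\log_2\big((t+1)(k-t+1)\big),$$ and for $m\le n$ write $[[m]]=\{\{1\},\dots,\{m\}\}$. For $k,\ell\geq t+1$ and $n\ge\ell$ define $$\mathcal A(k,\ell,t)=\Big\{F\in\Pi_{n,k}:[[t]]\subseteq F,\ F\cap([[\ell]]\setminus[[t]])\ne\emptyset\Big\},$$ $$\mathcal B(\ell,t)=\Big\{F\in\Pi_{n,\ell}:[[t]]\subseteq F\Big\}\cup\Big\{\big([[\ell]]\setminus\{\{i\}\}\big)\cup\big\{\{i\}\cup([n]\setminus[\ell])\big\}:1\le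 i\le t\Big\},$$ $$\mathcal C(k,t)=\Big\{F\in\Pi_{n,k}:[[t+1]]\subseteq F\Big\},\qquad \mathcal D(\ell,t)=\Big\{F\in\Pi_{n,\ell}:|F\cap[[t+1]]|\ge t\Big\}.$$ Write $(\mathcal F,\mathcal G)\cong(\mathcal F',\mathcal G')$ if a single permutation of $[n]$ carries $\mathcal F$ to $\mathcal F'$ and $\mathcal G$ to $\mathcal G'$. **Theorem 1.5.** Let $t\geq 1$, $k_1\ge k_2\ge t+2$, $n\ge 2L(k_1,t)$, and let $\mathcal F_1\subseteq\Pi_{n,k_1}$ and $\mathcal F_2\subseteq\Pi_{n,k_2}$ be non-trivial cross $t$-intersecting families. (i) If $k_2\ge 2t+2$ and $n\ge t+1+(k_1-t)(k_2-t)$, then $$|\mathcal F_1||\mathcal F_2|\le\left(\sum_{j=1}^{k_2-t}(-1)^{j-1}\binom{k_2-t}{j}S(n-t-j,k_1-t-j)\right)\left(S(n-t,k_2-t)+t\right).$$ Equality holds if and only if $(\mathcal F_1,\mathcal F_2)\cong(\mathcal A(k_1,k_2,t),\mathcal B(k_2,t))$, or $k_1=k_2$ and $(\mathcal F_1,\mathcal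 F_2)\cong(\mathcal B(k_1,t),\mathcal A(k_2,k_1,t))$. (ii) If $k_2\le 2t+1$ and $(k_1,k_2)\notin\{(2t+1,2t+1),(4,3)\}$, then $$|\mathcal F_1||\mathcal F_2|\le S(n-t-1,k_1-t-1)\left((t+1)\,S(n-t,k_2-t)-t\,S(n-t-1,k_2-t-1)\right).$$ Equality holds if and only if $(\mathcal F_1,\mathcal F_2)\cong(\mathcal C(k_1,t),\mathcal D(k_2,t))$, or $k_1=k_2$ and $(\mathcal F_1,\mathcal F_2)\cong(\mathcal D(k_1,t),\mathcal C(k_2,t))$. -/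

import Mathlib

open Finset

/-- `kPartitions n k` is the set of all `k`-partitions of the ground set `Fin n` (in place of
`{1, …, n}`), each given as its set of blocks: pairwise disjoint nonempty sets with union the
ground set. -/
def kPartitions (n k : ℕ) : Finset (Finset (Finset (Fin n))) :=
  ((univ : Finset (Finpartition (univ : Finset (Fin n)))).image
    (fun P => P.parts)).filter (fun F => F.card = k)

/-- Two families of partitions are cross `t`-intersecting if any two members, one from each,
have at least `t` blocks in common. -/
def CrossIntersecting {n : ℕ} (t : ℕ) (𝓕 𝓖 : Finset (Finset (Finset (Fin n)))) : Prop :=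
  ∀ F ∈ 𝓕, ∀ G ∈ 𝓖, t ≤ (F ∩ G).card

/-- A pair of families is non-trivial if fewer than `t` blocks lie in all members of both. -/
def NonTrivialPair {n : ℕ} (t : ℕ) (𝓕 𝓖 : Finset (Finset (Finset (Fin n)))) : Prop :=
  ((univ : Finset (Finset (Fin n))).filter
    (fun B => (∀ F ∈ 𝓕, B ∈ F) ∧ ∀ G ∈ 𝓖, B ∈ G)).card < t

/-- `initialSingletons n m` is the partition `{{1}, …, {m}}` of the first `m` points of the
ground set (for `m ≤ n`). -/
def initialSingletons (n m : ℕ) : Finset (Finset (Fin n)) :=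
  ((univ : Finset (Fin n)).filter (fun i : Fin n => (i : ℕ) < m)).image (fun i => {i})

/-- The `k`-partitions containing `X` and at least one block of `M \ X`. -/
def familyA (n k : ℕ) (X M : Finset (Finset (Fin n))) : Finset (Finset (Finset (Fin n))) :=
  (kPartitions n k).filter (fun F => X ⊆ F ∧ (F ∩ (M \ X)).Nonempty)

/-- The `l`-partitions containing `X`, together with the partitions obtained from the partial
partition `M` by enlarging one block `B ∈ X` by all the points that `M` does not cover. -/
def familyB (n l : ℕ) (X M : Finset (Finset (Fin n))) : Finset (Finset (Finset (Fin n))) :=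
  (kPartitions n l).filter (fun F => X ⊆ F) ∪
    X.image (fun B => (M \ {B}) ∪ {B ∪ (M.sup id)ᶜ})

/-- The `k`-partitions containing `T`. -/
def familyC (n k : ℕ) (T : Finset (Finset (Fin n))) : Finset (Finset (Finset (Fin n))) :=
  (kPartitions n k).filter (fun F => T ⊆ F)

/-- The `l`-partitions having at least `t` blocks in common with `T`. -/
def familyD (n l t : ℕ) (T : Finset (Finset (Fin n))) : Finset (Finset (Finset (Fin n))) :=
  (kPartitions n l).filter (fun F => t ≤ (T ∩ F).card)

/-- `stdA n k l t` is `𝓐(k, l, t)`. -/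
def stdA (n k l t : ℕ) : Finset (Finset (Finset (Fin n))) :=
  familyA n k (initialSingletons n t) (initialSingletons n l)

/-- `stdB n l t` is `𝓑(l, t)`. -/
def stdB (n l t : ℕ) : Finset (Finset (Finset (Fin n))) :=
  familyB n l (initialSingletons n t) (initialSingletons n l)

/-- `stdC n k t` is `𝓒(k, t)`. -/
def stdC (n k t : ℕ) : Finset (Finset (Finset (Fin n))) :=
  familyC n k (initialSingletons n (t + 1))

/-- `stdD n l t` is `𝓓(l, t)`. -/
def stdD (n l t : ℕ) : Finset (Finset (Finset (Fin n))) :=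
  familyD n l t (initialSingletons n (t + 1))

/-- The image of a family of partitions under a permutation of the ground set. -/
def permuteFamily {n : ℕ} (σ : Equiv.Perm (Fin n)) (𝓕 : Finset (Finset (Finset (Fin n)))) :
    Finset (Finset (Finset (Fin n))) :=
  𝓕.image (fun F => F.image (fun B => B.image σ))

/-- Two pairs of families are isomorphic if one permutation of the ground set carries the first
pair to the second. -/
def PairIso {n : ℕ} (𝓕 𝓖 𝓕' 𝓖' : Finset (Finset (Finset (Fin n)))) : Prop :=
  ∃ σ : Equiv.Perm (Fin n), permuteFamily σ 𝓕 = 𝓕' ∧ permuteFamily σ 𝓖 = 𝓖'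

/-- The threshold `L(k, t) = (t + 1) + (k - t + 1) * log₂ ((t + 1) * (k - t + 1))`. -/
noncomputable def thresholdL (k t : ℕ) : ℝ :=
  ((t : ℝ) + 1) + ((k : ℝ) - t + 1) * Real.logb 2 (((t : ℝ) + 1) * ((k : ℝ) - t + 1))

/-!
Write `k₁ = t + K`, `k₂ = t + L` and `n = t + M + 1`, and put `a₁ = S(M, K - 1)`,
`b₀ = S(M + 1, L)` and `Q = (t + 1) * (K + 1)`. Fixing a block, if it is a singleton, replaces a
Stirling number `S(m + 1, j + 1)` by `S(m, j)`, and the hypothesis `2 * L(k₁, t) ≤ n` makes this a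
loss by a factor of at least `Q ^ 2` (`AboveThreshold.sq_mul_stirlingSecond_le`). Up to lower
order terms the two candidate maxima are `L * a₁ * b₀`, for the pair `(𝓐, 𝓑)`, and
`(t + 1) * a₁ * b₀`, for `(𝓒, 𝓓)`. It is shown that every pair that lies in no copy of these, up
to exchange of the two families if `K = L`, has a product below `(c - 1 / 4) * a₁ * b₀` with
`c = max L (t + 1)` (`embeds_or_lt`). The larger candidate is at least that large.

The bound comes from covers. A `t`-cover of a family is a set of blocks sharing at least `t`
blocks with each of its members; by the cross intersection property each member of one family is a
`t`-cover of the other. If `t + α` and `t + β` are the least sizes of `t`-covers of the two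
families, then branching on the blocks of members of the opposite family bounds their sizes
(`card_le_of_covers`). Each unit of `α + β` costs at most a factor `Q` in branching, and each one
but the first gains a factor `Q ^ 2` compared to `a₁ * b₀`. This settles `α + β ≥ 2`
(`mul_le_of_min_covers`). Non-triviality excludes a common `t`-set of blocks of both families, so
`α = β = 0` is also cheap. If `α = 0` and `β = 1`, let `T` be the common `t`-set of the first
family. The number of one-block extensions of `T` that cover the second family decides the
structure: if it has its largest possible value `L`, the pair has the form of `(𝓐, 𝓑)`; if it is
`1` and all members of the first family contain the extending block, the pair has the form of
`(𝓒, 𝓓)`; and otherwise the product is small (`structure_of_common`). Configurations of these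
forms based on blocks that are not all singletons lose a constant factor
(`inside_or_lt_of_common`). The case `α = 1`, `β = 0` is symmetric if `K = L`; if `L < K` its
leading term is `S(M + 1, K) * S(M, L - 1)`, which is smaller than `a₁ * b₀` by a definite factor
(`AboveThreshold.four_mul_le`, `lt_of_common_right`). For `K = L = 2` the Stirling numbers leave
no room for these estimates, since one of the families then may consist of a single partition, and
a direct argument on the largest block of that partition is used (`insideCD_or_lt_two`).

It remains to compare the two candidates. If `L ≥ t + 2` then `(𝓐, 𝓑)` wins and if `L ≤ t` then
`(𝓒, 𝓓)` wins by the leading terms. For `L = t + 1` these agree, and the lower order terms favour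
`(𝓒, 𝓓)` unless `K = t + 1` or `(t, K) = (1, 3)`, the exceptions of the second part
(`AboveThreshold.mul_add_lt`). All inclusions are into families of known size, so equality forces
equality of families.
-/


/-! ### Stirling numbers of the second kind -/

/-- Powers in the basis of falling factorials, evaluated at natural numbers. -/
theorem sum_stirlingSecond_mul_descFactorial (m x N : ℕ) (h : m ≤ N) :
    ∑ i ∈ range (N + 1), Nat.stirlingSecond m i * x.descFactorial i = x ^ m := by
  induction m with
  | zero =>
    rw [Finset.sum_eq_single 0]
    · simp
    · intro i _ hi
      obtain ⟨i, rfl⟩ := Nat.exists_eq_succ_of_ne_zero hi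
      simp
    · simp
  | succ m ih =>
    rw [pow_succ, ← ih (by omega), Finset.sum_mul]
    have hx : ∀ i, x.descFactorial i * x = x.descFactorial (i + 1) + i * x.descFactorial i := by
      intro i
      rw [Nat.descFactorial_succ, ← add_mul]
      rcases le_or_gt i x with h | h
      · rw [Nat.sub_add_cancel h, mul_comm]
      · rw [Nat.descFactorial_of_lt h]; simp
    simp_rw [mul_assoc, hx, mul_add]
    rw [Finset.sum_add_distrib, Finset.sum_range_succ', Finset.sum_range_succ
      (fun i => Nat.stirlingSecond m i * x.descFactorial (i + 1)),
      Nat.stirlingSecond_eq_zero_of_lt (show m < N by omega)]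
    simp only [Nat.stirlingSecond_succ_succ, Nat.stirlingSecond_succ_zero, zero_mul, add_zero,
      add_mul, Finset.sum_add_distrib]
    rw [Finset.sum_range_succ' (fun i => Nat.stirlingSecond m i * (i * _))]
    simp only [zero_mul, mul_zero, add_zero, add_mul]
    simp only [← Finset.sum_add_distrib]
    exact Finset.sum_congr rfl fun i _ => by ring

theorem factorial_mul_stirlingSecond_le (m j : ℕ) :
    j.factorial * Nat.stirlingSecond m j ≤ j ^ m := by
  rw [← sum_stirlingSecond_mul_descFactorial m j (m + j) (by omega), mul_comm,
    ← Nat.descFactorial_self]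
  exact Finset.single_le_sum (f := fun i => Nat.stirlingSecond m i * j.descFactorial i)
    (fun _ _ => Nat.zero_le _) (Finset.mem_range.2 (by omega))

/-- The union bound for maps that are not surjective. -/
theorem pow_le_factorial_mul_stirlingSecond (m j : ℕ) :
    (j + 1) ^ m ≤ (j + 1).factorial * Nat.stirlingSecond m (j + 1) + (j + 1) * j ^ m := by
  rw [← sum_stirlingSecond_mul_descFactorial m (j + 1) (m + j + 1) (by omega),
    ← sum_stirlingSecond_mul_descFactorial m j (m + j + 1) (by omega), Finset.mul_sum]
  have hmem : j + 1 ∈ range (m + j + 1 + 1) := Finset.mem_range.2 (by omega)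
  rw [← Finset.add_sum_erase _ _ hmem, Nat.descFactorial_self, mul_comm (Nat.stirlingSecond _ _)]
  refine Nat.add_le_add_left ?_ _
  refine (Finset.sum_le_sum fun i hi => ?_).trans
    (Finset.sum_le_sum_of_subset (Finset.erase_subset _ _))
  have hij : i ≠ j + 1 := (Finset.mem_erase.1 hi).1
  rw [mul_left_comm]
  refine Nat.mul_le_mul_left _ ?_
  rcases lt_or_gt_of_ne hij with h | h
  · have h1 := Nat.succ_descFactorial j i
    have h2 : 1 ≤ j + 1 - i := by omega
    calc (j + 1).descFactorial i ≤ (j + 1 - i) * (j + 1).descFactorial i :=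
          Nat.le_mul_of_pos_left _ h2
      _ = _ := h1
  · rw [Nat.descFactorial_of_lt h]; exact Nat.zero_le _

theorem stirlingSecond_two_right (m : ℕ) : Nat.stirlingSecond (m + 1) 2 + 1 = 2 ^ m := by
  induction m with
  | zero => simp [Nat.stirlingSecond]
  | succ m ih =>
    have h : Nat.stirlingSecond (m + 2) 2 =
        2 * Nat.stirlingSecond (m + 1) 2 + Nat.stirlingSecond (m + 1) 1 :=
      Nat.stirlingSecond_succ_succ (m + 1) 1
    rw [Nat.stirlingSecond_one_right] at h
    rw [h, pow_succ]
    omega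

theorem stirlingSecond_mono_left (k : ℕ) {m m' : ℕ} (h : m ≤ m') :
    Nat.stirlingSecond m (k + 1) ≤ Nat.stirlingSecond m' (k + 1) := by
  induction h with
  | refl => exact le_rfl
  | step _ ih =>
    rw [Nat.stirlingSecond_succ_succ]
    nlinarith [Nat.zero_le k]

theorem mul_stirlingSecond_le_succ (m k : ℕ) :
    k * Nat.stirlingSecond m k ≤ Nat.stirlingSecond (m + 1) k := by
  cases k with
  | zero => simp
  | succ k => rw [Nat.stirlingSecond_succ_succ]; omega

theorem stirlingSecond_pos {m k : ℕ} (h : k ≤ m) : 1 ≤ Nat.stirlingSecond (m + 1) (k + 1) := by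
  induction m generalizing k with
  | zero => obtain rfl : k = 0 := by omega
            simp [Nat.stirlingSecond]
  | succ m ih =>
    rw [Nat.stirlingSecond_succ_succ]
    rcases Nat.lt_or_ge m k with hk | hk
    · obtain ⟨k, rfl⟩ : ∃ j, k = j + 1 := ⟨k - 1, by omega⟩
      have := ih (k := k) (by omega)
      omega
    · have := ih hk
      nlinarith [Nat.zero_le k]

theorem stirlingSecond_succ_succ_eq_sum_choose (n k : ℕ) :
    Nat.stirlingSecond (n + 1) (k + 1) =
      ∑ j ∈ range (n + 1), n.choose j * Nat.stirlingSecond j k := by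
  induction n generalizing k with
  | zero => cases k <;> simp [Nat.stirlingSecond]
  | succ n ih =>
    have key : ∑ j ∈ range (n + 1 + 1), (n + 1).choose j * Nat.stirlingSecond j k =
        (∑ j ∈ range (n + 1), n.choose j * Nat.stirlingSecond (j + 1) k) +
        ∑ j ∈ range (n + 1), n.choose j * Nat.stirlingSecond j k := by
      rw [Finset.sum_range_succ']
      simp only [Nat.choose_succ_succ', add_mul, Finset.sum_add_distrib]
      rw [Finset.sum_range_succ' (fun j => n.choose j * Nat.stirlingSecond j k),
        Finset.sum_range_succ (fun j => n.choose (j + 1) * Nat.stirlingSecond (j + 1) k)]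
      simp [add_assoc]
    rw [key, Nat.stirlingSecond_succ_succ, ih k]
    cases k with
    | zero => simp
    | succ k =>
      rw [ih k]
      simp only [Nat.stirlingSecond_succ_succ, mul_add, Finset.sum_add_distrib, Finset.mul_sum,
        add_mul, one_mul]
      simp only [← Finset.sum_add_distrib]
      exact Finset.sum_congr rfl fun j _ => by ring

/-! ### Estimates for Stirling numbers above the threshold -/

/-- As `(1 + 1 / j) ^ j ≥ 2`, a power of `1 + 1 / j` whose exponent is logarithmic in `Y` exceeds
`Y`. -/
theorem mul_pow_le_succ_pow {j p : ℕ} (hj : 1 ≤ j) {Y : ℝ} (hY : 0 < Y)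
    (h : j * Real.logb 2 Y ≤ p) : Y * (j : ℝ) ^ p ≤ ((j : ℝ) + 1) ^ p := by
  have hj0 : (0 : ℝ) < j := by exact_mod_cast hj
  have h2 : (2 : ℝ) ≤ (1 + 1 / (j : ℝ)) ^ j := by
    have := one_add_mul_le_pow (a := 1 / (j : ℝ)) (by have := one_div_pos.2 hj0; linarith) j
    rw [mul_one_div_cancel hj0.ne'] at this
    linarith
  have hlog2 : Real.log 2 ≤ j * Real.log (1 + 1 / (j : ℝ)) := by
    rw [← Real.log_pow]
    exact Real.log_le_log (by norm_num) h2
  have hl2 : 0 < Real.log 2 := Real.log_pos (by norm_num)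
  have hlog : Real.log Y ≤ p * Real.log (1 + 1 / (j : ℝ)) := by
    have e : Real.log Y = Real.logb 2 Y * Real.log 2 := by
      rw [Real.logb, div_mul_cancel₀ _ hl2.ne']
    have hu : 0 < Real.log (1 + 1 / (j : ℝ)) :=
      Real.log_pos (by have := one_div_pos.2 hj0; linarith)
    rcases le_or_gt (Real.logb 2 Y) 0 with hn | hp
    · have : Real.log Y ≤ 0 := by rw [e]; exact mul_nonpos_of_nonpos_of_nonneg hn hl2.le
      exact this.trans (by positivity)
    · calc Real.log Y = Real.logb 2 Y * Real.log 2 := e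
        _ ≤ Real.logb 2 Y * (j * Real.log (1 + 1 / (j : ℝ))) := by gcongr
        _ = (j * Real.logb 2 Y) * Real.log (1 + 1 / (j : ℝ)) := by ring
        _ ≤ _ := by gcongr
  have hY' : Y ≤ (1 + 1 / (j : ℝ)) ^ p := by
    rw [← Real.log_pow] at hlog
    exact (Real.log_le_log_iff hY (by positivity)).1 hlog
  calc Y * (j : ℝ) ^ p ≤ (1 + 1 / (j : ℝ)) ^ p * (j : ℝ) ^ p := by gcongr
    _ = ((j : ℝ) + 1) ^ p := by
      rw [← mul_pow, add_mul, one_div_mul_cancel hj0.ne', one_mul]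

/-- The size condition under which all estimates are made. With `M = n - t - 1` and
`K = k - t` it is the inequality `2 * L(k, t) ≤ n`. -/
def AboveThreshold (t K M : ℕ) : Prop :=
  (t : ℝ) + 1 + 2 * ((K : ℝ) + 1) * Real.logb 2 (((t + 1) * (K + 1) : ℕ) : ℝ) ≤ M

theorem aboveThreshold_of_two_mul_thresholdL_le {n t k : ℕ} (htk : t + 1 ≤ n) (hk : t ≤ k)
    (h : 2 * thresholdL k t ≤ (n : ℝ)) : AboveThreshold t (k - t) (n - t - 1) := by
  unfold AboveThreshold
  unfold thresholdL at h
  rw [Nat.sub_sub, Nat.cast_sub htk]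
  push_cast [Nat.cast_sub hk] at *
  linarith

section

variable {t K M : ℕ}

theorem three_le_logb {t K : ℕ} (ht : 1 ≤ t) (hK : 3 ≤ K) :
    3 ≤ Real.logb 2 (((t + 1) * (K + 1) : ℕ) : ℝ) := by
  rw [Real.le_logb_iff_rpow_le (by norm_num) (by positivity)]
  have : (8 : ℕ) ≤ (t + 1) * (K + 1) := by nlinarith
  have h : ((8 : ℕ) : ℝ) ≤ (((t + 1) * (K + 1) : ℕ) : ℝ) := by exact_mod_cast this
  norm_num at h ⊢
  exact h

theorem two_le_logb {t K : ℕ} (ht : 1 ≤ t) (hK : 2 ≤ K) :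
    2 ≤ Real.logb 2 (((t + 1) * (K + 1) : ℕ) : ℝ) := by
  rw [Real.le_logb_iff_rpow_le (by norm_num) (by positivity)]
  have : (4 : ℕ) ≤ (t + 1) * (K + 1) := by nlinarith
  have h : ((4 : ℕ) : ℝ) ≤ (((t + 1) * (K + 1) : ℕ) : ℝ) := by exact_mod_cast this
  norm_num at h ⊢
  exact h

theorem AboveThreshold.lt (h : AboveThreshold t K M) (ht : 1 ≤ t) (hK : 2 ≤ K) :
    4 * K + 4 + t < M := by
  have h2 := two_le_logb ht hK
  unfold AboveThreshold at h
  have : (4 * K + 4 + t : ℝ) < M := by nlinarith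
  exact_mod_cast this

/-- Consecutive Stirling numbers along a diagonal differ by a factor of at least `Q²` with
`Q = (t + 1) * (K + 1)`. -/
theorem AboveThreshold.sq_mul_stirlingSecond_le (h : AboveThreshold t K M) (ht : 1 ≤ t)
    (hK : 2 ≤ K) {i j : ℕ} (hij : i + j + 1 ≤ K) :
    ((t + 1) * (K + 1)) ^ 2 * Nat.stirlingSecond (M - i) j ≤
      Nat.stirlingSecond (M - i + 1) (j + 1) := by
  have hlt := h.lt ht hK
  rcases Nat.eq_zero_or_pos j with rfl | hj
  · obtain ⟨p, hp⟩ : ∃ p, M - i = p + 1 := ⟨M - i - 1, by omega⟩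
    rw [hp, Nat.stirlingSecond_succ_zero]
    simp
  set Q := (t + 1) * (K + 1) with hQ
  have hl := two_le_logb ht hK
  have hQpos : (0 : ℝ) < (Q : ℝ) := by positivity
  obtain ⟨p, hp⟩ : ∃ p, M - i = p + 1 := ⟨M - i - 1, by omega⟩
  have hpow : (Q : ℝ) ^ 2 * (j : ℝ) ^ p ≤ ((j : ℝ) + 1) ^ p := by
    refine mul_pow_le_succ_pow hj (by positivity) ?_
    rw [Real.logb_pow]
    have hpR : (p : ℝ) = M - i - 1 := by
      have : (M : ℝ) = p + 1 + i := by
        have : M = p + 1 + i := by omega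
        exact_mod_cast this
      linarith
    have hijR : (i : ℝ) + j + 1 ≤ K := by exact_mod_cast hij
    have ht0 : (1 : ℝ) ≤ t := by exact_mod_cast ht
    unfold AboveThreshold at h
    rw [hpR]
    push_cast
    nlinarith [Nat.cast_nonneg (α := ℝ) i]
  have hpow' : Q ^ 2 * j ^ p ≤ (j + 1) ^ p := by exact_mod_cast hpow
  have hpow2 : (Q ^ 2 + j) * j ^ (p + 1) ≤ (j + 1) ^ (p + 1) := by
    have hjQ : j * j ≤ Q ^ 2 := by
      have : j ≤ Q := by rw [hQ]; nlinarith
      nlinarith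
    calc (Q ^ 2 + j) * j ^ (p + 1) = (Q ^ 2 * j + j * j) * j ^ p := by ring
      _ ≤ (Q ^ 2 * j + Q ^ 2) * j ^ p := by gcongr
      _ = (Q ^ 2 * j ^ p) * (j + 1) := by ring
      _ ≤ (j + 1) ^ p * (j + 1) := by gcongr
      _ = _ := by ring
  have hlow := pow_le_factorial_mul_stirlingSecond (p + 1 + 1) j
  have hup := factorial_mul_stirlingSecond_le (p + 1) j
  rw [hp]
  have hfac : 0 < (j + 1) * j.factorial := by positivity
  refine Nat.le_of_mul_le_mul_left ?_ hfac
  rw [Nat.factorial_succ] at hlow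
  have h3 : (j + 1) * ((Q ^ 2 + j) * j ^ (p + 1)) ≤ (j + 1) * (j + 1) ^ (p + 1) :=
    Nat.mul_le_mul_left _ hpow2
  have h4 : (j + 1) * Q ^ 2 * (j.factorial * Nat.stirlingSecond (p + 1) j) ≤
      (j + 1) * Q ^ 2 * j ^ (p + 1) := Nat.mul_le_mul_left _ hup
  have e1 : (j + 1) ^ (p + 1 + 1) = (j + 1) * (j + 1) ^ (p + 1) := by ring
  have e2 : (j + 1) * j ^ (p + 1 + 1) = (j + 1) * (j * j ^ (p + 1)) := by ring
  rw [e1, e2] at hlow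
  nlinarith

/-- Up to the relative error `1 / (4 * (K + 1))` the number of surjections onto a `j`-element set
is the number of all maps. -/
theorem AboveThreshold.pow_le (h : AboveThreshold t K M) (ht : 1 ≤ t)
    (hK : 2 ≤ K) {j p : ℕ} (hj : 1 ≤ j) (hjK : j ≤ K) (hp : M ≤ p + 1) :
    (4 * K + 3) * j ^ p ≤ (4 * K + 4) * (j.factorial * Nat.stirlingSecond p j) := by
  have hlt := h.lt ht hK
  set Q := (t + 1) * (K + 1) with hQ
  have hl := two_le_logb ht hK
  obtain ⟨j, rfl⟩ : ∃ i, j = i + 1 := ⟨j - 1, by omega⟩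
  have hpow' : Q ^ 2 * j ^ p ≤ (j + 1) ^ p := by
    rcases Nat.eq_zero_or_pos j with rfl | hj'
    · rw [zero_pow (by omega)]; simp
    have hpow : (Q : ℝ) ^ 2 * (j : ℝ) ^ p ≤ ((j : ℝ) + 1) ^ p := by
      refine mul_pow_le_succ_pow hj' (by positivity) ?_
      rw [Real.logb_pow]
      have hpR : (M : ℝ) ≤ p + 1 := by exact_mod_cast hp
      have hijR : (j : ℝ) + 1 ≤ K := by exact_mod_cast hjK
      have ht0 : (1 : ℝ) ≤ t := by exact_mod_cast ht
      unfold AboveThreshold at h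
      push_cast
      nlinarith
    exact_mod_cast hpow
  have hlow := pow_le_factorial_mul_stirlingSecond p j
  have h1 : (4 * K + 4) * (j + 1) ≤ Q ^ 2 := by
    rw [hQ]
    calc (4 * K + 4) * (j + 1) ≤ (4 * K + 4) * (K + 1) := by gcongr; omega
      _ = 2 ^ 2 * (K + 1) ^ 2 := by ring
      _ ≤ (t + 1) ^ 2 * (K + 1) ^ 2 := by gcongr; omega
      _ = _ := by ring
  have h2 : (4 * K + 4) * (j + 1) * j ^ p ≤ (j + 1) ^ p :=
    (Nat.mul_le_mul_right _ h1).trans hpow'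
  nlinarith

theorem AboveThreshold.two_pow_mul_pow_five_le (h : AboveThreshold t K M) (ht : 1 ≤ t)
    (hK : 2 ≤ K) {p : ℕ} (hp : M + 2 ≤ p + K) :
    2 ^ (t + 1) * ((t + 1) * (K + 1)) ^ 5 ≤ 2 ^ p := by
  have hlt := h.lt ht hK
  have hl := two_le_logb ht hK
  set Q := (t + 1) * (K + 1) with hQ
  have hQ0 : (0 : ℝ) < Q := by positivity
  have : ((2 : ℝ) ^ (t + 1) * (Q : ℝ) ^ 5) * ((1 : ℕ) : ℝ) ^ p ≤ (((1 : ℕ) : ℝ) + 1) ^ p := by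
    refine mul_pow_le_succ_pow le_rfl (by positivity) ?_
    rw [Real.logb_mul (by positivity) (by positivity), Real.logb_pow, Real.logb_pow,
      Real.logb_self_eq_one (by norm_num)]
    have hKR : (2 : ℝ) ≤ K := by exact_mod_cast hK
    have hpR : (M : ℝ) + 2 ≤ p + K := by exact_mod_cast hp
    unfold AboveThreshold at h
    push_cast
    nlinarith
  norm_num at this
  exact_mod_cast this

theorem AboveThreshold.pow_five_le_stirlingSecond (h : AboveThreshold t K M) (ht : 1 ≤ t)
    (hK : 2 ≤ K) {i : ℕ} (hi : i + 2 ≤ K) :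
    ((t + 1) * (K + 1)) ^ 5 ≤ Nat.stirlingSecond (M - i + 1) 2 := by
  have hlt := h.lt ht hK
  have h1 := h.two_pow_mul_pow_five_le ht hK (p := M - i) (by omega)
  have h2 := stirlingSecond_two_right (M - i)
  have h3 : 2 * ((t + 1) * (K + 1)) ^ 5 ≤ 2 ^ (t + 1) * ((t + 1) * (K + 1)) ^ 5 := by
    gcongr
    calc 2 = 2 ^ 1 := rfl
      _ ≤ 2 ^ (t + 1) := Nat.pow_le_pow_right (by norm_num) (by omega)
  have h4 : 1 ≤ ((t + 1) * (K + 1)) ^ 5 := Nat.one_le_pow _ _ (by positivity)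
  omega

/-- Reduces a comparison of the two products of Stirling numbers to one of powers, at the cost of
the relative error of `AboveThreshold.pow_le` in each of two factors; the factorials cancel. -/
theorem AboveThreshold.mul_le_of_pow_le (h : AboveThreshold t K M) (ht : 1 ≤ t)
    {K₂ : ℕ} (hK₂ : 2 ≤ K₂) (hK : K₂ < K) {X : ℝ} (hX : 0 ≤ X)
    (hpow : X * (K * (K₂ - 1) : ℝ) ^ M ≤
      ((4 * K + 3 : ℝ) / (4 * K + 4)) ^ 2 * (((K : ℝ) - 1) * K₂) ^ M) :
    X * (Nat.stirlingSecond (M + 1) K * Nat.stirlingSecond M (K₂ - 1)) ≤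
      (Nat.stirlingSecond M (K - 1) * Nat.stirlingSecond (M + 1) K₂ : ℝ) := by
  obtain ⟨K, rfl⟩ : ∃ i, K = i + 1 := ⟨K - 1, by omega⟩
  obtain ⟨K₂, rfl⟩ : ∃ i, K₂ = i + 1 := ⟨K₂ - 1, by omega⟩
  have ha1 : (4 * (K + 1 : ℕ) + 3 : ℝ) * K ^ M ≤
      (4 * (K + 1 : ℕ) + 4) * (K.factorial * Nat.stirlingSecond M K) := by
    exact_mod_cast h.pow_le ht (by omega) (j := K) (p := M) (by omega) (by omega) (by omega)
  have hb0 : (4 * (K + 1 : ℕ) + 3 : ℝ) * (K₂ + 1) ^ (M + 1) ≤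
      (4 * (K + 1 : ℕ) + 4) * ((K₂ + 1).factorial * Nat.stirlingSecond (M + 1) (K₂ + 1)) := by
    exact_mod_cast h.pow_le ht (by omega) (j := K₂ + 1) (p := M + 1) (by omega) (by omega)
      (by omega)
  have ha0 : ((K + 1).factorial * Nat.stirlingSecond (M + 1) (K + 1) : ℝ) ≤
      (K + 1) ^ (M + 1) := by exact_mod_cast factorial_mul_stirlingSecond_le (M + 1) (K + 1)
  have hb1 : (K₂.factorial * Nat.stirlingSecond M K₂ : ℝ) ≤ K₂ ^ M := by
    exact_mod_cast factorial_mul_stirlingSecond_le M K₂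
  rw [Nat.factorial_succ] at hb0 ha0
  push_cast at ha1 hb0 ha0 hpow ⊢
  simp only [add_sub_cancel_right] at hpow ⊢
  set a₀ : ℝ := ((Nat.stirlingSecond (M + 1) (K + 1) : ℕ) : ℝ)
  set a₁ : ℝ := ((Nat.stirlingSecond M K : ℕ) : ℝ)
  set b₀ : ℝ := ((Nat.stirlingSecond (M + 1) (K₂ + 1) : ℕ) : ℝ)
  set b₁ : ℝ := ((Nat.stirlingSecond M K₂ : ℕ) : ℝ)
  have hf : (0 : ℝ) < K.factorial := by positivity
  have hf₂ : (0 : ℝ) < K₂.factorial := by positivity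
  have hc : (0 : ℝ) < 4 * ((K : ℝ) + 1) + 4 := by positivity
  have ha1' : (4 * ((K : ℝ) + 1) + 3) / (4 * ((K : ℝ) + 1) + 4) * K ^ M ≤ K.factorial * a₁ := by
    rw [div_mul_eq_mul_div, div_le_iff₀ hc]; linarith
  have hb0' : (4 * ((K : ℝ) + 1) + 3) / (4 * ((K : ℝ) + 1) + 4) * (K₂ + 1) ^ M ≤
      K₂.factorial * b₀ := by
    rw [div_mul_eq_mul_div, div_le_iff₀ hc]
    have : (0 : ℝ) < K₂ + 1 := by positivity
    refine le_of_mul_le_mul_left ?_ this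
    rw [pow_succ] at hb0
    linarith
  have ha0' : K.factorial * a₀ ≤ ((K : ℝ) + 1) ^ M := by
    have : (0 : ℝ) < K + 1 := by positivity
    refine le_of_mul_le_mul_left ?_ this
    rw [pow_succ] at ha0
    linarith
  set e : ℝ := (4 * ((K : ℝ) + 1) + 3) / (4 * ((K : ℝ) + 1) + 4)
  refine le_of_mul_le_mul_left (a := (K.factorial * K₂.factorial : ℝ)) ?_ (by positivity)
  calc (K.factorial * K₂.factorial : ℝ) * (X * (a₀ * b₁))
      = X * ((K.factorial * a₀) * (K₂.factorial * b₁)) := by ring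
    _ ≤ X * (((K : ℝ) + 1) ^ M * K₂ ^ M) := by gcongr
    _ = X * (((K : ℝ) + 1) * K₂) ^ M := by rw [mul_pow]
    _ ≤ e ^ 2 * (K * (K₂ + 1)) ^ M := hpow
    _ = (e * K ^ M) * (e * (K₂ + 1) ^ M) := by rw [mul_pow]; ring
    _ ≤ (K.factorial * a₁) * (K₂.factorial * b₀) := by gcongr
    _ = _ := by ring

/-- For `K₂ < K` the two ways of giving one family the larger index differ by a definite
factor. -/
theorem AboveThreshold.four_mul_le (h : AboveThreshold t K M) (ht : 1 ≤ t)
    {K₂ : ℕ} (hK₂ : 2 ≤ K₂) (hK : K₂ < K) :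
    4 * (K + 2) * (Nat.stirlingSecond (M + 1) K * Nat.stirlingSecond M (K₂ - 1)) ≤
      (4 * K₂ - 1) * (Nat.stirlingSecond M (K - 1) * Nat.stirlingSecond (M + 1) K₂) := by
  have hlt := h.lt ht (by omega)
  have hl := three_le_logb (K := K) ht (by omega)
  have hK₂R : (2 : ℝ) ≤ K₂ := by exact_mod_cast hK₂
  have hKR : (K₂ : ℝ) + 1 ≤ K := by exact_mod_cast hK
  have hM : 6 * ((K : ℝ) + 1) ≤ M := by
    unfold AboveThreshold at h
    have : (0 : ℝ) ≤ t := by positivity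
    nlinarith
  have key := h.mul_le_of_pow_le ht hK₂ hK (X := 4 * (K + 2) / (4 * K₂ - 1))
    (by apply div_nonneg <;> linarith) ?_
  · rw [div_mul_eq_mul_div, div_le_iff₀ (by linarith)] at key
    have e : (((4 * K₂ - 1 : ℕ) : ℝ)) = 4 * K₂ - 1 := by
      rw [Nat.cast_sub (by omega)]; push_cast; ring
    have : ((4 * (K + 2) * (Nat.stirlingSecond (M + 1) K * Nat.stirlingSecond M (K₂ - 1)) : ℕ) : ℝ)
      ≤ ((4 * K₂ - 1) * (Nat.stirlingSecond M (K - 1) * Nat.stirlingSecond (M + 1) K₂) : ℕ) := by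
      rw [Nat.cast_mul (4 * K₂ - 1), e]
      push_cast
      linarith
    exact_mod_cast this
  · have hA : (0 : ℝ) < K * (K₂ - 1) := mul_pos (by linarith) (by linarith)
    have hB : (((K : ℝ) - 1) * K₂) = (K * (K₂ - 1)) * (1 + (K - K₂) / (K * (K₂ - 1))) := by
      rw [mul_add, mul_div_cancel₀ _ hA.ne']; ring
    have hbern : 1 + 6 * ((K : ℝ) - K₂) / (K₂ - 1) ≤
        (1 + ((K : ℝ) - K₂) / (K * (K₂ - 1))) ^ M := by
      have h0 : 0 ≤ ((K : ℝ) - K₂) / (K * (K₂ - 1)) := div_nonneg (by linarith) hA.le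
      refine le_trans ?_ (one_add_mul_le_pow (by linarith) M)
      have h1 : 6 * ((K : ℝ) - K₂) / (K₂ - 1) = 6 * K * (((K : ℝ) - K₂) / (K * (K₂ - 1))) := by
        have : (K : ℝ) ≠ 0 := by linarith
        have : (K₂ : ℝ) - 1 ≠ 0 := by linarith
        field_simp
      rw [h1]
      gcongr
      linarith
    rw [hB, mul_pow _ (1 + _), mul_left_comm, mul_comm (_ ^ M) (_ * _)]
    refine mul_le_mul_of_nonneg_right ?_ (pow_nonneg hA.le _)
    refine le_trans ?_ (mul_le_mul_of_nonneg_left hbern (sq_nonneg _))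
    -- what is left is a rational inequality in `d = K - K₂ ≥ 1` and `x = K₂ - 1 ≥ 1`
    have h1 : (1 - 1 / (2 * (K : ℝ) + 2)) ≤ ((4 * K + 3 : ℝ) / (4 * K + 4)) ^ 2 := by
      have : (4 * K + 3 : ℝ) / (4 * K + 4) = 1 - 1 / (4 * K + 4) := by
        field_simp; ring
      rw [this]
      have h2 : 1 / (2 * (K : ℝ) + 2) = 2 * (1 / (4 * K + 4)) := by field_simp; ring
      rw [h2]
      nlinarith [sq_nonneg (1 / (4 * (K : ℝ) + 4))]
    have h3 : 0 ≤ 1 + 6 * ((K : ℝ) - K₂) / (K₂ - 1) := by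
      have : 0 ≤ 6 * ((K : ℝ) - K₂) / (K₂ - 1) := div_nonneg (by linarith) (by linarith)
      linarith
    refine le_trans ?_ (mul_le_mul_of_nonneg_right h1 h3)
    obtain ⟨d, hd⟩ : ∃ d : ℝ, (K : ℝ) = K₂ + d := ⟨K - K₂, by ring⟩
    obtain ⟨x, hx⟩ : ∃ x : ℝ, (K₂ : ℝ) = x + 1 := ⟨K₂ - 1, by ring⟩
    have hd1 : 1 ≤ d := by linarith
    have hx1 : 1 ≤ x := by linarith
    rw [hd, hx]
    have e1 : 1 - 1 / (2 * (x + 1 + d) + 2) = (2 * (x + 1 + d) + 1) / (2 * (x + 1 + d) + 2) := by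
      field_simp; ring
    have e2 : 1 + 6 * (x + 1 + d - (x + 1)) / (x + 1 - 1) = (x + 6 * d) / x := by
      have : x + 1 - 1 = x := by ring
      rw [this]; field_simp; ring
    rw [e1, e2, div_mul_div_comm, div_le_div_iff₀ (by nlinarith) (by positivity)]
    nlinarith [mul_nonneg (sub_nonneg.2 hd1) (sub_nonneg.2 hx1),
      mul_nonneg (mul_nonneg (sub_nonneg.2 hd1) (sub_nonneg.2 hx1)) (sub_nonneg.2 hx1),
      mul_nonneg (mul_nonneg (sub_nonneg.2 hd1) (sub_nonneg.2 hx1)) (sub_nonneg.2 hd1),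
      sq_nonneg (x - 1), sq_nonneg (d - 1)]

/-- The analogue of `AboveThreshold.four_mul_le` for `K₂ = 2`, where the gain is exponential. -/
theorem AboveThreshold.sq_mul_le (h : AboveThreshold t K M) (ht : 1 ≤ t) (hK : 2 < K) :
    ((t + 1) * (K + 1)) ^ 2 * Nat.stirlingSecond (M + 1) K ≤
      Nat.stirlingSecond M (K - 1) * Nat.stirlingSecond (M + 1) 2 := by
  have hl := three_le_logb (K := K) ht (by omega)
  set Q := (t + 1) * (K + 1) with hQ
  have hQ8 : 8 ≤ Q := by rw [hQ]; nlinarith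
  have hQ8R : (8 : ℝ) ≤ Q := by exact_mod_cast hQ8
  have hKR : (3 : ℝ) ≤ K := by exact_mod_cast hK
  have key := h.mul_le_of_pow_le ht (K₂ := 2) le_rfl hK (X := (Q : ℝ) ^ 2) (by positivity) ?_
  · have hM : 1 ≤ M := by have := h.lt ht (by omega); omega
    obtain ⟨p, rfl⟩ : ∃ p, M = p + 1 := ⟨M - 1, by omega⟩
    rw [Nat.stirlingSecond_one_right, Nat.cast_one, mul_one] at key
    exact_mod_cast key
  · have h43 : ∀ p : ℕ, 8 * Real.logb 2 Q ≤ p → (Q : ℝ) ^ 3 ≤ (4 / 3 : ℝ) ^ p := by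
      intro p hp
      have hQ0 : (0 : ℝ) < Q := by linarith
      rw [← Real.log_le_log_iff (by positivity) (by positivity), Real.log_pow, Real.log_pow]
      have h2 : Real.log Q = Real.logb 2 Q * Real.log 2 := by
        rw [Real.logb, div_mul_cancel₀ _ (Real.log_pos (by norm_num)).ne']
      have h3 : 3 * Real.log 2 ≤ 8 * Real.log (4 / 3) := by
        have := Real.log_le_log (x := (2 : ℝ) ^ 3) (y := (4 / 3 : ℝ) ^ 8) (by norm_num)
          (by norm_num)
        rw [Real.log_pow, Real.log_pow] at this
        exact_mod_cast this
      have h4 : 0 < Real.log (4 / 3) := Real.log_pos (by norm_num)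
      rw [h2]
      push_cast
      nlinarith
    have hMR : 8 * Real.logb 2 Q ≤ M := by
      unfold AboveThreshold at h
      have : (0 : ℝ) ≤ t := by positivity
      nlinarith
    have h5 : (4 / 3 : ℝ) ^ M * K ^ M ≤ (((K : ℝ) - 1) * 2) ^ M := by
      rw [← mul_pow]
      refine pow_le_pow_left₀ (by positivity) (by linarith) _
    have h6 : (1 / 2 : ℝ) ≤ ((4 * K + 3 : ℝ) / (4 * K + 4)) ^ 2 := by
      have : (15 / 16 : ℝ) ≤ (4 * K + 3 : ℝ) / (4 * K + 4) := by
        rw [div_le_div_iff₀ (by norm_num) (by positivity)]; linarith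
      nlinarith
    have h7 := h43 M hMR
    push_cast
    have e : (K : ℝ) * (2 - 1) = K := by ring
    rw [e]
    calc (Q : ℝ) ^ 2 * (K : ℝ) ^ M ≤ (1 / 2 * (Q : ℝ) ^ 3) * (K : ℝ) ^ M := by
          gcongr; nlinarith [sq_nonneg (Q : ℝ)]
      _ ≤ (1 / 2 * (4 / 3) ^ M) * (K : ℝ) ^ M := by gcongr
      _ = 1 / 2 * ((4 / 3) ^ M * (K : ℝ) ^ M) := by ring
      _ ≤ ((4 * K + 3 : ℝ) / (4 * K + 4)) ^ 2 * (((K : ℝ) - 1) * 2) ^ M := by gcongr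

/-- The comparison of lower order terms that decides between the two extremal configurations when
`k₂ = 2 * t + 1`. It fails for `K = t + 1`. -/
theorem AboveThreshold.mul_add_lt (h : AboveThreshold t K M) (ht : 1 ≤ t) (hK : t + 1 < K)
    (h43 : t = 1 → K ≠ 3) :
    Nat.stirlingSecond M (K - 1) * (Nat.stirlingSecond M t + t + 1) <
      Nat.stirlingSecond (M - 1) (K - 2) * Nat.stirlingSecond (M + 1) (t + 1) := by
  have hlt := h.lt ht (by omega)
  obtain ⟨K, rfl⟩ : ∃ i, K = i + 2 := ⟨K - 2, by omega⟩
  obtain ⟨N, rfl⟩ : ∃ i, M = i + 1 := ⟨M - 1, by omega⟩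
  simp only [Nat.add_sub_cancel, show K + 2 - 1 = K + 1 from rfl]
  have ha2 : (4 * (K + 2 : ℕ) + 3 : ℝ) * K ^ N ≤
      (4 * (K + 2 : ℕ) + 4) * (K.factorial * Nat.stirlingSecond N K) := by
    exact_mod_cast h.pow_le ht (by omega) (j := K) (p := N) (by omega) (by omega) (by omega)
  have hb0 : (4 * (K + 2 : ℕ) + 3 : ℝ) * (t + 1) ^ (N + 2) ≤
      (4 * (K + 2 : ℕ) + 4) * ((t + 1).factorial * Nat.stirlingSecond (N + 2) (t + 1)) := by
    exact_mod_cast h.pow_le ht (by omega) (j := t + 1) (p := N + 2) (by omega) (by omega)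
      (by omega)
  have ha1 : ((K + 1).factorial * Nat.stirlingSecond (N + 1) (K + 1) : ℝ) ≤
      (K + 1) ^ (N + 1) := by exact_mod_cast factorial_mul_stirlingSecond_le (N + 1) (K + 1)
  have hb1 : (t.factorial * Nat.stirlingSecond (N + 1) t : ℝ) ≤ t ^ (N + 1) := by
    exact_mod_cast factorial_mul_stirlingSecond_le (N + 1) t
  rw [Nat.factorial_succ] at hb0 ha1
  have ha1pos : (1 : ℝ) ≤ Nat.stirlingSecond (N + 1) (K + 1) := by
    exact_mod_cast stirlingSecond_pos (m := N) (k := K) (by omega)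
  have hb1n : 2 ≤ t → ((t + 1) * (K + 2 + 1)) ^ 2 ≤ Nat.stirlingSecond (N + 1) t := by
    intro h2
    obtain ⟨s, rfl⟩ : ∃ s, t = s + 2 := ⟨t - 2, by omega⟩
    have h5 := h.sq_mul_stirlingSecond_le ht (by omega) (i := 1) (j := s + 1) (by omega)
    have h6 := stirlingSecond_pos (m := N - 1) (k := s) (by omega)
    simp only [Nat.add_sub_cancel] at h5
    rw [show N - 1 + 1 = N by omega] at h6
    exact (Nat.le_mul_of_pos_right _ h6).trans h5
  have hb1one : t = 1 → Nat.stirlingSecond (N + 1) t = 1 := by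
    rintro rfl; exact Nat.stirlingSecond_one_right N
  rw [← Nat.cast_lt (α := ℝ)]
  push_cast at ha2 hb0 ha1 ⊢
  set a₁ : ℝ := ((Nat.stirlingSecond (N + 1) (K + 1) : ℕ) : ℝ)
  set a₂ : ℝ := ((Nat.stirlingSecond N K : ℕ) : ℝ)
  set b₀ : ℝ := ((Nat.stirlingSecond (N + 2) (t + 1) : ℕ) : ℝ)
  obtain ⟨b₁, hb₁⟩ : ∃ b₁ : ℝ, b₁ = Nat.stirlingSecond (N + 1) t := ⟨_, rfl⟩
  rw [← hb₁] at hb1 ⊢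
  have hf : (0 : ℝ) < K.factorial := by positivity
  have hf₂ : (0 : ℝ) < t.factorial := by positivity
  have hc : (0 : ℝ) < 4 * ((K : ℝ) + 2) + 4 := by positivity
  have ht0 : (1 : ℝ) ≤ t := by exact_mod_cast ht
  have hKt : (t : ℝ) ≤ K := by exact_mod_cast (show t ≤ K by omega)
  have ha2' : (4 * ((K : ℝ) + 2) + 3) / (4 * ((K : ℝ) + 2) + 4) * K ^ N ≤ K.factorial * a₂ := by
    rw [div_mul_eq_mul_div, div_le_iff₀ hc]; linarith
  have hb0' : (4 * ((K : ℝ) + 2) + 3) / (4 * ((K : ℝ) + 2) + 4) * (t + 1) ^ (N + 1) ≤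
      t.factorial * b₀ := by
    rw [div_mul_eq_mul_div, div_le_iff₀ hc]
    have : (0 : ℝ) < t + 1 := by positivity
    refine le_of_mul_le_mul_left ?_ this
    rw [pow_succ] at hb0
    linarith
  have ha1' : K.factorial * a₁ ≤ ((K : ℝ) + 1) ^ N := by
    have : (0 : ℝ) < K + 1 := by positivity
    refine le_of_mul_le_mul_left ?_ this
    rw [pow_succ] at ha1
    linarith
  set e : ℝ := (4 * ((K : ℝ) + 2) + 3) / (4 * ((K : ℝ) + 2) + 4) with he
  have he2 : 1 - 1 / (2 * (K : ℝ) + 6) ≤ e ^ 2 := by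
    have : e = 1 - 1 / (4 * K + 12) := by
      rw [he]; field_simp; ring
    rw [this]
    have h2 : 1 / (2 * (K : ℝ) + 6) = 2 * (1 / (4 * K + 12)) := by field_simp; ring
    rw [h2]
    nlinarith [sq_nonneg (1 / (4 * (K : ℝ) + 12))]
  have hprod : e ^ 2 * ((K : ℝ) ^ N * (t + 1) ^ (N + 1)) ≤
      (K.factorial * a₂) * (t.factorial * b₀) :=
    calc e ^ 2 * ((K : ℝ) ^ N * (t + 1) ^ (N + 1)) = (e * K ^ N) * (e * (t + 1) ^ (N + 1)) := by
          ring
      _ ≤ _ := by gcongr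
  rcases Nat.lt_or_ge t 2 with ht1 | ht2
  · obtain rfl : t = 1 := by omega
    rw [hb₁, hb1one rfl]
    have hK2 : 2 ≤ K := by have := h43 rfl; omega
    have hK2R : (2 : ℝ) ≤ K := by exact_mod_cast hK2
    have hpow : 3 * ((K : ℝ) + 1) ^ N ≤ (K : ℝ) ^ N * 2 ^ N := by
      calc 3 * ((K : ℝ) + 1) ^ N ≤ (4 / 3) ^ N * (K + 1) ^ N := by
            gcongr
            calc (3 : ℝ) ≤ (4 / 3) ^ 4 := by norm_num
              _ ≤ (4 / 3) ^ N := pow_le_pow_right₀ (by norm_num) (by omega)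
        _ = (4 / 3 * (K + 1)) ^ N := by rw [mul_pow]
        _ ≤ _ := by
            rw [← mul_pow]
            refine pow_le_pow_left₀ (by positivity) (by linarith) _
    have he3 : (9 / 10 : ℝ) ≤ e ^ 2 := by
      refine le_trans ?_ he2
      have : 1 / (2 * (K : ℝ) + 6) ≤ 1 / 10 := by
        apply one_div_le_one_div_of_le <;> linarith
      linarith
    have hP : (0 : ℝ) < (K + 1) ^ N := by positivity
    norm_num at hprod ⊢
    refine lt_of_mul_lt_mul_left (a := (K.factorial : ℝ)) ?_ hf.le
    calc (K.factorial : ℝ) * (a₁ * 3) = 3 * (K.factorial * a₁) := by ring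
      _ ≤ 3 * (K + 1) ^ N := by gcongr
      _ < 9 / 10 * (2 * (3 * (K + 1) ^ N)) := by linarith
      _ ≤ 9 / 10 * (2 * ((K : ℝ) ^ N * 2 ^ N)) := by gcongr
      _ = 9 / 10 * ((K : ℝ) ^ N * 2 ^ (N + 1)) := by rw [pow_succ]; ring
      _ ≤ e ^ 2 * ((K : ℝ) ^ N * 2 ^ (N + 1)) := by gcongr
      _ ≤ _ := hprod
      _ = _ := by ring
  · have hbig : ((t : ℝ) + 1) ^ 2 * 9 ≤ b₁ := by
      have h8 : (t + 1) ^ 2 * 9 ≤ ((t + 1) * (K + 2 + 1)) ^ 2 := by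
        rw [mul_pow]; gcongr; nlinarith [Nat.zero_le K]
      rw [hb₁]
      exact_mod_cast h8.trans (hb1n ht2)
    have hmul : ((K : ℝ) + 1) * t ≤ K * (t + 1) := by nlinarith
    -- `t * a₂ * b₀ ≥ (t + 1/2) * a₁ * b₁`
    have he3 : (t : ℝ) + 1 / 2 ≤ e ^ 2 * (t + 1) := by
      have : (1 / (2 * (K : ℝ) + 6)) * (t + 1) ≤ 1 / 2 := by
        rw [div_mul_eq_mul_div, div_le_div_iff₀ (by positivity) (by norm_num)]; linarith
      nlinarith
    have h9 : ((t : ℝ) + 1 / 2) * (a₁ * b₁) ≤ t * (a₂ * b₀) := by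
      refine le_of_mul_le_mul_left (a := (K.factorial * t.factorial : ℝ)) ?_ (by positivity)
      have hb1nn : 0 ≤ t.factorial * b₁ := by rw [hb₁]; positivity
      calc (K.factorial * t.factorial : ℝ) * (((t : ℝ) + 1 / 2) * (a₁ * b₁))
          = (t + 1 / 2) * ((K.factorial * a₁) * (t.factorial * b₁)) := by ring
        _ ≤ (t + 1 / 2) * ((K + 1) ^ N * t ^ (N + 1)) := by gcongr
        _ = (t + 1 / 2) * t * ((K + 1) * t) ^ N := by rw [mul_pow]; ring
        _ ≤ (e ^ 2 * (t + 1)) * t * (K * (t + 1)) ^ N := by gcongr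
        _ = t * (e ^ 2 * ((K : ℝ) ^ N * (t + 1) ^ (N + 1))) := by rw [mul_pow]; ring
        _ ≤ t * ((K.factorial * a₂) * (t.factorial * b₀)) := by gcongr
        _ = _ := by ring
    have h10 : t * (a₁ * (b₁ + t + 1)) < (t + 1 / 2) * (a₁ * b₁) := by
      have : 0 < a₁ * (1 / 2 * b₁ - t * (t + 1)) := by
        apply mul_pos (by linarith); nlinarith
      nlinarith
    exact lt_of_mul_lt_mul_left (h10.trans_le h9) (by linarith)

end

/-! ### Counting partitions with prescribed blocks -/

section

variable {α : Type*}

/-- A partial partition: a set of pairwise disjoint nonempty blocks, with no condition on what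
they cover. -/
def IsPartialPartition (X : Finset (Finset α)) : Prop :=
  (∀ B ∈ X, B.Nonempty) ∧ ∀ B ∈ X, ∀ C ∈ X, ∀ x ∈ B, x ∈ C → B = C

theorem IsPartialPartition.mono {X Y : Finset (Finset α)} (hY : IsPartialPartition Y)
    (h : X ⊆ Y) : IsPartialPartition X :=
  ⟨fun B hB => hY.1 B (h hB), fun B hB C hC => hY.2 B (h hB) C (h hC)⟩

theorem isPartialPartition_singleton {B : Finset α} (hB : B.Nonempty) :
    IsPartialPartition {B} := by
  refine ⟨fun C hC => ?_, fun C hC D hD _ _ _ => ?_⟩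
  · rwa [mem_singleton.1 hC]
  · rw [mem_singleton.1 hC, mem_singleton.1 hD]

variable [DecidableEq α]

theorem mem_sup_id {X : Finset (Finset α)} {x : α} : x ∈ X.sup id ↔ ∃ B ∈ X, x ∈ B := by
  simp

theorem IsPartialPartition.union {X Y : Finset (Finset α)} (hX : IsPartialPartition X)
    (hY : IsPartialPartition Y) (hd : ∀ x ∈ X.sup id, x ∉ Y.sup id) :
    IsPartialPartition (X ∪ Y) := by
  refine ⟨fun C hC => ?_, fun C hC D hD x hxC hxD => ?_⟩
  · rcases mem_union.1 hC with h | h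
    exacts [hX.1 C h, hY.1 C h]
  · rcases mem_union.1 hC with h | h <;> rcases mem_union.1 hD with h' | h'
    · exact hX.2 C h D h' x hxC hxD
    · exact absurd (mem_sup_id.2 ⟨D, h', hxD⟩) (hd x (mem_sup_id.2 ⟨C, h, hxC⟩))
    · exact absurd (mem_sup_id.2 ⟨C, h, hxC⟩) (hd x (mem_sup_id.2 ⟨D, h', hxD⟩))
    · exact hY.2 C h D h' x hxC hxD

theorem IsPartialPartition.card_sup_id {X : Finset (Finset α)} (hX : IsPartialPartition X) :
    (X.sup id).card = ∑ B ∈ X, B.card := by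
  rw [Finset.sup_eq_biUnion, Finset.card_biUnion]
  · rfl
  · intro B hB C hC hne
    exact Finset.disjoint_left.2 fun x hx hx' => hne (hX.2 B hB C hC x hx hx')

theorem IsPartialPartition.card_le {X : Finset (Finset α)} (hX : IsPartialPartition X) :
    X.card ≤ (X.sup id).card := by
  rw [hX.card_sup_id, Finset.card_eq_sum_ones]
  exact Finset.sum_le_sum fun B hB => (hX.1 B hB).card_pos

/-- A partial partition covering no more points than it has blocks consists of singletons. -/
theorem IsPartialPartition.lt_card {X : Finset (Finset α)} (hX : IsPartialPartition X)
    {B : Finset α} (hB : B ∈ X) (h : B.card ≠ 1) : X.card < (X.sup id).card := by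
  rw [hX.card_sup_id, Finset.card_eq_sum_ones]
  refine Finset.sum_lt_sum (fun B hB => (hX.1 B hB).card_pos) ⟨B, hB, ?_⟩
  have := (hX.1 B hB).card_pos
  omega

/-- `IsPartitionOf s F` says that `F` is the set of blocks of a partition of `s`. -/
def IsPartitionOf (s : Finset α) (F : Finset (Finset α)) : Prop :=
  IsPartialPartition F ∧ F.sup id = s

variable [Fintype α]

open Classical in
/-- The partitions of `s` into `k` blocks. -/
noncomputable def partitionsOf (s : Finset α) (k : ℕ) : Finset (Finset (Finset α)) :=
  univ.filter fun F => IsPartitionOf s F ∧ F.card = k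

theorem mem_partitionsOf {s : Finset α} {k : ℕ} {F : Finset (Finset α)} :
    F ∈ partitionsOf s k ↔ IsPartitionOf s F ∧ F.card = k := by
  simp [partitionsOf]

theorem card_filter_subset_partitionsOf {s : Finset α} {k : ℕ} {X : Finset (Finset α)}
    (hX : IsPartialPartition X) (hs : X.sup id ⊆ s) (hk : X.card ≤ k) :
    ((partitionsOf s k).filter (X ⊆ ·)).card = (partitionsOf (s \ X.sup id) (k - X.card)).card := by
  have hdisj : ∀ F : Finset (Finset α), IsPartitionOf (s \ X.sup id) F → Disjoint F X := by
    intro F hF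
    rw [Finset.disjoint_left]
    intro B hB hBX
    obtain ⟨x, hx⟩ := hX.1 B hBX
    have h1 : x ∈ s \ X.sup id := by rw [← hF.2]; exact mem_sup_id.2 ⟨B, hB, hx⟩
    exact (mem_sdiff.1 h1).2 (mem_sup_id.2 ⟨B, hBX, hx⟩)
  refine Finset.card_bij' (fun F _ => F \ X) (fun F _ => F ∪ X) ?_ ?_ ?_ ?_
  · intro F hF
    rw [mem_filter, mem_partitionsOf] at hF
    obtain ⟨⟨⟨hF1, hF2⟩, hF3⟩, hXF⟩ := hF
    refine mem_partitionsOf.2 ⟨⟨hF1.mono sdiff_subset, ?_⟩, ?_⟩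
    · ext x
      rw [mem_sup_id, mem_sdiff, ← hF2, mem_sup_id, mem_sup_id]
      constructor
      · rintro ⟨B, hB, hx⟩
        refine ⟨⟨B, (mem_sdiff.1 hB).1, hx⟩, ?_⟩
        rintro ⟨C, hC, hxC⟩
        exact (mem_sdiff.1 hB).2 (hF1.2 B (mem_sdiff.1 hB).1 C (hXF hC) x hx hxC ▸ hC)
      · rintro ⟨⟨B, hB, hx⟩, h⟩
        exact ⟨B, mem_sdiff.2 ⟨hB, fun hBX => h ⟨B, hBX, hx⟩⟩, hx⟩
    · rw [card_sdiff_of_subset hXF, hF3]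
  · intro F hF
    rw [mem_partitionsOf] at hF
    have hd := hdisj F hF.1
    rw [mem_filter, mem_partitionsOf]
    refine ⟨⟨⟨hF.1.1.union hX ?_, ?_⟩, ?_⟩, subset_union_right⟩
    · intro x hx
      rw [hF.1.2] at hx
      exact (mem_sdiff.1 hx).2
    · rw [sup_union, hF.1.2]
      exact sdiff_union_of_subset hs
    · rw [card_union_of_disjoint hd, hF.2]; omega
  · intro F hF
    exact sdiff_union_of_subset (mem_filter.1 hF).2
  · intro F hF
    exact union_sdiff_cancel_right (hdisj F (mem_partitionsOf.1 hF).1)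

theorem card_partitionsOf (s : Finset α) (k : ℕ) :
    (partitionsOf s k).card = Nat.stirlingSecond s.card k := by
  induction hs : s.card using Nat.strong_induction_on generalizing s k with
  | _ N ih =>
  rcases s.eq_empty_or_nonempty with rfl | ⟨a, ha⟩
  · have hF : ∀ F : Finset (Finset α), IsPartitionOf ∅ F ↔ F = ∅ := by
      intro F
      constructor
      · rintro ⟨h1, h2⟩
        rw [eq_empty_iff_forall_notMem]
        intro B hB
        obtain ⟨x, hx⟩ := h1.1 B hB
        have := mem_sup_id.2 ⟨B, hB, hx⟩
        rw [h2] at this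
        simp at this
      · rintro rfl
        exact ⟨⟨by simp, by simp⟩, by simp⟩
    rw [card_empty] at hs
    subst hs
    cases k with
    | zero =>
      rw [show partitionsOf (∅ : Finset α) 0 = {∅} by
        ext F; rw [mem_partitionsOf, hF, mem_singleton]
        exact ⟨fun h => h.1, fun h => ⟨h, by rw [h]; rfl⟩⟩]
      simp
    | succ k =>
      rw [show partitionsOf (∅ : Finset α) (k + 1) = ∅ by
        rw [eq_empty_iff_forall_notMem]
        intro F hF'
        rw [mem_partitionsOf, hF] at hF'
        obtain ⟨rfl, h⟩ := hF'
        simp at h]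
      simp
  · obtain ⟨N, rfl⟩ : ∃ M, N = M + 1 := ⟨N - 1, by have := card_pos.2 ⟨a, ha⟩; omega⟩
    cases k with
    | zero =>
      rw [show partitionsOf s 0 = ∅ by
        rw [eq_empty_iff_forall_notMem]
        intro F hF
        rw [mem_partitionsOf, card_eq_zero] at hF
        obtain ⟨⟨_, h⟩, rfl⟩ := hF
        rw [← h] at ha
        simp at ha]
      simp
    | succ k =>
      have hcard : (s.erase a).card = N := by rw [card_erase_of_mem ha, hs]; rfl
      have hbi : partitionsOf s (k + 1) = (s.erase a).powerset.biUnion fun C =>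
          (partitionsOf s (k + 1)).filter ({s \ C} ⊆ ·) := by
        ext F
        simp only [mem_biUnion, mem_powerset, mem_filter, singleton_subset_iff]
        refine ⟨fun hF => ?_, fun ⟨_, _, h, _⟩ => h⟩
        obtain ⟨⟨h1, h2⟩, h3⟩ := mem_partitionsOf.1 hF
        obtain ⟨B, hB, haB⟩ := mem_sup_id.1 (h2 ▸ ha)
        have hBs : B ⊆ s := by
          rw [← h2]; exact fun x hx => mem_sup_id.2 ⟨B, hB, hx⟩
        refine ⟨s \ B, fun x hx => ?_, hF, by rwa [Finset.sdiff_sdiff_eq_self hBs]⟩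
        rw [mem_sdiff] at hx
        exact mem_erase.2 ⟨fun h => hx.2 (h ▸ haB), hx.1⟩
      have hnot : ∀ C, C ⊆ s.erase a → a ∈ s \ C := fun C hC =>
        mem_sdiff.2 ⟨ha, fun h => (mem_erase.1 (hC h)).1 rfl⟩
      rw [hbi, card_biUnion]
      · rw [stirlingSecond_succ_succ_eq_sum_choose]
        have h1 : ∀ C ∈ (s.erase a).powerset,
            ((partitionsOf s (k + 1)).filter ({s \ C} ⊆ ·)).card =
              Nat.stirlingSecond C.card k := by
          intro C hC
          rw [mem_powerset] at hC
          have hCs : C ⊆ s := hC.trans (erase_subset _ _)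
          rw [card_filter_subset_partitionsOf (isPartialPartition_singleton ⟨a, hnot C hC⟩)
            (by simp) (by simp)]
          simp only [sup_singleton, id, card_singleton, Nat.add_sub_cancel,
            Finset.sdiff_sdiff_eq_self hCs]
          refine ih C.card ?_ C k rfl
          have := card_le_card hC
          omega
        rw [sum_congr rfl h1, sum_powerset_apply_card (fun j => Nat.stirlingSecond j k), hcard]
        simp
      · intro C hC D hD hne
        rw [mem_coe, mem_powerset] at hC hD
        rw [Function.onFun, Finset.disjoint_left]
        intro F hF hF'
        simp only [mem_filter, singleton_subset_iff] at hF hF'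
        have h1 := (mem_partitionsOf.1 hF.1).1.1.2 _ hF.2 _ hF'.2 a (hnot C hC) (hnot D hD)
        apply hne
        rw [← Finset.sdiff_sdiff_eq_self (hC.trans (erase_subset _ _)), h1,
          Finset.sdiff_sdiff_eq_self (hD.trans (erase_subset _ _))]

end

section

variable {n k : ℕ}

theorem mem_kPartitions {F : Finset (Finset (Fin n))} :
    F ∈ kPartitions n k ↔ IsPartitionOf univ F ∧ F.card = k := by
  simp only [kPartitions, mem_filter, mem_image, mem_univ, true_and]
  refine and_congr_left fun _ => ⟨?_, ?_⟩
  · rintro ⟨P, rfl⟩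
    refine ⟨⟨fun B hB => P.nonempty_of_mem_parts hB, fun B hB C hC x hx hx' => ?_⟩, P.sup_parts⟩
    exact P.eq_of_mem_parts hB hC hx hx'
  · rintro ⟨h1, h2⟩
    refine ⟨⟨F, ?_, h2, ?_⟩, rfl⟩
    · rw [Finset.supIndep_iff_pairwiseDisjoint]
      intro B hB C hC hne
      exact Finset.disjoint_left.2 fun x hx hx' => hne (h1.2 B hB C hC x hx hx')
    · intro h
      simpa using h1.1 _ h

theorem kPartitions_eq : kPartitions n k = partitionsOf univ k := by
  ext F; rw [mem_kPartitions, mem_partitionsOf]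

theorem card_familyC {X : Finset (Finset (Fin n))} (hX : IsPartialPartition X)
    (hk : X.card ≤ k) :
    (familyC n k X).card = Nat.stirlingSecond (n - (X.sup id).card) (k - X.card) := by
  rw [familyC, kPartitions_eq, card_filter_subset_partitionsOf hX (subset_univ _) hk,
    card_partitionsOf, card_univ_sdiff, Fintype.card_fin]

theorem familyC_eq_empty {X : Finset (Finset (Fin n))} (hX : ¬ IsPartialPartition X) :
    familyC n k X = ∅ := by
  rw [familyC, eq_empty_iff_forall_notMem]
  intro F hF
  rw [mem_filter, mem_kPartitions] at hF
  exact hX (hF.1.1.1.mono hF.2)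

theorem card_familyC_le {X : Finset (Finset (Fin n))} (hk : X.card < k) :
    (familyC n k X).card ≤ Nat.stirlingSecond (n - X.card) (k - X.card) := by
  by_cases hX : IsPartialPartition X
  · rw [card_familyC hX hk.le]
    obtain ⟨j, hj⟩ : ∃ j, k - X.card = j + 1 := ⟨k - X.card - 1, by omega⟩
    rw [hj]
    exact stirlingSecond_mono_left _ (Nat.sub_le_sub_left hX.card_le _)
  · rw [familyC_eq_empty hX]; simp

theorem card_familyC_le_of_not_singletons {X : Finset (Finset (Fin n))} (hk : X.card < k)
    {B : Finset (Fin n)} (hB : B ∈ X) (h1 : B.card ≠ 1) :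
    (familyC n k X).card ≤ Nat.stirlingSecond (n - X.card - 1) (k - X.card) := by
  by_cases hX : IsPartialPartition X
  · rw [card_familyC hX hk.le]
    obtain ⟨j, hj⟩ : ∃ j, k - X.card = j + 1 := ⟨k - X.card - 1, by omega⟩
    rw [hj]
    have := hX.lt_card hB h1
    exact stirlingSecond_mono_left _ (by omega)
  · rw [familyC_eq_empty hX]; simp

theorem familyC_subset_singleton {X : Finset (Finset (Fin n))} (hk : k ≤ X.card) :
    familyC n k X ⊆ {X} := by
  intro F hF
  rw [familyC, mem_filter, mem_kPartitions] at hF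
  rw [mem_singleton]
  exact (eq_of_subset_of_card_le hF.2 (by omega)).symm

theorem card_familyC_le_one {X : Finset (Finset (Fin n))} (hk : k ≤ X.card + 1) :
    (familyC n k X).card ≤ 1 := by
  rcases Nat.lt_or_ge X.card k with h | h
  · refine (card_familyC_le h).trans ?_
    rw [show k - X.card = 1 by omega]
    rcases Nat.eq_zero_or_pos (n - X.card) with h0 | h0
    · rw [h0]; simp
    · obtain ⟨p, hp⟩ : ∃ p, n - X.card = p + 1 := ⟨n - X.card - 1, by omega⟩
      rw [hp, Nat.stirlingSecond_one_right]
  · exact (card_le_card (familyC_subset_singleton h)).trans (by simp)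

end

/-! ### Covers and branching -/

section

variable {n t : ℕ}

/-- `X` is a `t`-cover of `𝓕` if it shares at least `t` blocks with every member of `𝓕`. It is not
required to be a partial partition. -/
def Covers (t : ℕ) (X : Finset (Finset (Fin n))) (𝓕 : Finset (Finset (Finset (Fin n)))) : Prop :=
  ∀ F ∈ 𝓕, t ≤ (X ∩ F).card

/-- The members of `𝓕` containing `X`. -/
def containing (𝓕 : Finset (Finset (Finset (Fin n)))) (X : Finset (Finset (Fin n))) :
    Finset (Finset (Finset (Fin n))) :=
  𝓕.filter (X ⊆ ·)

theorem mem_containing {𝓕 : Finset (Finset (Finset (Fin n)))} {X F : Finset (Finset (Fin n))} :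
    F ∈ containing 𝓕 X ↔ F ∈ 𝓕 ∧ X ⊆ F := mem_filter

theorem card_containing_le_card_familyC {k : ℕ}
    {𝓕 : Finset (Finset (Finset (Fin n)))}
    (h : 𝓕 ⊆ kPartitions n k) (X : Finset (Finset (Fin n))) :
    (containing 𝓕 X).card ≤ (familyC n k X).card :=
  card_le_card (filter_subset_filter _ h)

theorem CrossIntersecting.symm {𝓕 𝓖 : Finset (Finset (Finset (Fin n)))}
    (h : CrossIntersecting t 𝓕 𝓖) : CrossIntersecting t 𝓖 𝓕 :=
  fun G hG F hF => by rw [inter_comm]; exact h F hF G hG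

theorem CrossIntersecting.covers {𝓕 𝓖 : Finset (Finset (Finset (Fin n)))}
    (h : CrossIntersecting t 𝓕 𝓖) {F : Finset (Finset (Fin n))} (hF : F ∈ 𝓕) : Covers t F 𝓖 :=
  fun G hG => h F hF G hG

theorem exists_min_cover {𝓕 : Finset (Finset (Finset (Fin n)))} {Y : Finset (Finset (Fin n))}
    (hY : Covers t Y 𝓕) : ∃ X, Covers t X 𝓕 ∧ ∀ Z, Covers t Z 𝓕 → X.card ≤ Z.card := by
  classical
  obtain ⟨X, hX, hmin⟩ := exists_min_image (univ.filter fun X => Covers t X 𝓕) card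
    ⟨Y, mem_filter.2 ⟨mem_univ _, hY⟩⟩
  exact ⟨X, (mem_filter.1 hX).2, fun Z hZ => hmin Z (mem_filter.2 ⟨mem_univ _, hZ⟩)⟩

theorem Covers.le_card {𝓕 : Finset (Finset (Finset (Fin n)))} (h𝓕 : 𝓕.Nonempty)
    {X : Finset (Finset (Fin n))} (hX : Covers t X 𝓕) : t ≤ X.card := by
  obtain ⟨F, hF⟩ := h𝓕
  exact (hX F hF).trans (card_le_card inter_subset_left)

/-- A cover of size `t` is contained in every member. -/
theorem Covers.subset {𝓕 : Finset (Finset (Finset (Fin n)))} {X : Finset (Finset (Fin n))}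
    (hX : Covers t X 𝓕) (ht : X.card = t) {F : Finset (Finset (Fin n))} (hF : F ∈ 𝓕) : X ⊆ F := by
  have := eq_of_subset_of_card_le (inter_subset_left (s₁ := X) (s₂ := F))
    (by rw [ht]; exact hX F hF)
  exact inter_eq_left.1 this

theorem card_le_sum_containing {𝓕 : Finset (Finset (Finset (Fin n)))} {ι : Type*} {W : Finset ι}
    {f : ι → Finset (Finset (Fin n))} (h : ∀ F ∈ 𝓕, ∃ w ∈ W, f w ⊆ F) :
    𝓕.card ≤ ∑ w ∈ W, (containing 𝓕 (f w)).card := by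
  refine (card_le_card fun F hF => ?_).trans card_biUnion_le
  obtain ⟨w, hw, hs⟩ := h F hF
  exact mem_biUnion.2 ⟨w, hw, mem_containing.2 ⟨hF, hs⟩⟩

theorem card_le_mul_containing {𝓕 : Finset (Finset (Finset (Fin n)))} {ι : Type*} {W : Finset ι}
    {f : ι → Finset (Finset (Fin n))} {B : ℕ} (h : ∀ F ∈ 𝓕, ∃ w ∈ W, f w ⊆ F)
    (hB : ∀ w ∈ W, (containing 𝓕 (f w)).card ≤ B) : 𝓕.card ≤ W.card * B :=
  (card_le_sum_containing h).trans (sum_le_card_nsmul _ _ _ hB)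

/-- If every member of `𝓖` shares `t` blocks with `F₀` and `X` does not, then every member of `𝓖`
contains one of any `#F₀ - t + 1` blocks of `F₀ \ X`. -/
theorem exists_branch {𝓖 : Finset (Finset (Finset (Fin n)))} {X F₀ : Finset (Finset (Fin n))}
    (hF₀ : Covers t F₀ 𝓖) (hx : (X ∩ F₀).card < t) (ht : t ≤ F₀.card) :
    ∃ W ⊆ F₀ \ X, W.card = F₀.card - t + 1 ∧ ∀ G ∈ 𝓖, ∃ w ∈ W, w ∈ G := by
  have h1 : F₀.card - t + 1 ≤ (F₀ \ X).card := by
    have := card_sdiff_add_card_inter F₀ X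
    rw [inter_comm] at this
    omega
  obtain ⟨W, hW, hcard⟩ := exists_subset_card_eq h1
  refine ⟨W, hW, hcard, fun G hG => ?_⟩
  by_contra! hno
  have h2 : F₀ ∩ G ⊆ F₀ \ W := fun B hB =>
    mem_sdiff.2 ⟨(mem_inter.1 hB).1, fun hBW => hno B hBW (mem_inter.1 hB).2⟩
  have h3 := card_le_card h2
  rw [card_sdiff_of_subset (hW.trans sdiff_subset)] at h3
  have := hF₀ G hG
  omega

theorem containing_containing_insert {𝓖 : Finset (Finset (Finset (Fin n)))}
    (X : Finset (Finset (Fin n))) (w : Finset (Fin n)) :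
    containing (containing 𝓖 X) (insert w X) = containing 𝓖 (insert w X) := by
  ext G
  simp only [mem_containing, insert_subset_iff]
  tauto

/-- One branching step: the members containing a set `X` that is not a cover of the other family
are distributed over `K + 1` one-block extensions of `X`. -/
theorem card_containing_le_of_not_covers {K : ℕ} {𝓕 𝓖 : Finset (Finset (Finset (Fin n)))}
    (h𝓕 : 𝓕 ⊆ kPartitions n (t + K)) (hcross : CrossIntersecting t 𝓕 𝓖)
    {X : Finset (Finset (Fin n))} (hX : ¬ Covers t X 𝓕) {B : ℕ}
    (hB : ∀ w ∉ X, (containing 𝓖 (insert w X)).card ≤ B) :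
    (containing 𝓖 X).card ≤ (K + 1) * B := by
  unfold Covers at hX
  push Not at hX
  obtain ⟨F₀, hF₀, hlt⟩ := hX
  have hc : F₀.card = t + K := (mem_kPartitions.1 (h𝓕 hF₀)).2
  obtain ⟨W, hW, hWc, hWG⟩ := exists_branch (hcross.covers hF₀) hlt (by omega)
  rw [show K + 1 = W.card by omega]
  refine card_le_mul_containing (f := fun w => insert w X) ?_ ?_
  · intro G hG
    obtain ⟨w, hw, hwG⟩ := hWG G (mem_containing.1 hG).1
    exact ⟨w, hw, insert_subset hwG (mem_containing.1 hG).2⟩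
  · intro w hw
    rw [containing_containing_insert]
    exact hB w (mem_sdiff.1 (hW hw)).2

/-- Iterated branching up to the least size `a` of a cover of the other family. -/
theorem card_containing_le_pow {K a : ℕ} {𝓕 𝓖 : Finset (Finset (Finset (Fin n)))}
    (h𝓕 : 𝓕 ⊆ kPartitions n (t + K)) (hcross : CrossIntersecting t 𝓕 𝓖)
    (ha : ∀ X, Covers t X 𝓕 → a ≤ X.card) {B : ℕ}
    (hB : ∀ X : Finset (Finset (Fin n)), X.card = a → (containing 𝓖 X).card ≤ B)
    (i : ℕ) {X : Finset (Finset (Fin n))} (hX : X.card + i = a) :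
    (containing 𝓖 X).card ≤ (K + 1) ^ i * B := by
  induction i generalizing X with
  | zero => simpa using hB X hX
  | succ i ih =>
    rw [pow_succ', mul_assoc]
    refine card_containing_le_of_not_covers h𝓕 hcross (fun h => ?_) fun w hw => ih ?_
    · have := ha X h
      omega
    · rw [card_insert_of_notMem hw]; omega

theorem Covers.card_le_of_subset {𝓖 : Finset (Finset (Finset (Fin n)))}
    {X : Finset (Finset (Fin n))} (hX : Covers t X 𝓖) {B : ℕ}
    (hB : ∀ Y ⊆ X, Y.card = t → (containing 𝓖 Y).card ≤ B) :
    𝓖.card ≤ X.card.choose t * B := by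
  rw [← card_powersetCard]
  refine card_le_mul_containing (f := id) ?_ ?_
  · intro G hG
    obtain ⟨Y, hY, hc⟩ := exists_subset_card_eq (hX G hG)
    exact ⟨Y, mem_powersetCard.2 ⟨hY.trans inter_subset_left, hc⟩, hY.trans inter_subset_right⟩
  · intro Y hY
    exact hB Y (mem_powersetCard.1 hY).1 (mem_powersetCard.1 hY).2

theorem Covers.card_le {𝓖 : Finset (Finset (Finset (Fin n)))} {X : Finset (Finset (Fin n))}
    (hX : Covers t X 𝓖) {B : ℕ}
    (hB : ∀ Y : Finset (Finset (Fin n)), Y.card = t → (containing 𝓖 Y).card ≤ B) :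
    𝓖.card ≤ X.card.choose t * B :=
  hX.card_le_of_subset fun Y _ hY => hB Y hY

theorem choose_add_le_pow (t β : ℕ) : (t + β).choose t ≤ (t + 1) ^ β := by
  induction β with
  | zero => simp
  | succ β ih =>
    have h := Nat.choose_mul_succ_eq (t + β) t
    have e : t + β + 1 - t = β + 1 := by omega
    rw [e] at h
    rw [pow_succ, ← add_assoc]
    have h2 : (t + β).choose t * (t + β + 1) ≤ (t + β).choose t * ((t + 1) * (β + 1)) := by
      gcongr; nlinarith [Nat.zero_le (t * β)]
    refine Nat.le_of_mul_le_mul_right (c := β + 1) ?_ (by omega)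
    calc (t + β + 1).choose t * (β + 1) = (t + β).choose t * (t + β + 1) := h.symm
      _ ≤ (t + β).choose t * ((t + 1) * (β + 1)) := h2
      _ ≤ (t + 1) ^ β * ((t + 1) * (β + 1)) := Nat.mul_le_mul_right _ ih
      _ = _ := by ring

/-- The bound on one family in terms of a cover of itself and the covering number of the other. -/
theorem card_le_of_covers {K α β : ℕ} {𝓕 𝓖 : Finset (Finset (Finset (Fin n)))}
    (h𝓕 : 𝓕 ⊆ kPartitions n (t + K)) (hcross : CrossIntersecting t 𝓕 𝓖)
    (ha : ∀ X, Covers t X 𝓕 → t + α ≤ X.card) {Z : Finset (Finset (Fin n))}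
    (hZ : Covers t Z 𝓖) (hZc : Z.card = t + β) {B : ℕ}
    (hB : ∀ X : Finset (Finset (Fin n)), X.card = t + α → (containing 𝓖 X).card ≤ B) :
    𝓖.card ≤ (t + 1) ^ β * ((K + 1) ^ α * B) := by
  refine (hZ.card_le fun Y hY => card_containing_le_pow h𝓕 hcross ha hB α (by omega)).trans ?_
  rw [hZc]
  exact Nat.mul_le_mul_right _ (choose_add_le_pow t β)

end

/-! ### One family with a common `t`-set of blocks -/

section

variable {n t K L : ℕ} {𝓕 𝓖 : Finset (Finset (Finset (Fin n)))} {T : Finset (Finset (Fin n))}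

/-- A member of `𝓖` not containing the common `t`-set of `𝓕` has a block that occurs in no member
of `𝓕`: a block meeting a missing member of the `t`-set. -/
theorem exists_block_notMem (h𝓕 : 𝓕 ⊆ kPartitions n K) (h𝓖 : 𝓖 ⊆ kPartitions n L)
    (hne : 𝓕.Nonempty) (hTF : ∀ F ∈ 𝓕, T ⊆ F) {G₀ : Finset (Finset (Fin n))} (hG₀ : G₀ ∈ 𝓖)
    (hTG : ¬ T ⊆ G₀) : ∃ w ∈ G₀, w ∉ T ∧ ∀ F ∈ 𝓕, w ∉ F := by
  obtain ⟨x, hxT, hxG⟩ := not_subset.1 hTG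
  have hpart : ∀ F ∈ 𝓕, IsPartitionOf univ F := fun F hF => (mem_kPartitions.1 (h𝓕 hF)).1
  obtain ⟨F₁, hF₁⟩ := hne
  obtain ⟨p, hp⟩ := (hpart F₁ hF₁).1.1 x (hTF F₁ hF₁ hxT)
  have hG := (mem_kPartitions.1 (h𝓖 hG₀)).1
  obtain ⟨w, hw, hpw⟩ := mem_sup_id.1 (show p ∈ G₀.sup id by rw [hG.2]; exact mem_univ _)
  have hno : ∀ F ∈ 𝓕, w ∉ F := fun F hF hwF => by
    have := (hpart F hF).1.2 w hwF x (hTF F hF hxT) p hpw hp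
    exact hxG (this ▸ hw)
  exact ⟨w, hw, fun hwT => hno F₁ hF₁ (hTF F₁ hF₁ hwT), hno⟩

/-- Branching from a common `t`-set of `𝓕` takes only `L` blocks instead of `L + 1`, as one block of
`G₀` is in no member of `𝓕`. -/
theorem exists_branch_of_common (h𝓕 : 𝓕 ⊆ kPartitions n (t + K)) (h𝓖 : 𝓖 ⊆ kPartitions n (t + L))
    (hL : 1 ≤ L) (hcross : CrossIntersecting t 𝓕 𝓖)
    (hne : 𝓕.Nonempty) (hT : T.card = t) (hTF : ∀ F ∈ 𝓕, T ⊆ F) {G₀ : Finset (Finset (Fin n))}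
    (hG₀ : G₀ ∈ 𝓖) (hTG : ¬ T ⊆ G₀) :
    ∃ w₀ ∈ G₀, w₀ ∉ T ∧ (∀ F ∈ 𝓕, w₀ ∉ F) ∧
      ∃ W ⊆ G₀.erase w₀ \ T, W.card = L ∧ ∀ F ∈ 𝓕, ∃ w ∈ W, w ∈ F := by
  obtain ⟨w₀, hw₀, hw₀T, hw₀F⟩ := exists_block_notMem h𝓕 h𝓖 hne hTF hG₀ hTG
  refine ⟨w₀, hw₀, hw₀T, hw₀F, ?_⟩
  have hc : G₀.card = t + L := (mem_kPartitions.1 (h𝓖 hG₀)).2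
  have hce : (G₀.erase w₀).card = t + L - 1 := by rw [card_erase_of_mem hw₀, hc]
  have hcov : Covers t (G₀.erase w₀) 𝓕 := by
    intro F hF
    have h1 := hcross F hF G₀ hG₀
    have h2 : F ∩ G₀ ⊆ G₀.erase w₀ ∩ F := fun B hB => by
      rw [mem_inter] at hB
      exact mem_inter.2 ⟨mem_erase.2 ⟨fun h => hw₀F F hF (h ▸ hB.1), hB.2⟩, hB.1⟩
    exact h1.trans (card_le_card h2)
  have hlt : (T ∩ G₀.erase w₀).card < t := by
    rw [← hT]
    refine card_lt_card ⟨inter_subset_left, fun h => hTG fun B hB => ?_⟩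
    exact mem_of_mem_erase (mem_inter.1 (h hB)).2
  obtain ⟨W, hW, hWc, hWF⟩ := exists_branch hcov hlt (by omega)
  exact ⟨W, hW, by omega, hWF⟩

theorem card_le_of_common (h𝓕 : 𝓕 ⊆ kPartitions n (t + K)) (h𝓖 : 𝓖 ⊆ kPartitions n (t + L))
    (hL : 1 ≤ L) (hcross : CrossIntersecting t 𝓕 𝓖)
    (hne : 𝓕.Nonempty) (hT : T.card = t) (hTF : ∀ F ∈ 𝓕, T ⊆ F) {G₀ : Finset (Finset (Fin n))}
    (hG₀ : G₀ ∈ 𝓖) (hTG : ¬ T ⊆ G₀) {B : ℕ}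
    (hB : ∀ X : Finset (Finset (Fin n)), X.card = t + 1 → (containing 𝓕 X).card ≤ B) :
    𝓕.card ≤ L * B := by
  obtain ⟨w₀, -, -, -, W, hW, hWc, hWF⟩ :=
    exists_branch_of_common h𝓕 h𝓖 hL hcross hne hT hTF hG₀ hTG
  rw [← hWc]
  refine card_le_mul_containing (f := fun w => insert w T) ?_ ?_
  · intro F hF
    obtain ⟨w, hw, hwF⟩ := hWF F hF
    exact ⟨w, hw, insert_subset hwF (hTF F hF)⟩
  · intro w hw
    apply hB
    rw [card_insert_of_notMem (mem_sdiff.1 (hW hw)).2, hT]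

/-- A partition that contains all blocks but one of a partial partition `M`, and has as many blocks
as `M`, is obtained by enlarging the missing block by all uncovered points. -/
theorem eq_sdiff_union_of_subset {M G : Finset (Finset (Fin n))} (hM : IsPartialPartition M)
    (hG : IsPartitionOf univ G) (hc : G.card = M.card) {x : Finset (Fin n)} (hx : x ∈ M)
    (hsub : M \ {x} ⊆ G) : G = (M \ {x}) ∪ {x ∪ (M.sup id)ᶜ} := by
  have h1 : (G \ (M \ {x})).card = 1 := by
    rw [card_sdiff_of_subset hsub, sdiff_singleton_eq_erase, card_erase_of_mem hx, hc]
    have := card_pos.2 ⟨x, hx⟩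
    omega
  obtain ⟨z, hz⟩ := card_eq_one.1 h1
  have hzG : z ∈ G ∧ z ∉ M \ {x} := by
    have : z ∈ G \ (M \ {x}) := by rw [hz]; exact mem_singleton_self z
    exact mem_sdiff.1 this
  have hzeq : z = x ∪ (M.sup id)ᶜ := by
    ext p
    rw [mem_union, mem_compl, mem_sup_id]
    constructor
    · intro hp
      by_contra! hcon
      obtain ⟨hpx, B, hB, hpB⟩ := hcon
      have hBM : B ∈ M \ {x} := mem_sdiff.2 ⟨hB, fun h => hpx (mem_singleton.1 h ▸ hpB)⟩
      exact hzG.2 (hG.1.2 z hzG.1 B (hsub hBM) p hp hpB ▸ hBM)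
    · intro hp
      obtain ⟨B, hB, hpB⟩ := mem_sup_id.1 (show p ∈ G.sup id by rw [hG.2]; exact mem_univ _)
      by_cases hBM : B ∈ M \ {x}
      · rw [mem_sdiff, mem_singleton] at hBM
        rcases hp with hp | hp
        · exact absurd (hM.2 B hBM.1 x hx p hpB hp) hBM.2
        · exact absurd ⟨B, hBM.1, hpB⟩ hp
      · have : B ∈ G \ (M \ {x}) := mem_sdiff.2 ⟨hB, hBM⟩
        rw [hz, mem_singleton] at this
        exact this ▸ hpB
  rw [← hzeq, ← hz, union_sdiff_of_subset hsub]

theorem two_mul_mul_le_of_no_extension {f g t l a₁ a₂ b₀ : ℕ} (ht : 1 ≤ t)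
    (hf : f ≤ (l + 1) * ((l + 1 + 1) * a₂)) (hg : g ≤ (t + 1) * b₀)
    (ha : (t + 1) ^ 2 * (l + 1 + 1) ^ 2 * a₂ ≤ a₁) :
    2 * (f * g) ≤ (2 * l + 1) * (a₁ * b₀) := by
  have h1 : 2 * (l + 1) ≤ (l + 1 + 1) * (t + 1) * (2 * l + 1) := by
    have : 1 * 2 * (2 * l + 1) ≤ (l + 1 + 1) * (t + 1) * (2 * l + 1) := by gcongr <;> omega
    omega
  calc 2 * (f * g) ≤ 2 * (((l + 1) * ((l + 1 + 1) * a₂)) * ((t + 1) * b₀)) := by gcongr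
    _ = (2 * (l + 1)) * ((l + 1 + 1) * (t + 1) * a₂ * b₀) := by ring
    _ ≤ ((l + 1 + 1) * (t + 1) * (2 * l + 1)) * ((l + 1 + 1) * (t + 1) * a₂ * b₀) := by gcongr
    _ = (2 * l + 1) * ((t + 1) ^ 2 * (l + 1 + 1) ^ 2 * a₂ * b₀) := by ring
    _ ≤ (2 * l + 1) * (a₁ * b₀) := by gcongr

theorem four_mul_le_succ_sq (t : ℕ) : 4 * t ≤ (t + 1) ^ 2 := by
  zify; nlinarith [sq_nonneg ((t : ℤ) - 1)]

theorem two_mul_mul_le_of_one_extension {f g t l K a₁ a₂ b₀ b₁ : ℕ} (ht : 1 ≤ t) (hl : 1 ≤ l)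
    (hf : f ≤ 1 * a₁ + l * ((l + 1 + 1) * a₂)) (hg : g ≤ b₀ + t * K * b₁)
    (ha : (t + 1) ^ 2 * (l + 1 + 1) ^ 2 * a₂ ≤ a₁) (hb : (t + 1) ^ 2 * (K + 1) ^ 2 * b₁ ≤ b₀) :
    2 * (f * g) ≤ (2 * l + 1) * (a₁ * b₀) := by
  have hF4 : 4 * f ≤ 5 * a₁ := by
    have h1 : 4 * (l * ((l + 1 + 1) * a₂)) ≤ a₁ :=
      calc 4 * (l * ((l + 1 + 1) * a₂)) = 4 * (l * (l + 1 + 1)) * a₂ := by ring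
        _ ≤ (t + 1) ^ 2 * (l + 1 + 1) ^ 2 * a₂ := by
          gcongr
          · have := four_mul_le_succ_sq t; omega
          · rw [pow_two]; gcongr; omega
        _ ≤ a₁ := ha
    omega
  have hG16 : 16 * g ≤ 17 * b₀ := by
    have h1 : 16 * (t * K * b₁) ≤ b₀ :=
      calc 16 * (t * K * b₁) = (4 * t) * (4 * K) * b₁ := by ring
        _ ≤ (t + 1) ^ 2 * (K + 1) ^ 2 * b₁ := by
          gcongr
          · exact four_mul_le_succ_sq t
          · exact four_mul_le_succ_sq K
        _ ≤ b₀ := hb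
    omega
  have h6 := Nat.mul_le_mul hF4 hG16
  have h7 : 1 * (a₁ * b₀) ≤ l * (a₁ * b₀) := Nat.mul_le_mul_right _ hl
  have e1 : 4 * f * (16 * g) = 64 * (f * g) := by ring
  have e2 : 5 * a₁ * (17 * b₀) = 85 * (a₁ * b₀) := by ring
  have e3 : (2 * l + 1) * (a₁ * b₀) = 2 * (l * (a₁ * b₀)) + a₁ * b₀ := by ring
  omega

theorem two_mul_mul_le_of_extensions {f g t l y a₁ a₂ b₀ b₁ : ℕ} (ht : 1 ≤ t) (hy : y ≤ l)
    (hf : f ≤ y * a₁ + (l + 1 - y) * ((l + 1 + 1) * a₂)) (hg : g ≤ b₀ + t * b₁)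
    (ha : (t + 1) ^ 2 * (l + 1 + 1) ^ 2 * a₂ ≤ a₁)
    (hb : (t + 1) ^ 2 * (l + 1 + 1) ^ 2 * b₁ ≤ b₀) :
    2 * (f * g) ≤ (2 * l + 1) * (a₁ * b₀) := by
  have hF4 : 4 * f ≤ (4 * l + 1) * a₁ := by
    have h5 : 4 * ((l + 1 - y) * ((l + 1 + 1) * a₂)) ≤ a₁ :=
      calc 4 * ((l + 1 - y) * ((l + 1 + 1) * a₂)) = 4 * ((l + 1 - y) * (l + 1 + 1)) * a₂ := by ring
        _ ≤ (t + 1) ^ 2 * (l + 1 + 1) ^ 2 * a₂ := by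
          gcongr
          · have := four_mul_le_succ_sq t; omega
          · rw [pow_two]; gcongr; omega
        _ ≤ a₁ := ha
    have h6 : y * a₁ ≤ l * a₁ := Nat.mul_le_mul_right _ hy
    have e : (4 * l + 1) * a₁ = 4 * (l * a₁) + a₁ := by ring
    omega
  have hG4 : 4 * (l + 1 + 1) ^ 2 * g ≤ (4 * (l + 1 + 1) ^ 2 + 1) * b₀ :=
    calc 4 * (l + 1 + 1) ^ 2 * g ≤ 4 * (l + 1 + 1) ^ 2 * (b₀ + t * b₁) := by gcongr
      _ = 4 * (l + 1 + 1) ^ 2 * b₀ + (4 * t) * (l + 1 + 1) ^ 2 * b₁ := by ring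
      _ ≤ 4 * (l + 1 + 1) ^ 2 * b₀ + b₀ := by
        gcongr
        exact le_trans (by gcongr; exact four_mul_le_succ_sq t) hb
      _ = _ := by ring
  refine le_of_mul_le_mul_left (a := 8 * (l + 1 + 1) ^ 2) ?_ (by positivity)
  calc 8 * (l + 1 + 1) ^ 2 * (2 * (f * g))
      = 4 * f * (4 * (l + 1 + 1) ^ 2 * g) := by ring
    _ ≤ (4 * l + 1) * a₁ * ((4 * (l + 1 + 1) ^ 2 + 1) * b₀) := Nat.mul_le_mul hF4 hG4
    _ = ((4 * l + 1) * (4 * (l + 1 + 1) ^ 2 + 1)) * (a₁ * b₀) := by ring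
    _ ≤ (8 * (l + 1 + 1) ^ 2 * (2 * l + 1)) * (a₁ * b₀) := by
        refine Nat.mul_le_mul_right _ ?_
        have : l ≤ (l + 1 + 1) ^ 2 ∧ 1 ≤ (l + 1 + 1) ^ 2 := ⟨by nlinarith, by nlinarith⟩
        nlinarith
    _ = _ := by ring

/-- The structure of a pair of families in which `𝓕` has a common `t`-set `T` of blocks and `𝓖`
has a cover of size `t + 1`: either the pair is contained in one of the two extremal
configurations, or the product of the sizes is small. -/
theorem structure_of_common (ht : 1 ≤ t) (h𝓕 : 𝓕 ⊆ kPartitions n (t + K))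
    (h𝓖 : 𝓖 ⊆ kPartitions n (t + L))
    (hL : 2 ≤ L) (hcross : CrossIntersecting t 𝓕 𝓖)
    (hne : 𝓕.Nonempty) (hT : T.card = t) (hTF : ∀ F ∈ 𝓕, T ⊆ F) {G₀ : Finset (Finset (Fin n))}
    (hG₀ : G₀ ∈ 𝓖) (hTG : ¬ T ⊆ G₀) {S : Finset (Finset (Fin n))} (hS : S.card = t + 1)
    (hSG : Covers t S 𝓖) {a₁ a₂ b₀ b₁ Q : ℕ}
    (ha₁ : ∀ X : Finset (Finset (Fin n)), X.card = t + 1 → (containing 𝓕 X).card ≤ a₁)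
    (ha₂ : ∀ X : Finset (Finset (Fin n)), X.card = t + 2 → (containing 𝓕 X).card ≤ a₂)
    (hb₀ : ∀ X : Finset (Finset (Fin n)), X.card = t → (containing 𝓖 X).card ≤ b₀)
    (hb₁ : ∀ X : Finset (Finset (Fin n)), X.card = t + 1 → (containing 𝓖 X).card ≤ b₁)
    (hQK : (t + 1) * (K + 1) ≤ Q) (hQL : (t + 1) * (L + 1) ≤ Q)
    (ha : Q ^ 2 * a₂ ≤ a₁) (hb : Q ^ 2 * b₁ ≤ b₀) :
    (∃ M, IsPartialPartition M ∧ M.card = t + 1 ∧ 𝓕 ⊆ familyC n (t + K) M ∧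
      𝓖 ⊆ familyD n (t + L) t M) ∨
    (∃ M, IsPartialPartition M ∧ T ⊆ M ∧ M.card = t + L ∧ 𝓕 ⊆ familyA n (t + K) T M ∧
      𝓖 ⊆ familyB n (t + L) T M) ∨
    2 * (𝓕.card * 𝓖.card) ≤ (2 * L - 1) * (a₁ * b₀) := by
  classical
  obtain ⟨w₀, hw₀, hw₀T, hw₀F, W, hW, hWc, hWF⟩ :=
    exists_branch_of_common h𝓕 h𝓖 (by omega) hcross hne hT hTF hG₀ hTG
  have hpF : ∀ F ∈ 𝓕, IsPartitionOf univ F := fun F hF => (mem_kPartitions.1 (h𝓕 hF)).1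
  have hpG : ∀ G ∈ 𝓖, IsPartitionOf univ G := fun G hG => (mem_kPartitions.1 (h𝓖 hG)).1
  have hcG₀ : G₀.card = t + L := (mem_kPartitions.1 (h𝓖 hG₀)).2
  -- the one-block extensions of `T` that are compatible with `T` and cover `𝓖`
  set Y := univ.filter fun y => y ∉ T ∧ Covers t (insert y T) 𝓖 ∧ ∃ F ∈ 𝓕, y ∈ F with hY
  have hYmem : ∀ y, y ∈ Y ↔ y ∉ T ∧ Covers t (insert y T) 𝓖 ∧ ∃ F ∈ 𝓕, y ∈ F := by
    intro y; rw [hY, mem_filter]; simp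
  have hTlt : ∀ G, ¬ T ⊆ G → (T ∩ G).card < t := fun G hG => by
    rw [← hT]
    exact card_lt_card ⟨inter_subset_left, fun h => hG fun B hB => (mem_inter.1 (h hB)).2⟩
  have hYG : ∀ G ∈ 𝓖, ¬ T ⊆ G → ∀ y ∈ Y, y ∈ G ∧ (T ∩ G).card + 1 = t := by
    intro G hG hTG y hy
    have h1 := ((hYmem y).1 hy).2.1 G hG
    have h2 := hTlt G hTG
    by_cases hyG : y ∈ G
    · rw [insert_inter_of_mem hyG] at h1
      have := card_insert_le y (T ∩ G)
      exact ⟨hyG, by omega⟩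
    · rw [insert_inter_of_notMem hyG] at h1
      omega
  have hmiss : ∀ G ∈ 𝓖, ¬ T ⊆ G → Y.Nonempty → ∃ x ∈ T, x ∉ G ∧ T.erase x ⊆ G := by
    intro G hG hTG ⟨y, hy⟩
    obtain ⟨x, hxT, hxG⟩ := not_subset.1 hTG
    refine ⟨x, hxT, hxG, ?_⟩
    have h1 := (hYG G hG hTG y hy).2
    have h2 : T ∩ G ⊆ T.erase x := fun B hB =>
      mem_erase.2 ⟨fun h => hxG (h ▸ (mem_inter.1 hB).2), (mem_inter.1 hB).1⟩
    have h3 := eq_of_subset_of_card_le h2 (by rw [card_erase_of_mem hxT]; omega)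
    rw [← h3]
    exact inter_subset_right
  have hYW : Y ⊆ W := by
    intro y hy
    have h1 := hYG G₀ hG₀ hTG y hy
    have h2 : (G₀.erase w₀ \ T).card = L := by
      have h3 := card_sdiff_add_card_inter (G₀.erase w₀) T
      have h4 : G₀.erase w₀ ∩ T = T ∩ G₀ := by
        ext B
        simp only [mem_inter, mem_erase]
        exact ⟨fun h => ⟨h.2, h.1.2⟩, fun h => ⟨⟨fun e => hw₀T (e ▸ h.1), h.2⟩, h.1⟩⟩
      rw [h4, card_erase_of_mem hw₀] at h3
      omega
    rw [eq_of_subset_of_card_le hW (by omega)]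
    obtain ⟨hyT, -, F, hF, hyF⟩ := (hYmem y).1 hy
    exact mem_sdiff.2 ⟨mem_erase.2 ⟨fun h => hw₀F F hF (h ▸ hyF), h1.1⟩, hyT⟩
  have hcardF : 𝓕.card ≤ Y.card * a₁ + (L - Y.card) * ((L + 1) * a₂) := by
    refine (card_le_sum_containing (W := W) (f := fun w => insert w T) ?_).trans ?_
    · intro F hF
      obtain ⟨w, hw, hwF⟩ := hWF F hF
      exact ⟨w, hw, insert_subset hwF (hTF F hF)⟩
    · rw [← sum_sdiff hYW, add_comm, ← hWc, ← card_sdiff_of_subset hYW]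
      have hins : ∀ w ∈ W, (insert w T).card = t + 1 := fun w hw => by
        rw [card_insert_of_notMem (mem_sdiff.1 (hW hw)).2, hT]
      refine Nat.add_le_add (sum_le_card_nsmul _ _ _ fun w hw => ha₁ _ (hins w (hYW hw)))
        (sum_le_card_nsmul _ _ _ fun w hw => ?_)
      rw [mem_sdiff, hYmem] at hw
      rcases (containing 𝓕 (insert w T)).eq_empty_or_nonempty with h | ⟨F, hF⟩
      · rw [h]; simp
      · rw [mem_containing] at hF
        refine hWc ▸ card_containing_le_of_not_covers h𝓖 hcross.symm
          (fun hcov => hw.2 ⟨?_, hcov, F, hF.1, hF.2 (mem_insert_self _ _)⟩) fun v hv => ha₂ _ ?_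
        · exact (mem_sdiff.1 (hW hw.1)).2
        · rw [card_insert_of_notMem hv, hins w hw.1]
  have hYL : Y.card ≤ L := hWc ▸ card_le_card hYW
  have hGsplit : ∀ {R : ℕ}, (𝓖.filter fun G => ¬ T ⊆ G).card ≤ R → 𝓖.card ≤ b₀ + R := by
    intro R hR
    rw [← card_filter_add_card_filter_not (s := 𝓖) (fun G => T ⊆ G)]
    exact Nat.add_le_add (hb₀ T hT) hR
  have hmono : ∀ X, (containing (𝓖.filter fun G => ¬ T ⊆ G) X).card ≤ (containing 𝓖 X).card :=
    fun X => card_le_card (filter_subset_filter _ (filter_subset _ _))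
  have hQL2 : (t + 1) ^ 2 * (L + 1) ^ 2 ≤ Q ^ 2 := by
    rw [← mul_pow]; exact Nat.pow_le_pow_left hQL 2
  have hQK2 : (t + 1) ^ 2 * (K + 1) ^ 2 ≤ Q ^ 2 := by
    rw [← mul_pow]; exact Nat.pow_le_pow_left hQK 2
  have hqa : (t + 1) ^ 2 * (L + 1) ^ 2 * a₂ ≤ a₁ := (Nat.mul_le_mul_right _ hQL2).trans ha
  have hqb : (t + 1) ^ 2 * (L + 1) ^ 2 * b₁ ≤ b₀ := (Nat.mul_le_mul_right _ hQL2).trans hb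
  have hqbK : (t + 1) ^ 2 * (K + 1) ^ 2 * b₁ ≤ b₀ := (Nat.mul_le_mul_right _ hQK2).trans hb
  obtain ⟨l, rfl⟩ : ∃ l, L = l + 1 := ⟨L - 1, by omega⟩
  have e2L : 2 * (l + 1) - 1 = 2 * l + 1 := by omega
  rw [e2L]
  rcases Y.eq_empty_or_nonempty with hY0 | hYne
  · -- no cover of size `t + 1` of `𝓖` extends `T`
    right; right
    rw [hY0] at hcardF
    simp only [card_empty, zero_mul, Nat.sub_zero, zero_add] at hcardF
    have hcardG : 𝓖.card ≤ (t + 1) * b₀ := by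
      have := hSG.card_le hb₀
      rwa [hS, Nat.choose_succ_self_right] at this
    exact two_mul_mul_le_of_no_extension ht hcardF hcardG hqa
  rcases Nat.lt_or_ge Y.card 2 with hY1 | hY2
  · -- exactly one cover of size `t + 1` extends `T`
    obtain ⟨y, hYy⟩ := card_eq_one.1 (show Y.card = 1 by have := hYne.card_pos; omega)
    have hyY : y ∈ Y := by rw [hYy]; exact mem_singleton_self y
    obtain ⟨hyT, hyc, F₂, hF₂, hyF₂⟩ := (hYmem y).1 hyY
    have hMc : (insert y T).card = t + 1 := by rw [card_insert_of_notMem hyT, hT]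
    by_cases hall : ∀ F ∈ 𝓕, y ∈ F
    · left
      refine ⟨insert y T, (hpF F₂ hF₂).1.mono (insert_subset hyF₂ (hTF F₂ hF₂)), hMc, ?_, ?_⟩
      · intro F hF
        exact mem_filter.2 ⟨h𝓕 hF, insert_subset (hall F hF) (hTF F hF)⟩
      · intro G hG
        exact mem_filter.2 ⟨h𝓖 hG, hyc G hG⟩
    · right; right
      push Not at hall
      obtain ⟨F₁, hF₁, hyF₁⟩ := hall
      have hcF₁ : F₁.card = t + K := (mem_kPartitions.1 (h𝓕 hF₁)).2
      have hcardG : 𝓖.card ≤ b₀ + (t * K) * b₁ := by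
        apply hGsplit
        have hW' : (T ×ˢ (F₁ \ T)).card = t * K := by
          rw [card_product, hT, card_sdiff_of_subset (hTF F₁ hF₁), hcF₁, hT,
            Nat.add_sub_cancel_left]
        rw [← hW']
        refine card_le_mul_containing (f := fun p => insert p.2 (insert y (T.erase p.1))) ?_ ?_
        · intro G hG
          rw [mem_filter] at hG
          obtain ⟨x, hxT, hxG, hsub⟩ := hmiss G hG.1 hG.2 hYne
          obtain ⟨hyG, hTG1⟩ := hYG G hG.1 hG.2 y hyY
          have h1 := hcross F₁ hF₁ G hG.1
          obtain ⟨w, hw, hwT⟩ : ∃ w ∈ F₁ ∩ G, w ∉ T := by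
            by_contra! hcon
            have h2 : F₁ ∩ G ⊆ T ∩ G := fun B hB => mem_inter.2 ⟨hcon B hB, (mem_inter.1 hB).2⟩
            have := card_le_card h2
            omega
          rw [mem_inter] at hw
          exact ⟨(x, w), mem_product.2 ⟨hxT, mem_sdiff.2 ⟨hw.1, hwT⟩⟩,
            insert_subset hw.2 (insert_subset hyG hsub)⟩
        · rintro ⟨x, w⟩ hxw
          rw [mem_product, mem_sdiff] at hxw
          refine (hmono _).trans (hb₁ _ ?_)
          rw [card_insert_of_notMem, card_insert_of_notMem, card_erase_of_mem hxw.1, hT]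
          · omega
          · exact fun h => hyT (mem_of_mem_erase h)
          · rw [mem_insert, not_or]
            exact ⟨fun h => hyF₁ (h ▸ hxw.2.1), fun h => hxw.2.2 (mem_of_mem_erase h)⟩
      rw [hYy, card_singleton, Nat.add_sub_cancel] at hcardF
      exact two_mul_mul_le_of_one_extension ht (by omega) hcardF hcardG hqa hqbK
  · -- at least two covers of size `t + 1` extend `T`
    obtain ⟨y, hyY, y', hy'Y, hyy'⟩ := one_lt_card.1 (show 1 < Y.card by omega)
    rcases Nat.lt_or_ge Y.card (l + 1) with hYlt | hYge
    · right; right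
      have hcardG : 𝓖.card ≤ b₀ + t * b₁ := by
        apply hGsplit
        rw [← hT]
        refine card_le_mul_containing (f := fun x => insert y' (insert y (T.erase x))) ?_ ?_
        · intro G hG
          rw [mem_filter] at hG
          obtain ⟨x, hxT, hxG, hsub⟩ := hmiss G hG.1 hG.2 hYne
          exact ⟨x, hxT, insert_subset (hYG G hG.1 hG.2 y' hy'Y).1
            (insert_subset (hYG G hG.1 hG.2 y hyY).1 hsub)⟩
        · intro x hx
          refine (hmono _).trans (hb₁ _ ?_)
          have h1 := ((hYmem y).1 hyY).1
          have h2 := ((hYmem y').1 hy'Y).1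
          rw [card_insert_of_notMem, card_insert_of_notMem, card_erase_of_mem hx, hT]
          · omega
          · exact fun h => h1 (mem_of_mem_erase h)
          · rw [mem_insert, not_or]
            exact ⟨fun h => hyy' h.symm, fun h => h2 (mem_of_mem_erase h)⟩
      exact two_mul_mul_le_of_extensions ht (by omega) hcardF hcardG hqa hqb
    · right; left
      have hYeq : Y = W := eq_of_subset_of_card_le hYW (by omega)
      have hdTY : Disjoint T Y := disjoint_left.2 fun B hB hBY => ((hYmem B).1 hBY).1 hB
      obtain ⟨F₁, hF₁⟩ := id hne
      have hMp : IsPartialPartition (T ∪ Y) := by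
        refine ((hpF F₁ hF₁).1.mono (hTF F₁ hF₁)).union
          ((hpG G₀ hG₀).1.mono fun y hy => (hYG G₀ hG₀ hTG y hy).1) ?_
        intro p hp hp'
        obtain ⟨x, hx, hpx⟩ := mem_sup_id.1 hp
        obtain ⟨y, hy, hpy⟩ := mem_sup_id.1 hp'
        obtain ⟨hyT, -, F, hF, hyF⟩ := (hYmem y).1 hy
        exact hyT ((hpF F hF).1.2 x (hTF F hF hx) y hyF p hpx hpy ▸ hx)
      have hMc : (T ∪ Y).card = t + (l + 1) := by
        rw [card_union_of_disjoint hdTY, hT]; omega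
      refine ⟨T ∪ Y, hMp, subset_union_left, hMc, ?_, ?_⟩
      · intro F hF
        obtain ⟨w, hw, hwF⟩ := hWF F hF
        refine mem_filter.2 ⟨h𝓕 hF, hTF F hF, w, mem_inter.2 ⟨hwF, mem_sdiff.2 ⟨?_, ?_⟩⟩⟩
        · exact mem_union_right _ (hYeq ▸ hw)
        · exact (mem_sdiff.1 (hW hw)).2
      · intro G hG
        by_cases hTG' : T ⊆ G
        · exact mem_union_left _ (mem_filter.2 ⟨h𝓖 hG, hTG'⟩)
        · obtain ⟨x, hxT, hxG, hsub⟩ := hmiss G hG hTG' hYne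
          refine mem_union_right _ (mem_image.2 ⟨x, hxT, ?_⟩)
          refine (eq_sdiff_union_of_subset hMp (hpG G hG) ?_ (mem_union_left _ hxT) ?_).symm
          · rw [hMc, (mem_kPartitions.1 (h𝓖 hG)).2]
          · intro B hB
            rw [mem_sdiff, mem_union, mem_singleton] at hB
            rcases hB.1 with h | h
            · exact hsub (mem_erase.2 ⟨hB.2, h⟩)
            · exact (hYG G hG hTG' B h).1

end

/-! ### Extremal configurations on singletons -/

section

variable {n t k l : ℕ}

/-- The singletons of the points of `I`. -/
def singletons (I : Finset (Fin n)) : Finset (Finset (Fin n)) := I.image fun i => {i}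

theorem mem_singletons {I : Finset (Fin n)} {B : Finset (Fin n)} :
    B ∈ singletons I ↔ ∃ i ∈ I, {i} = B := mem_image

theorem card_singletons (I : Finset (Fin n)) : (singletons I).card = I.card :=
  card_image_of_injective _ singleton_injective

theorem sup_singletons (I : Finset (Fin n)) : (singletons I).sup id = I := by
  ext x
  rw [mem_sup_id]
  constructor
  · rintro ⟨B, hB, hx⟩
    obtain ⟨i, hi, rfl⟩ := mem_singletons.1 hB
    rwa [mem_singleton.1 hx]
  · exact fun hx => ⟨{x}, mem_singletons.2 ⟨x, hx, rfl⟩, mem_singleton_self x⟩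

theorem singletons_subset_singletons {I J : Finset (Fin n)} :
    singletons I ⊆ singletons J ↔ I ⊆ J :=
  image_subset_image_iff singleton_injective

theorem isPartialPartition_singletons (I : Finset (Fin n)) :
    IsPartialPartition (singletons I) := by
  refine ⟨fun B hB => ?_, fun B hB C hC x hx hx' => ?_⟩
  · obtain ⟨i, -, rfl⟩ := mem_singletons.1 hB
    exact singleton_nonempty i
  · obtain ⟨i, -, rfl⟩ := mem_singletons.1 hB
    obtain ⟨j, -, rfl⟩ := mem_singletons.1 hC
    rw [← mem_singleton.1 hx, ← mem_singleton.1 hx']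

theorem exists_eq_singletons {X : Finset (Finset (Fin n))} (h : ∀ B ∈ X, B.card = 1) :
    ∃ I, X = singletons I := by
  refine ⟨univ.filter fun i => {i} ∈ X, ?_⟩
  ext B
  rw [mem_singletons]
  constructor
  · intro hB
    obtain ⟨i, rfl⟩ := card_eq_one.1 (h B hB)
    exact ⟨i, mem_filter.2 ⟨mem_univ _, hB⟩, rfl⟩
  · rintro ⟨i, hi, rfl⟩
    exact (mem_filter.1 hi).2

/-- The pair is contained in a copy of `(𝓒(k, t), 𝓓(l, t))`. -/
def InsideCD (k l t : ℕ) (𝓕 𝓖 : Finset (Finset (Finset (Fin n)))) : Prop :=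
  ∃ I : Finset (Fin n), I.card = t + 1 ∧ 𝓕 ⊆ familyC n k (singletons I) ∧
    𝓖 ⊆ familyD n l t (singletons I)

/-- The pair is contained in a copy of `(𝓐(k, l, t), 𝓑(l, t))`. -/
def InsideAB (k l t : ℕ) (𝓕 𝓖 : Finset (Finset (Finset (Fin n)))) : Prop :=
  ∃ J I : Finset (Fin n), J ⊆ I ∧ J.card = t ∧ I.card = l ∧
    𝓕 ⊆ familyA n k (singletons J) (singletons I) ∧
    𝓖 ⊆ familyB n l (singletons J) (singletons I)

theorem exists_erase_subset {X F : Finset (Finset (Fin n))} (hX : X.card = t + 1)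
    (h : t ≤ (X ∩ F).card) : ∃ x ∈ X, X.erase x ⊆ F := by
  obtain ⟨Y, hY, hYc⟩ := exists_subset_card_eq h
  obtain ⟨x, hx, hxY⟩ : ∃ x ∈ X, x ∉ Y := by
    by_contra! hcon
    have := card_le_card (show X ⊆ Y from hcon)
    omega
  have h1 : Y ⊆ X.erase x := fun B hB =>
    mem_erase.2 ⟨fun e => hxY (e ▸ hB), (mem_inter.1 (hY hB)).1⟩
  have h2 := eq_of_subset_of_card_le h1 (by rw [card_erase_of_mem hx]; omega)
  exact ⟨x, hx, h2 ▸ hY.trans inter_subset_right⟩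

theorem card_familyD_le_sum {X : Finset (Finset (Fin n))} (hX : X.card = t + 1) :
    (familyD n l t X).card ≤ ∑ x ∈ X, (familyC n l (X.erase x)).card := by
  refine (card_le_card fun F hF => ?_).trans card_biUnion_le
  rw [familyD, mem_filter] at hF
  obtain ⟨x, hx, hs⟩ := exists_erase_subset hX hF.2
  exact mem_biUnion.2 ⟨x, hx, mem_filter.2 ⟨hF.1, hs⟩⟩

theorem card_familyB_le (X M : Finset (Finset (Fin n))) :
    (familyB n l X M).card ≤ (familyC n l X).card + X.card :=
  (card_union_le _ _).trans (Nat.add_le_add_left card_image_le _)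

theorem card_familyA_le_sum (X M : Finset (Finset (Fin n))) :
    (familyA n k X M).card ≤ ∑ w ∈ M \ X, (familyC n k (insert w X)).card := by
  refine (card_le_card fun F hF => ?_).trans card_biUnion_le
  rw [familyA, mem_filter] at hF
  obtain ⟨w, hw⟩ := hF.2.2
  rw [mem_inter] at hw
  exact mem_biUnion.2 ⟨w, hw.2, mem_filter.2 ⟨hF.1, insert_subset hw.1 hF.2.1⟩⟩

theorem sum_le_mul_add {ι : Type*} [DecidableEq ι] {s : Finset ι} {f : ι → ℕ} {i : ι} (hi : i ∈ s)
    {A B : ℕ} (hB : f i ≤ B) (hA : ∀ j ∈ s, f j ≤ A) : ∑ j ∈ s, f j ≤ (s.card - 1) * A + B := by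
  rw [← add_sum_erase _ _ hi, add_comm, ← card_erase_of_mem hi]
  exact Nat.add_le_add (sum_le_card_nsmul _ _ _ fun j hj => hA j (mem_of_mem_erase hj)) hB

end

section

variable {t K L K₁ M : ℕ}

/-- `blockBound t K₁ M K i` bounds the number of partitions of `t + M + 1` points into `t + K`
blocks that contain `t + i` given blocks. For `i + 2 ≤ K` it is the Stirling number counting
the partitions through given singletons; the last two values, at which a partition is already
determined, are enlarged so that consecutive values differ by a factor of at least
`((t + 1) * (K₁ + 1)) ^ 2`. -/
def blockBound (t K₁ M K i : ℕ) : ℕ :=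
  if i + 2 ≤ K then Nat.stirlingSecond (M + 1 - i) (K - i)
  else if i + 1 = K then ((t + 1) * (K₁ + 1)) ^ 2 else if i = K then 1 else 0

theorem card_containing_le_stirlingSecond {n i : ℕ} (hn : n = t + M + 1)
    {𝓕 : Finset (Finset (Finset (Fin n)))}
    (h𝓕 : 𝓕 ⊆ kPartitions n (t + K)) (hi : i < K) {X : Finset (Finset (Fin n))}
    (hX : X.card = t + i) : (containing 𝓕 X).card ≤ Nat.stirlingSecond (M + 1 - i) (K - i) := by
  refine (card_containing_le_card_familyC h𝓕 X).trans ((card_familyC_le (by omega)).trans_eq ?_)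
  congr 1 <;> omega

theorem card_containing_le_blockBound {n i : ℕ} (hn : n = t + M + 1)
    {𝓕 : Finset (Finset (Finset (Fin n)))}
    (h𝓕 : 𝓕 ⊆ kPartitions n (t + K)) {X : Finset (Finset (Fin n))}
    (hX : X.card = t + i) : (containing 𝓕 X).card ≤ blockBound t K₁ M K i := by
  unfold blockBound
  split_ifs with h1 h2 h3
  · exact card_containing_le_stirlingSecond hn h𝓕 (by omega) hX
  · exact ((card_containing_le_card_familyC h𝓕 X).trans (card_familyC_le_one (by omega))).trans
      (Nat.one_le_pow _ _ (by positivity))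
  · exact (card_containing_le_card_familyC h𝓕 X).trans (card_familyC_le_one (by omega))
  · rw [Nat.le_zero, card_eq_zero, eq_empty_iff_forall_notMem]
    intro F hF
    rw [mem_containing] at hF
    have h4 := (mem_kPartitions.1 (h𝓕 hF.1)).2
    have h5 := card_le_card hF.2
    omega

theorem AboveThreshold.sq_mul_blockBound_le (h : AboveThreshold t K₁ M) (ht : 1 ≤ t)
    (hK₁ : 2 ≤ K₁) (hK : K ≤ K₁) (i : ℕ) :
    ((t + 1) * (K₁ + 1)) ^ 2 * blockBound t K₁ M K (i + 1) ≤ blockBound t K₁ M K i := by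
  have hlt := h.lt ht hK₁
  unfold blockBound
  split_ifs with h1 h2 h3 h4 h5 h6 h7
  all_goals try omega
  · have := h.sq_mul_stirlingSecond_le ht hK₁ (i := i) (j := K - (i + 1)) (by omega)
    rwa [show M + 1 - (i + 1) = M - i by omega, show M + 1 - i = M - i + 1 by omega,
      show K - i = K - (i + 1) + 1 by omega]
  · have h8 := h.pow_five_le_stirlingSecond ht hK₁ (i := i) (by omega)
    rw [show M + 1 - i = M - i + 1 by omega, show K - i = 2 by omega]
    refine le_trans ?_ h8
    rw [← pow_add]
    exact Nat.pow_le_pow_right (by positivity) (by norm_num)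

theorem AboveThreshold.pow_mul_blockBound_le (h : AboveThreshold t K₁ M) (ht : 1 ≤ t)
    (hK₁ : 2 ≤ K₁) (hK : K ≤ K₁) (s i : ℕ) :
    ((t + 1) * (K₁ + 1)) ^ (2 * i) * blockBound t K₁ M K (s + i) ≤ blockBound t K₁ M K s := by
  induction i with
  | zero => simp
  | succ i ih =>
    refine le_trans ?_ ih
    rw [show 2 * (i + 1) = 2 * i + 2 by ring, pow_add, mul_assoc]
    exact Nat.mul_le_mul_left _ (h.sq_mul_blockBound_le ht hK₁ hK (s + i))

/-- Each of the `α + β` branching steps costs a factor `Q = (t + 1) * (K₁ + 1)`, and `α + β - 1`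
steps gain a factor `Q ^ 2`, which suffices for `2 ≤ α + β`. -/
theorem mul_le_of_min_covers {n α β : ℕ} (hn : n = t + M + 1) (h : AboveThreshold t K₁ M)
    (ht : 1 ≤ t) (hK : 3 ≤ K) (hKK₁ : K ≤ K₁) (hL : 2 ≤ L) (hLK₁ : L ≤ K₁)
    {𝓕 𝓖 : Finset (Finset (Finset (Fin n)))}
    (h𝓕 : 𝓕 ⊆ kPartitions n (t + K)) (h𝓖 : 𝓖 ⊆ kPartitions n (t + L))
    (hcross : CrossIntersecting t 𝓕 𝓖) {X Z : Finset (Finset (Fin n))}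
    (hX : Covers t X 𝓕) (hXc : X.card = t + α) (hXmin : ∀ Y, Covers t Y 𝓕 → X.card ≤ Y.card)
    (hZ : Covers t Z 𝓖) (hZc : Z.card = t + β) (hZmin : ∀ Y, Covers t Y 𝓖 → Z.card ≤ Y.card)
    (hβ : 1 ≤ β) (hαβ : 2 ≤ α + β) :
    𝓕.card * 𝓖.card ≤
      Nat.stirlingSecond M (K - 1) * Nat.stirlingSecond (M + 1) L := by
  have hf := card_le_of_covers (α := β) (β := α) h𝓖 hcross.symm
    (fun Y hY => hZc ▸ hZmin Y hY) hX hXc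
    (fun Y hY => card_containing_le_blockBound (K₁ := K₁) hn h𝓕 hY)
  have hg := card_le_of_covers (α := α) (β := β) h𝓕 hcross
    (fun Y hY => hXc ▸ hXmin Y hY) hZ hZc
    (fun Y hY => card_containing_le_blockBound (K₁ := K₁) hn h𝓖 hY)
  have hw1 := h.pow_mul_blockBound_le ht (by omega) hKK₁ 1 (β - 1)
  have hw0 := h.pow_mul_blockBound_le ht (by omega) hLK₁ 0 α
  rw [show 1 + (β - 1) = β by omega] at hw1
  rw [zero_add] at hw0
  have e1 : blockBound t K₁ M K 1 = Nat.stirlingSecond M (K - 1) := by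
    unfold blockBound; rw [if_pos (by omega)]; rfl
  have e0 : blockBound t K₁ M L 0 = Nat.stirlingSecond (M + 1) L := by
    unfold blockBound; rw [if_pos (by omega)]; rfl
  rw [e1] at hw1
  rw [e0] at hw0
  set Q := (t + 1) * (K₁ + 1) with hQ
  set wK := blockBound t K₁ M K β
  set wL := blockBound t K₁ M L α
  have hQpos : 1 ≤ Q := by rw [hQ]; exact Nat.mul_pos (by omega) (by omega)
  calc 𝓕.card * 𝓖.card
      ≤ ((t + 1) ^ α * ((L + 1) ^ β * wK)) * ((t + 1) ^ β * ((K + 1) ^ α * wL)) :=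
        Nat.mul_le_mul hf hg
    _ ≤ ((t + 1) ^ α * ((K₁ + 1) ^ β * wK)) * ((t + 1) ^ β * ((K₁ + 1) ^ α * wL)) := by gcongr
    _ = Q ^ (α + β) * (wK * wL) := by rw [hQ, mul_pow, pow_add, pow_add]; ring
    _ ≤ Q ^ (2 * (β - 1) + 2 * α) * (wK * wL) := by
        exact Nat.mul_le_mul_right _ (Nat.pow_le_pow_right hQpos (by omega))
    _ = (Q ^ (2 * (β - 1)) * wK) * (Q ^ (2 * α) * wL) := by rw [pow_add]; ring
    _ ≤ _ := Nat.mul_le_mul hw1 hw0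

theorem two_mul_card_familyC_le {n : ℕ} (hn : n = t + M + 1) (hL : 2 ≤ L)
    {X : Finset (Finset (Fin n))} (hX : X.card = t) {B : Finset (Fin n)} (hB : B ∈ X)
    (hB1 : B.card ≠ 1) :
    2 * (familyC n (t + L) X).card ≤ Nat.stirlingSecond (M + 1) L := by
  have h2 := card_familyC_le_of_not_singletons (k := t + L) (by omega) hB hB1
  rw [show n - X.card - 1 = M by omega, show t + L - X.card = L by omega] at h2
  have h3 := mul_stirlingSecond_le_succ M L
  have h4 : 2 * Nat.stirlingSecond M L ≤ L * Nat.stirlingSecond M L := by gcongr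
  omega

theorem two_mul_card_familyD_le {n : ℕ} (hn : n = t + M + 1) (ht : 1 ≤ t) (hL : 2 ≤ L)
    {X : Finset (Finset (Fin n))} (hX : X.card = t + 1) {B : Finset (Fin n)} (hB : B ∈ X)
    (hB1 : B.card ≠ 1) :
    2 * (familyD n (t + L) t X).card ≤ (2 * t + 1) * Nat.stirlingSecond (M + 1) L := by
  obtain ⟨x, hx, hxB⟩ : ∃ x ∈ X, x ≠ B := by
    by_contra! hcon
    have := card_le_one.2 fun a ha b hb => (hcon a ha).trans (hcon b hb).symm
    omega
  have hec : ∀ x ∈ X, (X.erase x).card = t := fun x hx => by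
    rw [card_erase_of_mem hx, hX, Nat.add_sub_cancel]
  have h1 := card_familyD_le_sum (n := n) (l := t + L) hX
  have h2 := two_mul_card_familyC_le hn hL (hec x hx) (mem_erase.2 ⟨hxB.symm, hB⟩) hB1
  have h3 := sum_le_mul_add (f := fun x => (familyC n (t + L) (X.erase x)).card) hx le_rfl
    fun y hy => by
      have h4 := card_familyC_le (n := n) (k := t + L) (X := X.erase y) (by rw [hec y hy]; omega)
      rwa [hec y hy, show n - t = M + 1 by omega, show t + L - t = L by omega] at h4
  rw [hX, Nat.add_sub_cancel] at h3
  nlinarith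

/-- The case of a common `t`-set of blocks, with all bounds evaluated: outside the extremal
configurations on singletons the product stays below `(c - 1 / 4) * a₁ * b₀`. -/
theorem inside_or_lt_of_common {n c : ℕ} (hn : n = t + M + 1) (h : AboveThreshold t K₁ M)
    (ht : 1 ≤ t) (hK : 3 ≤ K) (hKK₁ : K ≤ K₁) (hL : 2 ≤ L) (hLK₁ : L ≤ K₁)
    (hc : t + 1 ≤ c) (hcL : L ≤ c)
    {𝓕 𝓖 : Finset (Finset (Finset (Fin n)))}
    (h𝓕 : 𝓕 ⊆ kPartitions n (t + K)) (h𝓖 : 𝓖 ⊆ kPartitions n (t + L))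
    (hcross : CrossIntersecting t 𝓕 𝓖) (hne : 𝓕.Nonempty)
    {T : Finset (Finset (Fin n))} (hT : T.card = t) (hTF : ∀ F ∈ 𝓕, T ⊆ F)
    {G₀ : Finset (Finset (Fin n))} (hG₀ : G₀ ∈ 𝓖) (hTG : ¬ T ⊆ G₀)
    {S : Finset (Finset (Fin n))} (hS : S.card = t + 1) (hSG : Covers t S 𝓖) :
    InsideCD (t + K) (t + L) t 𝓕 𝓖 ∨ InsideAB (t + K) (t + L) t 𝓕 𝓖 ∨
      4 * (𝓕.card * 𝓖.card) <
        (4 * c - 1) * (Nat.stirlingSecond M (K - 1) * Nat.stirlingSecond (M + 1) L) := by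
  have hlt := h.lt ht (by omega)
  obtain ⟨N, rfl⟩ : ∃ N, M = N + 1 := ⟨M - 1, by omega⟩
  set Q := (t + 1) * (K₁ + 1) with hQ
  have hQK : (t + 1) * (K + 1) ≤ Q := by rw [hQ]; gcongr
  have hQL : (t + 1) * (L + 1) ≤ Q := by rw [hQ]; gcongr
  have hqa : Q ^ 2 * Nat.stirlingSecond N (K - 2) ≤ Nat.stirlingSecond (N + 1) (K - 1) := by
    have := h.sq_mul_stirlingSecond_le ht (by omega) (i := 1) (j := K - 2) (by omega)
    rwa [show K - 2 + 1 = K - 1 by omega] at this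
  have hqb : Q ^ 2 * Nat.stirlingSecond (N + 1) (L - 1) ≤ Nat.stirlingSecond (N + 2) L := by
    have := h.sq_mul_stirlingSecond_le ht (by omega) (i := 0) (j := L - 1) (by omega)
    rwa [show L - 1 + 1 = L by omega] at this
  have ha₁ : ∀ X : Finset (Finset (Fin n)), X.card = t + 1 → (containing 𝓕 X).card ≤
      Nat.stirlingSecond (N + 1) (K - 1) := fun X hX =>
    card_containing_le_stirlingSecond hn h𝓕 (by omega) hX
  have ha₂ : ∀ X : Finset (Finset (Fin n)), X.card = t + 2 → (containing 𝓕 X).card ≤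
      Nat.stirlingSecond N (K - 2) := fun X hX =>
    card_containing_le_stirlingSecond hn h𝓕 (by omega) hX
  have hb₀ : ∀ X : Finset (Finset (Fin n)), X.card = t → (containing 𝓖 X).card ≤
      Nat.stirlingSecond (N + 2) L := fun X hX =>
    card_containing_le_stirlingSecond (i := 0) hn h𝓖 (by omega) hX
  have hb₁ : ∀ X : Finset (Finset (Fin n)), X.card = t + 1 → (containing 𝓖 X).card ≤
      Nat.stirlingSecond (N + 1) (L - 1) := fun X hX =>
    card_containing_le_stirlingSecond hn h𝓖 (by omega) hX
  have hapos : 1 ≤ Nat.stirlingSecond (N + 1) (K - 1) := by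
    have := stirlingSecond_pos (m := N) (k := K - 2) (by omega)
    rwa [show K - 2 + 1 = K - 1 by omega] at this
  have hbbig : Q ^ 2 ≤ Nat.stirlingSecond (N + 2) L := by
    have := stirlingSecond_pos (m := N) (k := L - 2) (by omega)
    rw [show L - 2 + 1 = L - 1 by omega] at this
    exact (Nat.le_mul_of_pos_right _ this).trans hqb
  have hbig : 4 * L * t + 1 ≤ Nat.stirlingSecond (N + 2) L := by
    refine le_trans ?_ hbbig
    have h1 : 4 * t * ((L + 1) * (L + 1)) ≤ Q ^ 2 :=
      calc 4 * t * ((L + 1) * (L + 1)) ≤ (t + 1) ^ 2 * ((L + 1) * (L + 1)) :=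
            Nat.mul_le_mul_right _ (four_mul_le_succ_sq t)
        _ = ((t + 1) * (L + 1)) ^ 2 := by ring
        _ ≤ Q ^ 2 := Nat.pow_le_pow_left hQL 2
    have h2 : 4 * t * L + 4 * t * 1 ≤ 4 * t * ((L + 1) * (L + 1)) := by
      rw [← mul_add]; gcongr; nlinarith
    nlinarith
  have hCDnot : ∀ X : Finset (Finset (Fin n)), X.card = t → ∀ B ∈ X, B.card ≠ 1 →
      2 * (familyC n (t + L) X).card ≤ Nat.stirlingSecond (N + 2) L := fun X hX B hB hB1 =>
    two_mul_card_familyC_le hn hL hX hB hB1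
  have hD : ∀ X : Finset (Finset (Fin n)), X.card = t + 1 → ∀ B ∈ X, B.card ≠ 1 →
      2 * (familyD n (t + L) t X).card ≤ (2 * t + 1) * Nat.stirlingSecond (N + 2) L :=
    fun X hX B hB hB1 => two_mul_card_familyD_le hn ht hL hX hB hB1
  have hCge : ∀ X : Finset (Finset (Fin n)), X.card = t →
      (familyC n (t + L) X).card ≤ Nat.stirlingSecond (N + 2) L := by
    intro X hX
    have h2 := card_familyC_le (n := n) (k := t + L) (X := X) (by omega)
    rwa [show n - X.card = N + 2 by omega, show t + L - X.card = L by omega] at h2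
  have hA1 : ∀ X : Finset (Finset (Fin n)), X.card = t + 1 →
      (familyC n (t + K) X).card ≤ Nat.stirlingSecond (N + 1) (K - 1) := by
    intro X hX
    have h2 := card_familyC_le (n := n) (k := t + K) (X := X) (by omega)
    rwa [show n - X.card = N + 1 by omega, show t + K - X.card = K - 1 by omega] at h2
  have hA1not : ∀ X : Finset (Finset (Fin n)), X.card = t + 1 → ∀ B ∈ X, B.card ≠ 1 →
      2 * (familyC n (t + K) X).card ≤ Nat.stirlingSecond (N + 1) (K - 1) := by
    intro X hX B hB h1
    have h2 := card_familyC_le_of_not_singletons (k := t + K) (by omega) hB h1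
    rw [show n - X.card - 1 = N by omega, show t + K - X.card = K - 1 by omega] at h2
    have h3 := mul_stirlingSecond_le_succ N (K - 1)
    have h4 : 2 * Nat.stirlingSecond N (K - 1) ≤ (K - 1) * Nat.stirlingSecond N (K - 1) := by
      gcongr; omega
    omega
  have hstr := structure_of_common ht h𝓕 h𝓖 hL hcross hne hT hTF hG₀ hTG hS hSG ha₁ ha₂ hb₀ hb₁
    hQK hQL hqa hqb
  clear hqa hqb ha₁ ha₂ hb₀ hb₁ hbbig hQK hQL
  generalize Nat.stirlingSecond (N + 1) (K - 1) = a₁ at *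
  generalize hb₀eq : Nat.stirlingSecond (N + 2) L = b₀ at *
  have hfin : ∀ {f g : ℕ}, 2 * (f * g) ≤ (2 * c - 1) * (a₁ * b₀) →
      4 * (f * g) < (4 * c - 1) * (a₁ * b₀) := by
    intro f g hfg
    have hpos : 1 ≤ a₁ * b₀ := Nat.mul_pos hapos (by omega)
    obtain ⟨d, rfl⟩ : ∃ d, c = d + 1 := ⟨c - 1, by omega⟩
    rw [show 2 * (d + 1) - 1 = 2 * d + 1 by omega] at hfg
    rw [show 4 * (d + 1) - 1 = 4 * d + 3 by omega]
    nlinarith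
  rcases hstr with ⟨X, hXp, hXc, hFX, hGX⟩ | ⟨X, hXp, hTX, hXc, hFX, hGX⟩ | hsmall
  · by_cases hsing : ∀ B ∈ X, B.card = 1
    · left
      obtain ⟨I, rfl⟩ := exists_eq_singletons hsing
      exact ⟨I, by rw [← card_singletons, hXc], hFX, hGX⟩
    · right; right
      push Not at hsing
      obtain ⟨B, hB, hB1⟩ := hsing
      have hf : 𝓕.card ≤ a₁ := (card_le_card hFX).trans (hA1 X hXc)
      have hg : 2 * 𝓖.card ≤ (2 * t + 1) * b₀ :=
        (Nat.mul_le_mul_left 2 (card_le_card hGX)).trans (hD X hXc B hB hB1)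
      apply hfin
      calc 2 * (𝓕.card * 𝓖.card) = 𝓕.card * (2 * 𝓖.card) := by ring
        _ ≤ a₁ * ((2 * t + 1) * b₀) := Nat.mul_le_mul hf hg
        _ = (2 * t + 1) * (a₁ * b₀) := by ring
        _ ≤ _ := Nat.mul_le_mul_right _ (by omega)
  · by_cases hsing : ∀ B ∈ X, B.card = 1
    · right; left
      obtain ⟨I, rfl⟩ := exists_eq_singletons hsing
      obtain ⟨J, rfl⟩ := exists_eq_singletons fun B hB => hsing B (hTX hB)
      exact ⟨J, I, singletons_subset_singletons.1 hTX, by rw [← card_singletons, hT],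
        by rw [← card_singletons, hXc], hFX, hGX⟩
    · right; right
      push Not at hsing
      obtain ⟨B, hB, hB1⟩ := hsing
      have hXT : (X \ T).card = L := by rw [card_sdiff_of_subset hTX, hXc, hT]; omega
      have hic : ∀ w ∈ X \ T, (insert w T).card = t + 1 := fun w hw => by
        rw [card_insert_of_notMem (mem_sdiff.1 hw).2, hT]
      have hsum := (card_le_card hFX).trans (card_familyA_le_sum (k := t + K) T X)
      have hg := (card_le_card hGX).trans (card_familyB_le (l := t + L) T X)
      rw [hT] at hg
      have hpos : 1 ≤ a₁ * b₀ := Nat.mul_pos hapos (by omega)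
      obtain ⟨d, hd⟩ : ∃ d, L = d + 1 := ⟨L - 1, by omega⟩
      have hc4 : (4 * d + 3) * (a₁ * b₀) ≤ (4 * c - 1) * (a₁ * b₀) :=
        Nat.mul_le_mul_right _ (by omega)
      refine lt_of_lt_of_le ?_ hc4
      by_cases hBT : B ∈ T
      · -- a block of `T` is not a singleton
        have hf : 𝓕.card ≤ L * a₁ := by
          rw [← hXT]
          exact hsum.trans (sum_le_card_nsmul _ _ _ fun w hw => hA1 _ (hic w hw))
        have h2 := hCDnot T hT B hBT hB1
        have hg2 : 2 * 𝓖.card ≤ b₀ + 2 * t := by omega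
        have h3 := Nat.mul_le_mul hf hg2
        have h4 : (4 * L * t + 1) * a₁ ≤ b₀ * a₁ := Nat.mul_le_mul_right _ hbig
        have h5 : 1 * (a₁ * b₀) ≤ d * (a₁ * b₀) := Nat.mul_le_mul_right _ (by omega)
        calc 4 * (𝓕.card * 𝓖.card) = 2 * (𝓕.card * (2 * 𝓖.card)) := by ring
          _ ≤ 2 * (L * a₁ * (b₀ + 2 * t)) := by omega
          _ = 2 * L * (a₁ * b₀) + 4 * L * t * a₁ := by ring
          _ < 2 * L * (a₁ * b₀) + b₀ * a₁ := by
            have : (4 * L * t + 1) * a₁ = 4 * L * t * a₁ + a₁ := by ring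
            omega
          _ = (2 * d + 3) * (a₁ * b₀) := by rw [hd]; ring
          _ ≤ _ := Nat.mul_le_mul_right _ (by omega)
      · -- all blocks of `T` may be singletons, but one of the other blocks of `X` is not
        have hBX : B ∈ X \ T := mem_sdiff.2 ⟨hB, hBT⟩
        have h2 := hA1not (insert B T) (hic B hBX) B (mem_insert_self _ _) hB1
        have h3 := sum_le_mul_add (f := fun w => (familyC n (t + K) (insert w T)).card) hBX le_rfl
          fun w hw => hA1 _ (hic w hw)
        rw [hXT, hd, Nat.add_sub_cancel] at h3
        have hf2 : 2 * 𝓕.card ≤ (2 * d + 1) * a₁ := by nlinarith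
        have hg2 : 𝓖.card ≤ b₀ + t := hg.trans (Nat.add_le_add_right (hCge T hT) _)
        have h4 := Nat.mul_le_mul hf2 hg2
        have h5 : (4 * L * t + 1) * a₁ ≤ b₀ * a₁ := Nat.mul_le_mul_right _ hbig
        calc 4 * (𝓕.card * 𝓖.card) = 2 * (2 * 𝓕.card * 𝓖.card) := by ring
          _ ≤ 2 * ((2 * d + 1) * a₁ * (b₀ + t)) := by omega
          _ = (4 * d + 2) * (a₁ * b₀) + (4 * d + 2) * t * a₁ := by ring
          _ ≤ (4 * d + 2) * (a₁ * b₀) + 4 * L * t * a₁ := by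
            gcongr; omega
          _ < (4 * d + 2) * (a₁ * b₀) + b₀ * a₁ := by
            have : (4 * L * t + 1) * a₁ = 4 * L * t * a₁ + a₁ := by ring
            omega
          _ = _ := by ring
  · right; right
    exact hfin (hsmall.trans (Nat.mul_le_mul_right _ (by omega)))

end

/-! ### Nontrivial pairs of families -/

section

variable {n t : ℕ} {𝓕 𝓖 : Finset (Finset (Finset (Fin n)))}

theorem NonTrivialPair.symm (h : NonTrivialPair t 𝓕 𝓖) : NonTrivialPair t 𝓖 𝓕 := by
  unfold NonTrivialPair at *
  simpa only [and_comm] using h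

theorem NonTrivialPair.exists_not_subset (h : NonTrivialPair t 𝓕 𝓖) {T : Finset (Finset (Fin n))}
    (hT : T.card = t) (hTF : ∀ F ∈ 𝓕, T ⊆ F) : ∃ G ∈ 𝓖, ¬ T ⊆ G := by
  by_contra! hcon
  have : T ⊆ univ.filter fun B => (∀ F ∈ 𝓕, B ∈ F) ∧ ∀ G ∈ 𝓖, B ∈ G := fun B hB =>
    mem_filter.2 ⟨mem_univ _, fun F hF => hTF F hF hB, fun G hG => hcon G hG hB⟩
  have h1 := card_le_card this
  unfold NonTrivialPair at h
  omega

end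

section

variable {n t K L K₁ M α β c : ℕ} {𝓕 𝓖 : Finset (Finset (Finset (Fin n)))}

/-- The dichotomy for given least sizes `t + α` and `t + β` of covers, except for the case
`α > 0 = β`, in which the roles of the families are exchanged. -/
theorem inside_or_lt (hn : n = t + M + 1) (h : AboveThreshold t K₁ M)
    (ht : 1 ≤ t) (hK : 3 ≤ K) (hKK₁ : K ≤ K₁) (hL : 2 ≤ L) (hLK₁ : L ≤ K₁)
    (hc : t + 1 ≤ c) (hcL : L ≤ c)
    (h𝓕 : 𝓕 ⊆ kPartitions n (t + K)) (h𝓖 : 𝓖 ⊆ kPartitions n (t + L))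
    (hcross : CrossIntersecting t 𝓕 𝓖) (hnt : NonTrivialPair t 𝓕 𝓖)
    (hneF : 𝓕.Nonempty) (hneG : 𝓖.Nonempty) {X Z : Finset (Finset (Fin n))}
    (hX : Covers t X 𝓕) (hXc : X.card = t + α) (hXmin : ∀ Y, Covers t Y 𝓕 → X.card ≤ Y.card)
    (hZ : Covers t Z 𝓖) (hZc : Z.card = t + β) (hZmin : ∀ Y, Covers t Y 𝓖 → Z.card ≤ Y.card)
    (hαβ : α = 0 ∨ 1 ≤ β) :
    InsideCD (t + K) (t + L) t 𝓕 𝓖 ∨ InsideAB (t + K) (t + L) t 𝓕 𝓖 ∨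
      4 * (𝓕.card * 𝓖.card) <
        (4 * c - 1) * (Nat.stirlingSecond M (K - 1) * Nat.stirlingSecond (M + 1) L) := by
  have hlt := h.lt ht (by omega)
  have hapos : 1 ≤ Nat.stirlingSecond M (K - 1) := by
    have := stirlingSecond_pos (m := M - 1) (k := K - 2) (by omega)
    rwa [show K - 2 + 1 = K - 1 by omega, show M - 1 + 1 = M by omega] at this
  have hbpos : 1 ≤ Nat.stirlingSecond (M + 1) L := by
    have := stirlingSecond_pos (m := M) (k := L - 1) (by omega)
    rwa [show L - 1 + 1 = L by omega] at this
  have hfin : 𝓕.card * 𝓖.card ≤ Nat.stirlingSecond M (K - 1) * Nat.stirlingSecond (M + 1) L →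
      4 * (𝓕.card * 𝓖.card) <
        (4 * c - 1) * (Nat.stirlingSecond M (K - 1) * Nat.stirlingSecond (M + 1) L) := by
    intro hle
    have hpos := Nat.mul_pos hapos hbpos
    have : 7 * (Nat.stirlingSecond M (K - 1) * Nat.stirlingSecond (M + 1) L) ≤
      (4 * c - 1) * (Nat.stirlingSecond M (K - 1) * Nat.stirlingSecond (M + 1) L) :=
      Nat.mul_le_mul_right _ (by omega)
    omega
  rcases Nat.lt_or_ge (α + β) 2 with hlt2 | hge2
  · obtain rfl : α = 0 := by omega
    have hTF : ∀ F ∈ 𝓕, X ⊆ F := fun F hF => hX.subset hXc hF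
    obtain ⟨G₀, hG₀, hTG⟩ := hnt.exists_not_subset hXc hTF
    rcases Nat.eq_zero_or_pos β with rfl | hβ
    · -- both families have a common `t`-set of blocks
      right; right
      apply hfin
      have hTG' : ∀ G ∈ 𝓖, Z ⊆ G := fun G hG => hZ.subset hZc hG
      obtain ⟨F₀, hF₀, hTF'⟩ := hnt.symm.exists_not_subset hZc hTG'
      have hf := card_le_of_common h𝓕 h𝓖 (by omega) hcross hneF hXc hTF hG₀ hTG
        fun Y hY => card_containing_le_stirlingSecond (i := 1) hn h𝓕 (by omega) hY
      have hg := card_le_of_common h𝓖 h𝓕 (by omega) hcross.symm hneG hZc hTG' hF₀ hTF'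
        fun Y hY => card_containing_le_stirlingSecond (i := 1) hn h𝓖 (by omega) hY
      rw [Nat.add_sub_cancel] at hf hg
      have hqb := h.sq_mul_stirlingSecond_le ht (by omega) (i := 0) (j := L - 1) (by omega)
      rw [show L - 1 + 1 = L by omega, Nat.sub_zero] at hqb
      have hLK : L * K ≤ ((t + 1) * (K₁ + 1)) ^ 2 := by
        rw [pow_two]
        apply Nat.mul_le_mul <;> nlinarith
      calc 𝓕.card * 𝓖.card ≤ (L * Nat.stirlingSecond M (K - 1)) *
            (K * Nat.stirlingSecond M (L - 1)) := Nat.mul_le_mul hf hg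
        _ = Nat.stirlingSecond M (K - 1) * ((L * K) * Nat.stirlingSecond M (L - 1)) := by ring
        _ ≤ Nat.stirlingSecond M (K - 1) *
            (((t + 1) * (K₁ + 1)) ^ 2 * Nat.stirlingSecond M (L - 1)) := by gcongr
        _ ≤ _ := Nat.mul_le_mul_left _ hqb
    · obtain rfl : β = 1 := by omega
      exact inside_or_lt_of_common hn h ht hK hKK₁ hL hLK₁ hc hcL h𝓕 h𝓖 hcross hneF hXc hTF hG₀
        hTG hZc hZ
  · exact Or.inr (Or.inr (hfin (mul_le_of_min_covers hn h ht hK hKK₁ hL hLK₁ h𝓕 h𝓖 hcross hX hXc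
      hXmin hZ hZc hZmin (by omega) hge2)))

/-- When the parameters differ and only the family with fewer blocks has a common `t`-set of
blocks, the product is small: its leading term has the two Stirling indices in the wrong order. -/
theorem lt_of_common_right (hn : n = t + M + 1) (h : AboveThreshold t K M)
    (ht : 1 ≤ t) (hL : 2 ≤ L) (hLK : L < K) (hc : t + 1 ≤ c) (hcL : L ≤ c)
    (h𝓕 : 𝓕 ⊆ kPartitions n (t + K)) (h𝓖 : 𝓖 ⊆ kPartitions n (t + L))
    (hcross : CrossIntersecting t 𝓕 𝓖) (hnt : NonTrivialPair t 𝓕 𝓖)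
    (hneG : 𝓖.Nonempty) {X Z : Finset (Finset (Fin n))}
    (hX : Covers t X 𝓕) (hXc : X.card = t + α) (hXmin : ∀ Y, Covers t Y 𝓕 → X.card ≤ Y.card)
    (hZ : Covers t Z 𝓖) (hZc : Z.card = t) (hα : 1 ≤ α) :
    4 * (𝓕.card * 𝓖.card) <
      (4 * c - 1) * (Nat.stirlingSecond M (K - 1) * Nat.stirlingSecond (M + 1) L) := by
  have hlt := h.lt ht (by omega)
  have hapos : 1 ≤ Nat.stirlingSecond M (K - 1) := by
    have := stirlingSecond_pos (m := M - 1) (k := K - 2) (by omega)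
    rwa [show K - 2 + 1 = K - 1 by omega, show M - 1 + 1 = M by omega] at this
  have hbpos : 1 ≤ Nat.stirlingSecond (M + 1) L := by
    have := stirlingSecond_pos (m := M) (k := L - 1) (by omega)
    rwa [show L - 1 + 1 = L by omega] at this
  have ha0pos : 1 ≤ Nat.stirlingSecond (M + 1) K := by
    have := stirlingSecond_pos (m := M) (k := K - 1) (by omega)
    rwa [show K - 1 + 1 = K by omega] at this
  have hb1pos : 1 ≤ Nat.stirlingSecond M (L - 1) := by
    have := stirlingSecond_pos (m := M - 1) (k := L - 2) (by omega)
    rwa [show L - 2 + 1 = L - 1 by omega, show M - 1 + 1 = M by omega] at this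
  have hTG : ∀ G ∈ 𝓖, Z ⊆ G := fun G hG => hZ.subset hZc hG
  obtain ⟨F₀, hF₀, hTF⟩ := hnt.symm.exists_not_subset hZc hTG
  have hcomp := h.four_mul_le ht hL hLK
  have hpos := Nat.mul_pos hapos hbpos
  have hpos' := Nat.mul_pos ha0pos hb1pos
  have hfin : ∀ x, x ≤ Nat.stirlingSecond M (K - 1) * Nat.stirlingSecond (M + 1) L →
      4 * x < (4 * c - 1) * (Nat.stirlingSecond M (K - 1) * Nat.stirlingSecond (M + 1) L) := by
    intro x hle
    have : 7 * (Nat.stirlingSecond M (K - 1) * Nat.stirlingSecond (M + 1) L) ≤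
      (4 * c - 1) * (Nat.stirlingSecond M (K - 1) * Nat.stirlingSecond (M + 1) L) :=
      Nat.mul_le_mul_right _ (by omega)
    omega
  have hg := card_le_of_common h𝓖 h𝓕 (by omega) hcross.symm hneG hZc hTG hF₀ hTF
    fun Y hY => card_containing_le_stirlingSecond (i := 1) hn h𝓖 (by omega) hY
  rw [Nat.add_sub_cancel] at hg
  rcases Nat.eq_or_lt_of_le hL with rfl | hL3
  · -- `L = 2`: crude bounds suffice
    apply hfin
    have hα2 : α ≤ 2 := by
      obtain ⟨G, hG⟩ := hneG
      have h1 := hXmin G (hcross.symm.covers hG)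
      have h2 := (mem_kPartitions.1 (h𝓖 hG)).2
      omega
    have hf := card_le_of_covers (α := 0) (β := α) h𝓖 hcross.symm
      (fun Y hY => hY.le_card hneG) hX hXc
      (fun Y hY => card_containing_le_stirlingSecond (i := 0) hn h𝓕 (by omega) hY)
    have hsq := h.sq_mul_le ht hLK
    have hone : Nat.stirlingSecond M (2 - 1) = 1 := by
      rw [show M = M - 1 + 1 by omega]; exact Nat.stirlingSecond_one_right _
    rw [hone, mul_one] at hg
    rw [pow_zero, one_mul] at hf
    calc 𝓕.card * 𝓖.card ≤ ((t + 1) ^ α * Nat.stirlingSecond (M + 1) K) * K :=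
          Nat.mul_le_mul hf hg
      _ ≤ ((t + 1) ^ 2 * Nat.stirlingSecond (M + 1) K) * (K + 1) ^ 2 := by
          gcongr
          · omega
          · nlinarith
      _ = ((t + 1) * (K + 1)) ^ 2 * Nat.stirlingSecond (M + 1) K := by ring
      _ ≤ _ := hsq
  · have hfin' : ∀ x, x ≤ (K + 1) * (Nat.stirlingSecond (M + 1) K * Nat.stirlingSecond M (L - 1)) →
        4 * x < (4 * c - 1) * (Nat.stirlingSecond M (K - 1) * Nat.stirlingSecond (M + 1) L) := by
      intro x hx
      have h1 : (4 * L - 1) * (Nat.stirlingSecond M (K - 1) * Nat.stirlingSecond (M + 1) L) ≤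
          (4 * c - 1) * (Nat.stirlingSecond M (K - 1) * Nat.stirlingSecond (M + 1) L) :=
        Nat.mul_le_mul_right _ (by omega)
      have h2 : 4 * (K + 2) * (Nat.stirlingSecond (M + 1) K * Nat.stirlingSecond M (L - 1)) =
          4 * ((K + 1) * (Nat.stirlingSecond (M + 1) K * Nat.stirlingSecond M (L - 1))) +
          4 * (Nat.stirlingSecond (M + 1) K * Nat.stirlingSecond M (L - 1)) := by ring
      omega
    rcases Nat.lt_or_ge α 2 with hα1 | hα2
    · obtain rfl : α = 1 := by omega
      have ha₁ : ∀ X : Finset (Finset (Fin n)), X.card = t + 1 → (containing 𝓖 X).card ≤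
          Nat.stirlingSecond M (L - 1) := fun X hX =>
        card_containing_le_stirlingSecond hn h𝓖 (by omega) hX
      have ha₂ : ∀ X : Finset (Finset (Fin n)), X.card = t + 2 → (containing 𝓖 X).card ≤
          Nat.stirlingSecond (M - 1) (L - 2) := fun X hX =>
        card_containing_le_stirlingSecond hn h𝓖 (by omega) hX
      have hb₀ : ∀ X : Finset (Finset (Fin n)), X.card = t → (containing 𝓕 X).card ≤
          Nat.stirlingSecond (M + 1) K := fun X hX =>
        card_containing_le_stirlingSecond (i := 0) hn h𝓕 (by omega) hX
      have hb₁ : ∀ X : Finset (Finset (Fin n)), X.card = t + 1 → (containing 𝓕 X).card ≤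
          Nat.stirlingSecond M (K - 1) := fun X hX =>
        card_containing_le_stirlingSecond hn h𝓕 (by omega) hX
      have hqa : ((t + 1) * (K + 1)) ^ 2 * Nat.stirlingSecond (M - 1) (L - 2) ≤
          Nat.stirlingSecond M (L - 1) := by
        have := h.sq_mul_stirlingSecond_le ht (by omega) (i := 1) (j := L - 2) (by omega)
        rwa [show L - 2 + 1 = L - 1 by omega, show M - 1 + 1 = M by omega] at this
      have hqb : ((t + 1) * (K + 1)) ^ 2 * Nat.stirlingSecond M (K - 1) ≤
          Nat.stirlingSecond (M + 1) K := by
        have := h.sq_mul_stirlingSecond_le ht (by omega) (i := 0) (j := K - 1) (by omega)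
        rwa [show K - 1 + 1 = K by omega, Nat.sub_zero] at this
      rcases structure_of_common ht h𝓖 h𝓕 (by omega) hcross.symm hneG hZc hTG hF₀ hTF hXc hX
        ha₁ ha₂ hb₀ hb₁ (Q := (t + 1) * (K + 1)) (by gcongr) le_rfl hqa hqb with
        ⟨S, hSp, hSc, hGS, hFS⟩ | ⟨S, hSp, hTS, hSc, hGS, hFS⟩ | hsmall
      · have hg1 : 𝓖.card ≤ Nat.stirlingSecond M (L - 1) := by
          have h2 := card_familyC_le (n := n) (k := t + L) (X := S) (by omega)
          rw [show n - S.card = M by omega, show t + L - S.card = L - 1 by omega] at h2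
          exact (card_le_card hGS).trans h2
        have hf1 : 𝓕.card ≤ (t + 1) * Nat.stirlingSecond (M + 1) K := by
          have := hX.card_le hb₀
          rwa [hXc, Nat.choose_succ_self_right] at this
        have hle := Nat.mul_le_mul hf1 hg1
        generalize Nat.stirlingSecond M (K - 1) * Nat.stirlingSecond (M + 1) L = P at *
        have e : (t + 1) * Nat.stirlingSecond (M + 1) K * Nat.stirlingSecond M (L - 1) =
          (t + 1) * (Nat.stirlingSecond (M + 1) K * Nat.stirlingSecond M (L - 1)) := by ring
        rw [e] at hle
        generalize Nat.stirlingSecond (M + 1) K * Nat.stirlingSecond M (L - 1) = R at *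
        have h1 : 4 * (L + 3) * R ≤ (4 * L - 1) * P :=
          le_trans (Nat.mul_le_mul_right _ (by omega)) hcomp
        obtain ⟨d, rfl⟩ : ∃ d, c = d + 1 := ⟨c - 1, by omega⟩
        obtain ⟨l, rfl⟩ : ∃ l, L = l + 1 := ⟨L - 1, by omega⟩
        rw [show 4 * (l + 1) - 1 = 4 * l + 3 by omega] at h1
        rw [show 4 * (d + 1) - 1 = 4 * d + 3 by omega]
        refine lt_of_mul_lt_mul_left (a := l + 1 + 3) ?_ (Nat.zero_le _)
        calc (l + 1 + 3) * (4 * (𝓕.card * 𝓖.card)) ≤ (l + 1 + 3) * (4 * ((t + 1) * R)) := by gcongr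
          _ = (t + 1) * (4 * (l + 1 + 3) * R) := by ring
          _ ≤ (t + 1) * ((4 * l + 3) * P) := by gcongr
          _ ≤ (d + 1) * ((4 * l + 3) * P) := by gcongr
          _ < (l + 1 + 3) * ((4 * d + 3) * P) := by
            have : (d + 1) * (4 * l + 3) < (l + 1 + 3) * (4 * d + 3) := by nlinarith
            calc (d + 1) * ((4 * l + 3) * P) = ((d + 1) * (4 * l + 3)) * P := by ring
              _ < ((l + 1 + 3) * (4 * d + 3)) * P := Nat.mul_lt_mul_of_pos_right this hpos
              _ = _ := by ring
      · apply hfin'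
        have hf1 : 𝓕.card ≤ Nat.stirlingSecond (M + 1) K + t := by
          have h2 := card_familyC_le (n := n) (k := t + K) (X := Z) (by omega)
          rw [show n - Z.card = M + 1 by omega, show t + K - Z.card = K by omega] at h2
          have h3 := (card_le_card hFS).trans (card_familyB_le (l := t + K) Z S)
          omega
        have hKt : K * t ≤ Nat.stirlingSecond (M + 1) K := by
          have h5 := Nat.le_mul_of_pos_right (((t + 1) * (K + 1)) ^ 2) hapos
          have h6 : K * t ≤ ((t + 1) * (K + 1)) ^ 2 := by
            calc K * t ≤ (K + 1) * (t + 1) := by gcongr <;> omega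
              _ = (t + 1) * (K + 1) := by ring
              _ ≤ _ := Nat.le_self_pow (by norm_num) _
          omega
        calc 𝓕.card * 𝓖.card ≤ (Nat.stirlingSecond (M + 1) K + t) *
              (K * Nat.stirlingSecond M (L - 1)) := Nat.mul_le_mul hf1 hg
          _ = K * Nat.stirlingSecond (M + 1) K * Nat.stirlingSecond M (L - 1) +
              K * t * Nat.stirlingSecond M (L - 1) := by ring
          _ ≤ K * Nat.stirlingSecond (M + 1) K * Nat.stirlingSecond M (L - 1) +
              Nat.stirlingSecond (M + 1) K * Nat.stirlingSecond M (L - 1) := by gcongr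
          _ = _ := by ring
      · apply hfin'
        have h1 : (2 * K - 1) * (Nat.stirlingSecond M (L - 1) * Nat.stirlingSecond (M + 1) K) ≤
            2 * (K + 1) * (Nat.stirlingSecond M (L - 1) * Nat.stirlingSecond (M + 1) K) :=
          Nat.mul_le_mul_right _ (by omega)
        rw [mul_comm 𝓕.card, mul_comm (Nat.stirlingSecond (M + 1) K)]
        have h2 := hsmall.trans h1
        rw [mul_assoc] at h2
        omega
    · apply hfin'
      have hle := mul_le_of_min_covers (β := α) (α := 0) hn h ht hL3 hLK.le (by omega) le_rfl
        h𝓖 h𝓕 hcross.symm hZ hZc (fun Y hY => hZc ▸ hY.le_card hneG) hX hXc hXmin (by omega)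
        (by omega)
      rw [mul_comm, mul_comm (Nat.stirlingSecond (M + 1) K)]
      exact hle.trans (Nat.le_mul_of_pos_left _ (by omega))

end

/-! ### Partitions into `t + 2` blocks -/

section

variable {n t M : ℕ} {𝓕 𝓖 : Finset (Finset (Finset (Fin n)))}

/-- For `K = 2` the number of partitions containing `t` given singletons exceeds every polynomial
in `t` that occurs. -/
theorem AboveThreshold.pow_five_le_two (h : AboveThreshold t 2 M) (ht : 1 ≤ t) :
    2 ^ (t + 1) * (243 * (t + 1) ^ 5) ≤ Nat.stirlingSecond (M + 1) 2 + 1 := by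
  have h1 := h.two_pow_mul_pow_five_le ht le_rfl (p := M) (by omega)
  rw [stirlingSecond_two_right]
  calc 2 ^ (t + 1) * (243 * (t + 1) ^ 5) = 2 ^ (t + 1) * ((t + 1) * (2 + 1)) ^ 5 := by ring
    _ ≤ _ := h1

theorem stirlingSecond_two_le_two_pow (p : ℕ) : Nat.stirlingSecond p 2 ≤ 2 ^ (p - 1) := by
  cases p with
  | zero => simp
  | succ p => have := stirlingSecond_two_right p; rw [Nat.add_sub_cancel]; omega

/-- A family of partitions into `t + 2` blocks that all share `t` blocks with one such partition
`F₀`: unless the pair is extremal, the family is small. The proof compares the largest block `g`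
of `F₀` with the other blocks. If they are not all singletons, then members avoiding `g` are
rarer by a definite factor, and members containing `g` are rare if `g` is large; if `g` is small,
then all members are rare. -/
theorem exists_singletons_or_lt_of_forall (hn : n = t + M + 1) (h : AboveThreshold t 2 M)
    (ht : 2 ≤ t) (h𝓖 : 𝓖 ⊆ kPartitions n (t + 2)) {F₀ : Finset (Finset (Fin n))}
    (hF₀ : F₀ ∈ kPartitions n (t + 2)) (hcov : Covers t F₀ 𝓖) :
    (∃ I : Finset (Fin n), I.card = t + 1 ∧ singletons I ⊆ F₀ ∧
      𝓖 ⊆ familyD n (t + 2) t (singletons I)) ∨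
    4 * 𝓖.card < (4 * t + 3) * Nat.stirlingSecond (M + 1) 2 := by
  obtain ⟨hF₀p, hF₀c⟩ := mem_kPartitions.1 hF₀
  obtain ⟨g, hg, hgmax⟩ := exists_max_image F₀ card (card_pos.1 (by omega))
  have hHc : (F₀.erase g).card = t + 1 := by rw [card_erase_of_mem hg, hF₀c]; omega
  have hnsum : n = ∑ B ∈ F₀, B.card := by
    rw [← hF₀p.1.card_sup_id, hF₀p.2, card_univ, Fintype.card_fin]
  have hHp := hF₀p.1.mono (erase_subset g F₀)
  have hHsum : g.card + ((F₀.erase g).sup id).card = n := by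
    rw [hHp.card_sup_id]
    exact (add_sum_erase F₀ card hg).trans hnsum.symm
  by_cases hsing : ∀ B ∈ F₀.erase g, B.card = 1
  · left
    obtain ⟨I, hI⟩ := exists_eq_singletons hsing
    rw [hI, card_singletons] at hHc
    refine ⟨I, hHc, hI ▸ erase_subset g F₀, fun G hG => mem_filter.2 ⟨h𝓖 hG, ?_⟩⟩
    obtain ⟨hGp, hGc⟩ := mem_kPartitions.1 (h𝓖 hG)
    rw [← hI]
    by_cases hgG : g ∈ G
    · -- `G` splits the complement of `g` into as many blocks as it has points
      have hGe := hGp.1.mono (erase_subset g G)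
      have hGec : (G.erase g).card = t + 1 := by rw [card_erase_of_mem hgG, hGc]; omega
      have hsub : (G.erase g).sup id ⊆ (F₀.erase g).sup id := by
        intro x hx
        obtain ⟨B, hB, hxB⟩ := mem_sup_id.1 hx
        rw [mem_erase] at hB
        obtain ⟨C, hC, hxC⟩ := mem_sup_id.1 (show x ∈ F₀.sup id by rw [hF₀p.2]; exact mem_univ _)
        refine mem_sup_id.2 ⟨C, mem_erase.2 ⟨?_, hC⟩, hxC⟩
        rintro rfl
        exact hB.1 (hGp.1.2 B hB.2 C hgG x hxB hxC)
      have hle := card_le_card hsub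
      rw [hI, sup_singletons, hHc] at hle
      have hone : ∀ B ∈ G.erase g, B.card = 1 := fun B hB => by
        by_contra hB1
        have := hGe.lt_card hB hB1
        omega
      have hsub2 : F₀.erase g ⊆ G := by
        intro B hB
        rw [hI] at hB
        obtain ⟨i, hi, rfl⟩ := mem_singletons.1 hB
        rw [← hI, mem_erase] at hB
        obtain ⟨C, hC, hiC⟩ := mem_sup_id.1 (show i ∈ G.sup id by rw [hGp.2]; exact mem_univ _)
        have hCg : C ≠ g := by
          rintro rfl
          exact hB.1 (hF₀p.1.2 _ hB.2 C hg i (mem_singleton_self i) hiC)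
        obtain ⟨j, rfl⟩ := card_eq_one.1 (hone C (mem_erase.2 ⟨hCg, hC⟩))
        rwa [mem_singleton.1 hiC]
      rw [inter_eq_left.2 hsub2, hI, card_singletons]
      omega
    · refine (hcov G hG).trans (card_le_card fun B hB => ?_)
      rw [mem_inter] at hB
      exact mem_inter.2 ⟨mem_erase.2 ⟨fun e => hgG (e ▸ hB.2), hB.1⟩, hB.2⟩
  · right
    push Not at hsing
    obtain ⟨B, hB, hB1⟩ := hsing
    have hbig := h.pow_five_le_two (by omega)
    have h2M := stirlingSecond_two_right M
    rcases Nat.lt_or_ge (2 ^ g.card) (8 * (t + 1) ^ 2) with hsmall | hlarge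
    · -- `g` is small, so the two blocks outside any `t` of the blocks cover few points
      have hcard := hcov.card_le_of_subset (B := 64 * (t + 1) ^ 4) fun Y hY hYc => by
        refine (card_containing_le_card_familyC h𝓖 Y).trans ?_
        rw [card_familyC (hF₀p.1.mono hY) (by omega)]
        have h1 : n - (Y.sup id).card ≤ 2 * g.card := by
          rw [(hF₀p.1.mono hY).card_sup_id]
          have h2 : (F₀ \ Y).card = 2 := by rw [card_sdiff_of_subset hY]; omega
          have h3 : ∑ C ∈ F₀ \ Y, C.card ≤ (F₀ \ Y).card * g.card :=
            sum_le_card_nsmul _ _ _ fun C hC => hgmax C (mem_sdiff.1 hC).1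
          have h4 := sum_sdiff hY (f := card)
          rw [h2] at h3
          omega
        rw [show t + 2 - Y.card = 2 by omega]
        calc Nat.stirlingSecond (n - (Y.sup id).card) 2 ≤ 2 ^ (n - (Y.sup id).card - 1) :=
              stirlingSecond_two_le_two_pow _
          _ ≤ 2 ^ (2 * g.card) := Nat.pow_le_pow_right (by norm_num) (by omega)
          _ = (2 ^ g.card) ^ 2 := by rw [mul_comm, pow_mul]
          _ ≤ (8 * (t + 1) ^ 2) ^ 2 := Nat.pow_le_pow_left hsmall.le 2
          _ = _ := by ring
      rw [hF₀c] at hcard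
      have h3 := Nat.mul_le_mul_right (64 * (t + 1) ^ 4) (choose_add_le_pow t 2)
      have h4 : (t + 1) ^ 6 * 243 ≤ Nat.stirlingSecond (M + 1) 2 + 1 :=
        calc (t + 1) ^ 6 * 243 = (t + 1) * (243 * (t + 1) ^ 5) := by ring
          _ ≤ 2 ^ (t + 1) * (243 * (t + 1) ^ 5) :=
            Nat.mul_le_mul_right _ (Nat.lt_two_pow_self).le
          _ ≤ _ := hbig
      have h5 : 11 * Nat.stirlingSecond (M + 1) 2 ≤
          (4 * t + 3) * Nat.stirlingSecond (M + 1) 2 := Nat.mul_le_mul_right _ (by omega)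
      have h6 : 1 ≤ (t + 1) ^ 6 := Nat.one_le_pow _ _ (by omega)
      have h7 : (t + 1) ^ 2 * (64 * (t + 1) ^ 4) = 64 * (t + 1) ^ 6 := by ring
      omega
    · -- `g` is large, so few members contain `g`
      have hsplit : 𝓖.card ≤ (familyD n (t + 2) t (F₀.erase g)).card +
          (𝓖.filter fun G => g ∈ G).card := by
        refine (card_le_card fun G hG => ?_).trans (card_union_le _ _)
        by_cases hgG : g ∈ G
        · exact mem_union_right _ (mem_filter.2 ⟨hG, hgG⟩)
        · refine mem_union_left _ (mem_filter.2 ⟨h𝓖 hG, ?_⟩)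
          refine (hcov G hG).trans (card_le_card fun B hB => ?_)
          rw [mem_inter] at hB
          exact mem_inter.2 ⟨mem_erase.2 ⟨fun e => hgG (e ▸ hB.2), hB.1⟩, hB.2⟩
      have hD := two_mul_card_familyD_le hn (by omega) le_rfl hHc hB hB1
      have hcov2 : Covers (t - 1) (F₀.erase g) (𝓖.filter fun G => g ∈ G) := by
        intro G hG
        have h1 := hcov G (mem_filter.1 hG).1
        have h2 : F₀ ∩ G ⊆ insert g (F₀.erase g ∩ G) := fun C hC => by
          rw [mem_inter] at hC
          by_cases hCg : C = g
          · exact mem_insert.2 (Or.inl hCg)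
          · exact mem_insert_of_mem (mem_inter.2 ⟨mem_erase.2 ⟨hCg, hC.1⟩, hC.2⟩)
        have h3 := (card_le_card h2).trans (card_insert_le _ _)
        omega
      have hgM : g.card ≤ M := by
        have := hHp.card_le
        omega
      have hcard := hcov2.card_le_of_subset (B := 2 ^ (M + 1 - g.card)) fun Y hY hYc => by
        have hgY : g ∉ Y := fun hgY => (mem_erase.1 (hY hgY)).1 rfl
        have hsub : insert g Y ⊆ F₀ := insert_subset hg (hY.trans (erase_subset _ _))
        have h1 : containing (𝓖.filter fun G => g ∈ G) Y ⊆ familyC n (t + 2) (insert g Y) := by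
          intro G hG
          rw [mem_containing, mem_filter] at hG
          exact mem_filter.2 ⟨h𝓖 hG.1.1, insert_subset hG.1.2 hG.2⟩
        refine (card_le_card h1).trans ?_
        have hc : (insert g Y).card = t := by rw [card_insert_of_notMem hgY, hYc]; omega
        rw [card_familyC (hF₀p.1.mono hsub) (by omega), hc, (hF₀p.1.mono hsub).card_sup_id,
          sum_insert hgY, show t + 2 - t = 2 by omega]
        have h2 : Y.card ≤ ∑ B ∈ Y, B.card := by
          rw [← (hF₀p.1.mono ((subset_insert _ _).trans hsub)).card_sup_id]
          exact (hF₀p.1.mono ((subset_insert _ _).trans hsub)).card_le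
        refine (stirlingSecond_two_le_two_pow _).trans (Nat.pow_le_pow_right (by norm_num) ?_)
        omega
      rw [hHc] at hcard
      have h3 : (t + 1).choose (t - 1) ≤ t ^ 2 := by
        have := choose_add_le_pow (t - 1) 2
        rwa [show t - 1 + 2 = t + 1 by omega, show t - 1 + 1 = t by omega] at this
      have h4 := hcard.trans (Nat.mul_le_mul_right _ h3)
      have h5 : 4 * ((t + 1) ^ 2 * 2 ^ (M + 1 - g.card)) ≤ 2 ^ M := by
        refine Nat.le_of_mul_le_mul_left (c := 2) ?_ (by norm_num)
        calc 2 * (4 * ((t + 1) ^ 2 * 2 ^ (M + 1 - g.card)))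
            = 8 * (t + 1) ^ 2 * 2 ^ (M + 1 - g.card) := by ring
          _ ≤ 2 ^ g.card * 2 ^ (M + 1 - g.card) := Nat.mul_le_mul_right _ hlarge
          _ = 2 ^ (M + 1) := by rw [← pow_add]; congr 1; omega
          _ = _ := by ring
      have hE : 1 ≤ 2 ^ (M + 1 - g.card) := Nat.one_le_two_pow
      have h6 : (t + 1) ^ 2 * 2 ^ (M + 1 - g.card) = t ^ 2 * 2 ^ (M + 1 - g.card) +
          2 * (t * 2 ^ (M + 1 - g.card)) + 2 ^ (M + 1 - g.card) := by ring
      have h7 : (4 * t + 3) * Nat.stirlingSecond (M + 1) 2 =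
          2 * ((2 * t + 1) * Nat.stirlingSecond (M + 1) 2) + Nat.stirlingSecond (M + 1) 2 := by
        ring
      omega

/-- The case of a common `t`-set of `𝓕`. Then `𝓕` has at most two members; two members leave
only polynomially many members of `𝓖` that do not contain `T`, and for a single member
`exists_singletons_or_lt_of_forall` applies. -/
theorem insideCD_or_lt_of_common_two (hn : n = t + M + 1) (h : AboveThreshold t 2 M)
    (ht : 2 ≤ t) (h𝓕 : 𝓕 ⊆ kPartitions n (t + 2)) (h𝓖 : 𝓖 ⊆ kPartitions n (t + 2))
    (hcross : CrossIntersecting t 𝓕 𝓖) (hne : 𝓕.Nonempty)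
    {T : Finset (Finset (Fin n))} (hT : T.card = t) (hTF : ∀ F ∈ 𝓕, T ⊆ F)
    {G₀ : Finset (Finset (Fin n))} (hG₀ : G₀ ∈ 𝓖) (hTG : ¬ T ⊆ G₀) :
    InsideCD (t + 2) (t + 2) t 𝓕 𝓖 ∨
      4 * (𝓕.card * 𝓖.card) < (4 * t + 3) * Nat.stirlingSecond (M + 1) 2 := by
  rcases Nat.lt_or_ge 1 𝓕.card with hf | hf
  · right
    obtain ⟨F₁, hF₁, F₂, hF₂, hne12⟩ := one_lt_card.1 hf
    have hf2 : 𝓕.card ≤ 2 * 1 := card_le_of_common h𝓕 h𝓖 (by norm_num) hcross hne hT hTF hG₀ hTG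
      fun Y hY => (card_containing_le_card_familyC h𝓕 Y).trans (card_familyC_le_one (by omega))
    have hint : (F₁ ∩ F₂).card ≤ t := by
      by_contra! hgt
      have h1 := card_familyC_le_one (n := n) (k := t + 2) (X := F₁ ∩ F₂) (by omega)
      exact hne12 (card_le_one.1 h1 F₁ (mem_filter.2 ⟨h𝓕 hF₁, inter_subset_left⟩) F₂
        (mem_filter.2 ⟨h𝓕 hF₂, inter_subset_right⟩))
    have hTeq : T = F₁ ∩ F₂ := eq_of_subset_of_card_le
      (subset_inter (hTF F₁ hF₁) (hTF F₂ hF₂)) (by omega)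
    have hc1 : F₁.card = t + 2 := (mem_kPartitions.1 (h𝓕 hF₁)).2
    have hc2 : F₂.card = t + 2 := (mem_kPartitions.1 (h𝓕 hF₂)).2
    have hunion : (F₁ ∪ F₂).card = (t + 1) + 3 := by
      have := card_union_add_card_inter F₁ F₂
      rw [← hTeq, hT] at this
      omega
    have hcov : Covers (t + 1) (F₁ ∪ F₂) (𝓖.filter fun G => ¬ T ⊆ G) := by
      intro G hG
      rw [mem_filter] at hG
      have h1 := hcross F₁ hF₁ G hG.1
      have h2 := hcross F₂ hF₂ G hG.1
      have h3 : (T ∩ G).card < t := by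
        rw [← hT]
        exact card_lt_card ⟨inter_subset_left, fun h => hG.2 fun B hB => (mem_inter.1 (h hB)).2⟩
      have h4 := card_union_add_card_inter (F₁ ∩ G) (F₂ ∩ G)
      rw [← union_inter_distrib_right, ← inter_inter_distrib_right, ← hTeq] at h4
      omega
    have h5 := hcov.card_le (B := 1) fun Y hY =>
      (card_containing_le_card_familyC ((filter_subset _ _).trans h𝓖) Y).trans
        (card_familyC_le_one (by omega))
    rw [hunion, mul_one] at h5
    have h6 := h5.trans (choose_add_le_pow (t + 1) 3)
    have h7 : (containing 𝓖 T).card ≤ Nat.stirlingSecond (M + 1) 2 :=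
      card_containing_le_stirlingSecond (K := 2) (i := 0) hn h𝓖 (by norm_num) hT
    have h8 : 𝓖.card ≤ Nat.stirlingSecond (M + 1) 2 + (t + 1 + 1) ^ 3 := by
      rw [← card_filter_add_card_filter_not (s := 𝓖) (fun G => T ⊆ G)]
      exact Nat.add_le_add h7 h6
    have hbig := h.pow_five_le_two (by omega)
    have h9 : 8 * (t + 1 + 1) ^ 3 < 3 * Nat.stirlingSecond (M + 1) 2 := by
      have h10 : (t + 1 + 1) ^ 3 ≤ 8 * (t + 1) ^ 5 :=
        calc (t + 1 + 1) ^ 3 ≤ (2 * (t + 1)) ^ 3 := Nat.pow_le_pow_left (by omega) 3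
          _ = 8 * (t + 1) ^ 3 := by ring
          _ ≤ 8 * (t + 1) ^ 5 := by gcongr <;> omega
      have h11 : 1 * (243 * (t + 1) ^ 5) ≤ 2 ^ (t + 1) * (243 * (t + 1) ^ 5) :=
        Nat.mul_le_mul_right _ Nat.one_le_two_pow
      have h12 : 1 ≤ (t + 1) ^ 5 := Nat.one_le_pow _ _ (by omega)
      omega
    have h13 : 11 * Nat.stirlingSecond (M + 1) 2 ≤ (4 * t + 3) * Nat.stirlingSecond (M + 1) 2 :=
      Nat.mul_le_mul_right _ (by omega)
    have h14 := Nat.mul_le_mul hf2 h8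
    omega
  · obtain ⟨F₀, rfl⟩ := card_eq_one.1 (le_antisymm hf hne.card_pos)
    have hF₀ : F₀ ∈ kPartitions n (t + 2) := h𝓕 (mem_singleton_self _)
    rcases exists_singletons_or_lt_of_forall hn h ht h𝓖 hF₀
      (hcross.covers (mem_singleton_self _)) with ⟨I, hI, hIF, hIG⟩ | hlt
    · left
      refine ⟨I, hI, fun F hF => mem_filter.2 ⟨h𝓕 hF, ?_⟩, hIG⟩
      rwa [mem_singleton.1 hF]
    · right
      rwa [card_singleton, one_mul]

/-- The dichotomy for `k₁ = k₂ = t + 2`, where `S(M, 1) * S(M + 1, 2)` is just `S(M + 1, 2)`. -/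
theorem insideCD_or_lt_two (hn : n = t + M + 1) (h : AboveThreshold t 2 M)
    (ht : 2 ≤ t) (h𝓕 : 𝓕 ⊆ kPartitions n (t + 2)) (h𝓖 : 𝓖 ⊆ kPartitions n (t + 2))
    (hcross : CrossIntersecting t 𝓕 𝓖) (hnt : NonTrivialPair t 𝓕 𝓖)
    (hneF : 𝓕.Nonempty) (hneG : 𝓖.Nonempty) :
    InsideCD (t + 2) (t + 2) t 𝓕 𝓖 ∨ InsideCD (t + 2) (t + 2) t 𝓖 𝓕 ∨
      4 * (𝓕.card * 𝓖.card) < (4 * t + 3) * Nat.stirlingSecond (M + 1) 2 := by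
  obtain ⟨F₀, hF₀⟩ := id hneF
  obtain ⟨G₀, hG₀⟩ := id hneG
  by_cases hX : ∃ X, Covers t X 𝓕 ∧ X.card = t
  · obtain ⟨X, hX, hXc⟩ := hX
    have hTF : ∀ F ∈ 𝓕, X ⊆ F := fun F hF => hX.subset hXc hF
    obtain ⟨G, hG, hTG⟩ := hnt.exists_not_subset hXc hTF
    rcases insideCD_or_lt_of_common_two hn h ht h𝓕 h𝓖 hcross hneF hXc hTF hG hTG with h1 | h1
    exacts [Or.inl h1, Or.inr (Or.inr h1)]
  by_cases hZ : ∃ Z, Covers t Z 𝓖 ∧ Z.card = t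
  · obtain ⟨Z, hZ, hZc⟩ := hZ
    have hTG : ∀ G ∈ 𝓖, Z ⊆ G := fun G hG => hZ.subset hZc hG
    obtain ⟨F, hF, hTF⟩ := hnt.symm.exists_not_subset hZc hTG
    rcases insideCD_or_lt_of_common_two hn h ht h𝓖 h𝓕 hcross.symm hneG hZc hTG hF hTF with h1 | h1
    exacts [Or.inr (Or.inl h1), Or.inr (Or.inr (by rwa [mul_comm 𝓕.card]))]
  · right; right
    -- all covers have at least `t + 1` blocks, and `t + 1` blocks determine a partition
    have hXmin : ∀ Y, Covers t Y 𝓕 → t + 1 ≤ Y.card := fun Y hY => by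
      have h1 := hY.le_card hneF
      rcases Nat.eq_or_lt_of_le h1 with h2 | h2
      exacts [absurd ⟨Y, hY, h2.symm⟩ hX, h2]
    have hZmin : ∀ Y, Covers t Y 𝓖 → t + 1 ≤ Y.card := fun Y hY => by
      have h1 := hY.le_card hneG
      rcases Nat.eq_or_lt_of_le h1 with h2 | h2
      exacts [absurd ⟨Y, hY, h2.symm⟩ hZ, h2]
    have hf := card_le_of_covers (B := 1) h𝓖 hcross.symm hZmin (hcross.symm.covers hG₀)
      (mem_kPartitions.1 (h𝓖 hG₀)).2 fun Y hY =>
        (card_containing_le_card_familyC h𝓕 Y).trans (card_familyC_le_one (by omega))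
    have hg := card_le_of_covers (B := 1) h𝓕 hcross hXmin (hcross.covers hF₀)
      (mem_kPartitions.1 (h𝓕 hF₀)).2 fun Y hY =>
        (card_containing_le_card_familyC h𝓖 Y).trans (card_familyC_le_one (by omega))
    have hbig := h.pow_five_le_two (by omega)
    have h1 := Nat.mul_le_mul hf hg
    have h2 : (t + 1) ^ 2 * ((2 + 1) ^ 1 * 1) * ((t + 1) ^ 2 * ((2 + 1) ^ 1 * 1)) ≤
        9 * (t + 1) ^ 5 := by
      calc (t + 1) ^ 2 * ((2 + 1) ^ 1 * 1) * ((t + 1) ^ 2 * ((2 + 1) ^ 1 * 1)) =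
            9 * (t + 1) ^ 4 := by ring
        _ ≤ _ := by gcongr <;> omega
    have h11 : 1 * (243 * (t + 1) ^ 5) ≤ 2 ^ (t + 1) * (243 * (t + 1) ^ 5) :=
      Nat.mul_le_mul_right _ Nat.one_le_two_pow
    have h12 : 1 ≤ (t + 1) ^ 5 := Nat.one_le_pow _ _ (by omega)
    have h13 : 11 * Nat.stirlingSecond (M + 1) 2 ≤ (4 * t + 3) * Nat.stirlingSecond (M + 1) 2 :=
      Nat.mul_le_mul_right _ (by omega)
    omega

end

/-! ### Permutations of the ground set -/

section

variable {n k l t : ℕ}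

/-- The image of a set of blocks under a permutation of the ground set. -/
def permuteBlocks (σ : Equiv.Perm (Fin n)) (X : Finset (Finset (Fin n))) :
    Finset (Finset (Fin n)) :=
  X.image fun B => B.image σ

theorem permuteBlocks_injective (σ : Equiv.Perm (Fin n)) :
    Function.Injective (permuteBlocks σ) :=
  image_injective (image_injective σ.injective)

theorem card_permuteBlocks (σ : Equiv.Perm (Fin n)) (X : Finset (Finset (Fin n))) :
    (permuteBlocks σ X).card = X.card :=
  card_image_of_injective _ (image_injective σ.injective)

theorem permuteBlocks_subset_permuteBlocks {σ : Equiv.Perm (Fin n)}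
    {X Y : Finset (Finset (Fin n))} : permuteBlocks σ X ⊆ permuteBlocks σ Y ↔ X ⊆ Y :=
  image_subset_image_iff (image_injective σ.injective)

theorem permuteBlocks_inter (σ : Equiv.Perm (Fin n)) (X Y : Finset (Finset (Fin n))) :
    permuteBlocks σ (X ∩ Y) = permuteBlocks σ X ∩ permuteBlocks σ Y :=
  image_inter _ _ (image_injective σ.injective)

theorem permuteBlocks_sdiff (σ : Equiv.Perm (Fin n)) (X Y : Finset (Finset (Fin n))) :
    permuteBlocks σ (X \ Y) = permuteBlocks σ X \ permuteBlocks σ Y :=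
  image_sdiff _ _ (image_injective σ.injective)

theorem sup_permuteBlocks (σ : Equiv.Perm (Fin n)) (X : Finset (Finset (Fin n))) :
    (permuteBlocks σ X).sup id = (X.sup id).image σ := by
  ext x
  simp only [mem_sup_id, permuteBlocks, mem_image]
  constructor
  · rintro ⟨_, ⟨B, hB, rfl⟩, hx⟩
    obtain ⟨y, hy, rfl⟩ := mem_image.1 hx
    exact ⟨y, ⟨B, hB, hy⟩, rfl⟩
  · rintro ⟨y, ⟨B, hB, hy⟩, rfl⟩
    exact ⟨_, ⟨B, hB, rfl⟩, mem_image_of_mem _ hy⟩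

theorem permuteBlocks_singletons (σ : Equiv.Perm (Fin n)) (I : Finset (Fin n)) :
    permuteBlocks σ (singletons I) = singletons (I.image σ) := by
  simp only [permuteBlocks, singletons, image_image, Function.comp_def, image_singleton]

theorem card_permuteFamily (σ : Equiv.Perm (Fin n)) (𝓕 : Finset (Finset (Finset (Fin n)))) :
    (permuteFamily σ 𝓕).card = 𝓕.card :=
  card_image_of_injective _ (permuteBlocks_injective σ)

theorem permuteFamily_kPartitions (σ : Equiv.Perm (Fin n)) (k : ℕ) :
    permuteFamily σ (kPartitions n k) = kPartitions n k := by
  refine eq_of_subset_of_card_le (fun F hF => ?_) (card_permuteFamily σ _).ge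
  obtain ⟨G, hG, rfl⟩ := mem_image.1 hF
  obtain ⟨⟨⟨hG1, hG2⟩, hG3⟩, hG4⟩ := mem_kPartitions.1 hG
  refine mem_kPartitions.2 ⟨⟨⟨fun B hB' => ?_, fun B hB' C hC' x hxB hxC => ?_⟩, ?_⟩,
    (card_permuteBlocks σ G).trans hG4⟩
  · obtain ⟨B, hB, rfl⟩ := mem_image.1 hB'
    exact (hG1 B hB).image σ
  · obtain ⟨B, hB, rfl⟩ := mem_image.1 hB'
    obtain ⟨C, hC, rfl⟩ := mem_image.1 hC'
    obtain ⟨y, hy, rfl⟩ := mem_image.1 hxB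
    obtain ⟨z, hz, hzy⟩ := mem_image.1 hxC
    rw [hG2 B hB C hC y hy (σ.injective hzy ▸ hz)]
  · exact (sup_permuteBlocks σ G).trans (by rw [hG3, image_univ_equiv])

theorem permuteFamily_filter (σ : Equiv.Perm (Fin n)) {p q : Finset (Finset (Fin n)) → Prop}
    [DecidablePred p] [DecidablePred q] (h : ∀ F, p F ↔ q (permuteBlocks σ F)) :
    permuteFamily σ ((kPartitions n k).filter p) = (kPartitions n k).filter q := by
  conv_rhs => rw [← permuteFamily_kPartitions σ]
  unfold permuteFamily
  rw [filter_image]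
  congr 1
  exact filter_congr fun F _ => h F

theorem permuteFamily_familyC (σ : Equiv.Perm (Fin n)) (X : Finset (Finset (Fin n))) :
    permuteFamily σ (familyC n k X) = familyC n k (permuteBlocks σ X) :=
  permuteFamily_filter σ fun _ => permuteBlocks_subset_permuteBlocks.symm

theorem permuteFamily_familyD (σ : Equiv.Perm (Fin n)) (X : Finset (Finset (Fin n))) :
    permuteFamily σ (familyD n l t X) = familyD n l t (permuteBlocks σ X) :=
  permuteFamily_filter σ fun F => by rw [← permuteBlocks_inter, card_permuteBlocks]

theorem permuteFamily_familyA (σ : Equiv.Perm (Fin n)) (X M : Finset (Finset (Fin n))) :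
    permuteFamily σ (familyA n k X M) =
      familyA n k (permuteBlocks σ X) (permuteBlocks σ M) :=
  permuteFamily_filter σ fun F => by
    rw [permuteBlocks_subset_permuteBlocks, ← permuteBlocks_sdiff, ← permuteBlocks_inter,
      ← card_pos, ← card_pos, card_permuteBlocks]

theorem permuteFamily_familyB (σ : Equiv.Perm (Fin n)) (X M : Finset (Finset (Fin n))) :
    permuteFamily σ (familyB n l X M) =
      familyB n l (permuteBlocks σ X) (permuteBlocks σ M) := by
  have h := permuteFamily_familyC (k := l) σ X
  unfold permuteFamily familyC at h
  unfold permuteFamily familyB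
  rw [image_union, h]
  congr 1
  conv_rhs => unfold permuteBlocks
  rw [image_image, image_image]
  refine image_congr fun B _ => ?_
  have h1 := sup_permuteBlocks σ M
  unfold permuteBlocks at h1
  have h2 : ((M.sup id)ᶜ).image σ = ((M.sup id).image σ)ᶜ := by
    rw [compl_eq_univ_sdiff, image_sdiff _ _ σ.injective, image_univ_equiv, compl_eq_univ_sdiff]
  simp only [Function.comp_apply]
  rw [image_union, image_sdiff _ _ (image_injective σ.injective), image_singleton,
    image_singleton, image_union, h2, h1]

/-- Two chains `J ⊆ I` and `J' ⊆ I'` of sets of the same sizes differ by a permutation. -/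
theorem exists_perm_image_eq {J I J' I' : Finset (Fin n)} (hJI : J ⊆ I) (hJI' : J' ⊆ I')
    (hJ : J.card = J'.card) (hI : I.card = I'.card) :
    ∃ σ : Equiv.Perm (Fin n), J.image σ = J' ∧ I.image σ = I' := by
  let e₂ : {x // x ∈ I} ≃ {x // x ∈ I'} := equivOfCardEq hI
  obtain ⟨e, he⟩ : ∃ e : {x // x ∈ I} ≃ {x // x ∈ I'}, ∀ x, x.1 ∈ J ↔ (e x).1 ∈ J' := by
    have hc : Fintype.card {x : {x // x ∈ I} // (e₂ x).1 ∈ J'} =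
        Fintype.card {x : {x // x ∈ I} // x.1 ∈ J} := by
      have h1 : Fintype.card {x : {x // x ∈ I} // x.1 ∈ J} = J.card := by
        rw [← Fintype.card_coe J]
        exact Fintype.card_congr (Equiv.subtypeSubtypeEquivSubtype fun h => hJI h)
      have h2 : Fintype.card {x : {x // x ∈ I} // (e₂ x).1 ∈ J'} = J'.card := by
        rw [← Fintype.card_coe J']
        exact Fintype.card_congr ((e₂.subtypeEquiv fun _ => Iff.rfl).trans
          (Equiv.subtypeSubtypeEquivSubtype (p := (· ∈ I')) (q := (· ∈ J')) fun h => hJI' h))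
      rw [h1, h2, hJ]
    let τ : {x : {x // x ∈ I} // x.1 ∈ J} ≃ {x : {x // x ∈ I} // (e₂ x).1 ∈ J'} :=
      (Fintype.equivOfCardEq hc).symm
    refine ⟨τ.extendSubtype.trans e₂, fun x => ?_⟩
    by_cases hx : x.1 ∈ J
    · simp only [hx, true_iff]
      exact τ.extendSubtype_mem x hx
    · simp only [hx, false_iff]
      exact τ.extendSubtype_not_mem x hx
  have hmem : ∀ x : Fin n, x ∈ I → (e.extendSubtype x) ∈ I' := fun x hx =>
    e.extendSubtype_mem x hx
  refine ⟨e.extendSubtype, ?_, ?_⟩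
  · refine eq_of_subset_of_card_le (fun y hy => ?_) ?_
    · obtain ⟨x, hx, rfl⟩ := mem_image.1 hy
      rw [Equiv.extendSubtype_apply_of_mem e x (hJI hx)]
      exact (he ⟨x, hJI hx⟩).1 hx
    · rw [card_image_of_injective _ (Equiv.injective _), hJ]
  · refine eq_of_subset_of_card_le (fun y hy => ?_) ?_
    · obtain ⟨x, hx, rfl⟩ := mem_image.1 hy
      exact hmem x hx
    · rw [card_image_of_injective _ (Equiv.injective _), hI]

/-- The first `m` points of the ground set. -/
def initialPoints (n m : ℕ) : Finset (Fin n) := univ.filter fun i => (i : ℕ) < m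

theorem card_initialPoints {n m : ℕ} (h : m ≤ n) : (initialPoints n m).card = m := by
  rw [initialPoints, Fin.card_filter_val_lt, min_eq_right h]

theorem initialPoints_subset (n : ℕ) {m m' : ℕ} (h : m ≤ m') :
    initialPoints n m ⊆ initialPoints n m' := fun i hi =>
  mem_filter.2 ⟨mem_univ i, (mem_filter.1 hi).2.trans_le h⟩

theorem exists_perm_stdA_stdB (htl : t ≤ l) (hln : l ≤ n) {J I : Finset (Fin n)} (hJI : J ⊆ I)
    (hJ : J.card = t) (hI : I.card = l) : ∃ σ : Equiv.Perm (Fin n),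
      permuteFamily σ (familyA n k (singletons J) (singletons I)) = stdA n k l t ∧
      permuteFamily σ (familyB n l (singletons J) (singletons I)) = stdB n l t := by
  obtain ⟨σ, h1, h2⟩ := exists_perm_image_eq hJI (initialPoints_subset n htl)
    (hJ.trans (card_initialPoints (htl.trans hln)).symm) (hI.trans (card_initialPoints hln).symm)
  refine ⟨σ, ?_, ?_⟩
  · rw [permuteFamily_familyA, permuteBlocks_singletons, permuteBlocks_singletons, h1, h2]; rfl
  · rw [permuteFamily_familyB, permuteBlocks_singletons, permuteBlocks_singletons, h1, h2]; rfl

theorem exists_perm_stdC_stdD (htn : t + 1 ≤ n) {I : Finset (Fin n)} (hI : I.card = t + 1) :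
    ∃ σ : Equiv.Perm (Fin n), permuteFamily σ (familyC n k (singletons I)) = stdC n k t ∧
      permuteFamily σ (familyD n l t (singletons I)) = stdD n l t := by
  obtain ⟨σ, h1, -⟩ := exists_perm_image_eq (subset_refl I)
    (subset_refl (initialPoints n (t + 1))) (hI.trans (card_initialPoints htn).symm)
    (hI.trans (card_initialPoints htn).symm)
  refine ⟨σ, ?_, ?_⟩
  · rw [permuteFamily_familyC, permuteBlocks_singletons, h1]; rfl
  · rw [permuteFamily_familyD, permuteBlocks_singletons, h1]; rfl

end

/-! ### Sizes of the extremal families -/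

section

variable {n k l t : ℕ}

theorem card_familyC_singletons {I : Finset (Fin n)} (hk : I.card ≤ k) :
    (familyC n k (singletons I)).card = Nat.stirlingSecond (n - I.card) (k - I.card) := by
  rw [card_familyC (isPartialPartition_singletons I) (by rwa [card_singletons]),
    sup_singletons, card_singletons]

theorem singletons_sdiff (I J : Finset (Fin n)) :
    singletons (I \ J) = singletons I \ singletons J := image_sdiff _ _ singleton_injective

/-- A member of `𝓓` contains one `t`-subset of the `t + 1` blocks, or all `t + 1` of them. -/
theorem card_filter_erase_subset {X F : Finset (Finset (Fin n))} (hX : X.card = t + 1) :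
    (X.filter fun x => X.erase x ⊆ F).card =
      (if t ≤ (X ∩ F).card then 1 else 0) + t * (if X ⊆ F then 1 else 0) := by
  by_cases hXF : X ⊆ F
  · rw [filter_true_of_mem fun x _ => (erase_subset x X).trans hXF, inter_eq_left.2 hXF,
      if_pos hXF, if_pos (by omega), hX]
    omega
  · rw [if_neg hXF, mul_zero, add_zero]
    split_ifs with h
    · obtain ⟨x, hx, hxF⟩ := exists_erase_subset hX h
      refine card_eq_one.2 ⟨x, ?_⟩
      ext y
      rw [mem_filter, mem_singleton]
      constructor
      · rintro ⟨-, hyF⟩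
        by_contra hne
        refine hXF fun B hB => ?_
        by_cases hBx : B = x
        · exact hyF (mem_erase.2 ⟨fun e => hne (e.symm.trans hBx), hB⟩)
        · exact hxF (mem_erase.2 ⟨hBx, hB⟩)
      · rintro rfl
        exact ⟨hx, hxF⟩
    · rw [card_eq_zero, filter_eq_empty_iff]
      intro x hx hxF
      apply h
      have h1 : X.erase x ⊆ X ∩ F := subset_inter (erase_subset x X) hxF
      have h2 := card_le_card h1
      rw [card_erase_of_mem hx] at h2
      omega

theorem card_familyD_add {X : Finset (Finset (Fin n))} (hX : X.card = t + 1) :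
    (familyD n l t X).card + t * (familyC n l X).card =
      ∑ x ∈ X, (familyC n l (X.erase x)).card := by
  unfold familyC familyD
  simp only [card_filter]
  rw [mul_sum, ← sum_add_distrib, sum_comm]
  refine sum_congr rfl fun F _ => ?_
  rw [← card_filter, card_filter_erase_subset hX]

theorem card_familyD_singletons {I : Finset (Fin n)} (hI : I.card = t + 1) (hl : t + 1 ≤ l) :
    (familyD n l t (singletons I)).card + t * Nat.stirlingSecond (n - t - 1) (l - t - 1) =
      (t + 1) * Nat.stirlingSecond (n - t) (l - t) := by
  have h := card_familyD_add (n := n) (l := l) (X := singletons I)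
    (by rw [card_singletons, hI] : _ = t + 1)
  rw [card_familyC_singletons (by omega), hI, ← Nat.sub_sub, ← Nat.sub_sub] at h
  rw [h, sum_congr rfl (g := fun _ => Nat.stirlingSecond (n - t) (l - t)), sum_const,
    card_singletons, hI, smul_eq_mul]
  intro x hx
  obtain ⟨i, hi, rfl⟩ := mem_singletons.1 hx
  have he : (singletons I).erase {i} = singletons (I.erase i) := by
    rw [erase_eq, erase_eq, singletons_sdiff]; rfl
  have hc : (I.erase i).card = t := by rw [card_erase_of_mem hi, hI, Nat.add_sub_cancel]
  rw [he, card_familyC_singletons (by omega), hc]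

theorem card_familyB_singletons {J I : Finset (Fin n)} (hJI : J ⊆ I) (hJ : J.card = t)
    (hl : t ≤ l) (hI : I.card < n) :
    (familyB n l (singletons J) (singletons I)).card = Nat.stirlingSecond (n - t) (l - t) + t := by
  have hne : (Iᶜ).Nonempty := by rw [← card_pos, card_compl, Fintype.card_fin]; omega
  -- the enlarged block of `j` is not a singleton, so `{j}` is missing from the partition
  have hkey : ∀ i ∈ J, ∀ j ∈ J,
      ({i} ∈ (singletons I \ {{j}}) ∪ {({j} : Finset (Fin n)) ∪ Iᶜ} ↔ i ≠ j) := by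
    intro i hi j hj
    rw [mem_union, mem_sdiff, mem_singleton, mem_singleton, singleton_inj]
    have h1 : {i} ∈ singletons I := mem_singletons.2 ⟨i, hJI hi, rfl⟩
    have h2 : ({i} : Finset (Fin n)) ≠ {j} ∪ Iᶜ := by
      intro h
      obtain ⟨x, hx⟩ := hne
      have h3 : x ∈ ({i} : Finset (Fin n)) := h ▸ mem_union_right _ hx
      rw [mem_singleton.1 h3] at hx
      exact (mem_compl.1 hx) (hJI hi)
    rw [or_iff_left h2, and_iff_right h1]
  unfold familyB
  rw [sup_singletons, card_union_of_disjoint, card_image_of_injOn, card_singletons, hJ]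
  · have h := card_familyC_singletons (n := n) (k := l) (I := J) (by omega)
    rw [hJ] at h
    rw [← h]; rfl
  · intro B hB C hC hBC
    obtain ⟨i, hi, rfl⟩ := mem_singletons.1 (mem_coe.1 hB)
    obtain ⟨j, hj, rfl⟩ := mem_singletons.1 (mem_coe.1 hC)
    by_contra hij
    have h1 := (hkey i hi j hj).2 fun e => hij (by rw [e])
    simp only at hBC
    rw [← hBC] at h1
    exact (hkey i hi i hi).1 h1 rfl
  · rw [disjoint_left]
    intro F hF hF'
    obtain ⟨B, hB, rfl⟩ := mem_image.1 hF'
    obtain ⟨i, hi, rfl⟩ := mem_singletons.1 hB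
    exact (hkey i hi i hi).1 ((mem_filter.1 hF).2 hB) rfl

theorem familyA_singletons_eq (J I : Finset (Fin n)) :
    familyA n k (singletons J) (singletons I) =
      (I \ J).biUnion fun i => familyC n k (singletons (insert i J)) := by
  ext F
  rw [familyA, mem_filter, ← singletons_sdiff, mem_biUnion]
  constructor
  · rintro ⟨hF, hJF, B, hB⟩
    rw [mem_inter] at hB
    obtain ⟨i, hi, rfl⟩ := mem_singletons.1 hB.2
    refine ⟨i, hi, mem_filter.2 ⟨hF, ?_⟩⟩
    rw [singletons, image_insert]
    exact insert_subset hB.1 hJF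
  · rintro ⟨i, hi, hF⟩
    obtain ⟨hF, hs⟩ := mem_filter.1 hF
    exact ⟨hF, (singletons_subset_singletons.2 (subset_insert i J)).trans hs, {i},
      mem_inter.2 ⟨hs (mem_singletons.2 ⟨i, mem_insert_self i J, rfl⟩),
        mem_singletons.2 ⟨i, hi, rfl⟩⟩⟩

/-- Inclusion-exclusion. The empty index set accounts for the whole type of sets of blocks, which
cancels against the complement. -/
theorem card_familyA_singletons {J I : Finset (Fin n)} (hJI : J ⊆ I) (hJ : J.card = t)
    (hI : I.card ≤ k) :
    ((familyA n k (singletons J) (singletons I)).card : ℤ) =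
      ∑ j ∈ Icc 1 (I.card - t), (-1 : ℤ) ^ (j - 1) * ((I.card - t).choose j : ℤ) *
        (Nat.stirlingSecond (n - t - j) (k - t - j) : ℤ) := by
  classical
  have hs : (I \ J).card = I.card - t := by rw [card_sdiff_of_subset hJI, hJ]
  set S : Fin n → Finset (Finset (Finset (Fin n))) :=
    fun i => familyC n k (singletons (insert i J)) with hS
  have hinf : ∀ u ⊆ I \ J, u.Nonempty →
      (u.inf S).card = Nat.stirlingSecond (n - t - u.card) (k - t - u.card) := by
    intro u hu hne
    have h1 : u.inf S = familyC n k (singletons (J ∪ u)) := by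
      ext F
      simp only [mem_inf, hS, familyC, mem_filter]
      constructor
      · intro h
        obtain ⟨i, hi⟩ := hne
        refine ⟨(h i hi).1, fun B hB => ?_⟩
        obtain ⟨j, hj, rfl⟩ := mem_singletons.1 hB
        rcases mem_union.1 hj with hj | hj
        · exact (h i hi).2 (mem_singletons.2 ⟨j, mem_insert_of_mem hj, rfl⟩)
        · exact (h j hj).2 (mem_singletons.2 ⟨j, mem_insert_self j J, rfl⟩)
      · exact fun h i hi => ⟨h.1, (singletons_subset_singletons.2
          (insert_subset (mem_union_right J hi) subset_union_left)).trans h.2⟩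
    have h2 : (J ∪ u).card = t + u.card := by
      rw [card_union_of_disjoint (disjoint_sdiff.mono_right hu), hJ]
    have h3 := card_le_card hu
    have h4 := card_le_card hJI
    rw [h1, card_familyC_singletons (by omega), h2, Nat.sub_sub, Nat.sub_sub]
  have hie := inclusion_exclusion_card_inf_compl (I \ J) S
  have hcompl : (I \ J).inf (fun i => (S i)ᶜ) = ((I \ J).biUnion S)ᶜ := by
    ext F
    simp only [mem_inf, mem_compl, mem_biUnion, not_exists, not_and]
  have hgroup : ∑ u ∈ (I \ J).powerset, (-1 : ℤ) ^ u.card * ((u.inf S).card : ℤ) =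
      ∑ u ∈ (I \ J).powerset, (fun j => if j = 0 then
        (Fintype.card (Finset (Finset (Fin n))) : ℤ) else (-1 : ℤ) ^ j *
          (Nat.stirlingSecond (n - t - j) (k - t - j) : ℤ)) u.card := by
    refine sum_congr rfl fun u hu => ?_
    rcases u.eq_empty_or_nonempty with rfl | hne
    · simp
    · simp only [card_ne_zero.2 hne, if_false]
      rw [hinf u (mem_powerset.1 hu) hne]
  rw [hcompl, hgroup, sum_powerset_apply_card (fun j => if j = 0 then
    (Fintype.card (Finset (Finset (Fin n))) : ℤ) else (-1 : ℤ) ^ j *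
      (Nat.stirlingSecond (n - t - j) (k - t - j) : ℤ)), hs, sum_range_succ', card_compl,
    Nat.cast_sub (card_le_univ _)] at hie
  rw [familyA_singletons_eq]
  simp only [Nat.choose_zero_right, if_true, one_smul, Nat.add_eq_zero_iff, one_ne_zero, and_false,
    if_false, nsmul_eq_mul] at hie
  rw [show Icc 1 (I.card - t) = Ico 1 (I.card - t + 1) from rfl, sum_Ico_eq_sum_range,
    Nat.add_sub_cancel]
  have h5 : ∑ j ∈ range (I.card - t), (-1 : ℤ) ^ (1 + j - 1) * ((I.card - t).choose (1 + j) : ℤ) *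
        (Nat.stirlingSecond (n - t - (1 + j)) (k - t - (1 + j)) : ℤ) =
      - ∑ j ∈ range (I.card - t), ((I.card - t).choose (j + 1) : ℤ) * ((-1 : ℤ) ^ (j + 1) *
        (Nat.stirlingSecond (n - t - (j + 1)) (k - t - (j + 1)) : ℤ)) := by
    rw [← sum_neg_distrib]
    refine sum_congr rfl fun j _ => ?_
    rw [add_comm 1 j, Nat.add_sub_cancel, pow_succ]
    ring
  rw [h5]
  linarith

/-- The lower Bonferroni inequality for the families of partitions containing `J` and one point of
`I \ J` as singletons. -/
theorem card_mul_le_card_familyA_add {J I : Finset (Fin n)} (hJI : J ⊆ I) (hJ : J.card = t)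
    (hI : I.card ≤ k) (htI : t + 1 ≤ I.card) :
    (I.card - t) * Nat.stirlingSecond (n - t - 1) (k - t - 1) ≤
      (familyA n k (singletons J) (singletons I)).card +
        (I.card - t) * (I.card - t - 1) * Nat.stirlingSecond (n - t - 2) (k - t - 2) := by
  have hs : (I \ J).card = I.card - t := by rw [card_sdiff_of_subset hJI, hJ]
  have h1 : ∑ i ∈ I \ J, (familyC n k (singletons (insert i J))).card =
      (I.card - t) * Nat.stirlingSecond (n - t - 1) (k - t - 1) := by
    rw [← hs, ← smul_eq_mul, ← sum_const]
    refine sum_congr rfl fun i hi => ?_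
    have hc : (insert i J).card = t + 1 := by
      rw [card_insert_of_notMem (mem_sdiff.1 hi).2, hJ]
    rw [card_familyC_singletons (by omega), hc, Nat.sub_sub, Nat.sub_sub]
  have h2 : ∑ p ∈ (I \ J).offDiag, (familyC n k (singletons (insert p.1 (insert p.2 J)))).card =
      (I.card - t) * (I.card - t - 1) * Nat.stirlingSecond (n - t - 2) (k - t - 2) := by
    have h3 : (I \ J).offDiag.card = (I.card - t) * (I.card - t - 1) := by
      rw [offDiag_card, hs, Nat.mul_sub_one]
    rw [← h3, ← smul_eq_mul, ← sum_const]
    refine sum_congr rfl fun p hp => ?_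
    rw [mem_offDiag] at hp
    have hsub : insert p.1 (insert p.2 J) ⊆ I :=
      insert_subset (mem_sdiff.1 hp.1).1 (insert_subset (mem_sdiff.1 hp.2.1).1 hJI)
    have hc : (insert p.1 (insert p.2 J)).card = t + 2 := by
      rw [card_insert_of_notMem, card_insert_of_notMem (mem_sdiff.1 hp.2.1).2, hJ]
      rw [mem_insert, not_or]
      exact ⟨hp.2.2, (mem_sdiff.1 hp.1).2⟩
    have hle := card_le_card hsub
    rw [card_familyC_singletons (by omega), hc, Nat.sub_sub, Nat.sub_sub]
  rw [← h1, ← h2, familyA_singletons_eq]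
  -- a member counted `s` times on the left is counted `1 + s * (s - 1)` times on the right
  have h4 : ∀ F ∈ kPartitions n k,
      ((I \ J).filter fun i => singletons (insert i J) ⊆ F).card ≤
        (if F ∈ (I \ J).biUnion (fun i => familyC n k (singletons (insert i J))) then 1 else 0) +
        ((I \ J).offDiag.filter
          fun p => singletons (insert p.1 (insert p.2 J)) ⊆ F).card := by
    intro F hF
    set s := (I \ J).filter fun i => singletons (insert i J) ⊆ F with hsdef
    rcases s.eq_empty_or_nonempty with h | ⟨i, hi⟩
    · rw [h]; exact Nat.zero_le _
    · have hi' := mem_filter.1 hi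
      rw [if_pos (mem_biUnion.2 ⟨i, hi'.1, mem_filter.2 ⟨hF, hi'.2⟩⟩)]
      have h5 : s.offDiag ⊆ (I \ J).offDiag.filter
          fun p => singletons (insert p.1 (insert p.2 J)) ⊆ F := by
        intro p hp
        rw [mem_offDiag] at hp
        have hp1 := mem_filter.1 hp.1
        have hp2 := mem_filter.1 hp.2.1
        refine mem_filter.2 ⟨mem_offDiag.2 ⟨hp1.1, hp2.1, hp.2.2⟩, ?_⟩
        rw [singletons, image_insert]
        exact insert_subset (hp1.2 (mem_singletons.2 ⟨_, mem_insert_self _ _, rfl⟩)) hp2.2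
      refine le_trans ?_ (Nat.add_le_add_left (card_le_card h5) 1)
      rw [offDiag_card]
      have h6 : 1 ≤ s.card := card_pos.2 ⟨i, hi⟩
      obtain ⟨m, hm⟩ : ∃ m, s.card = m + 1 := ⟨s.card - 1, by omega⟩
      rw [hm, show (m + 1) * (m + 1) - (m + 1) = m * m + m by
        rw [Nat.sub_eq_iff_eq_add (by nlinarith)]; ring]
      omega
  have h5 := sum_le_sum h4
  rw [sum_add_distrib] at h5
  have h6 : ∑ F ∈ kPartitions n k,
      (if F ∈ (I \ J).biUnion (fun i => familyC n k (singletons (insert i J))) then 1 else 0) =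
      ((I \ J).biUnion fun i => familyC n k (singletons (insert i J))).card := by
    rw [← card_filter, filter_mem_eq_inter, inter_eq_right.2]
    exact biUnion_subset.2 fun i _ => filter_subset _ _
  rw [h6] at h5
  simp only [card_filter] at h5
  rw [sum_comm, sum_comm (s := kPartitions n k)] at h5
  simpa only [familyC, card_filter] using h5

/-- The upper bound that counts intersections with one of the `#I - t` families only. -/
theorem card_familyA_add_le {J I : Finset (Fin n)} (hJI : J ⊆ I) (hJ : J.card = t)
    (hI : I.card ≤ k) (htI : t + 1 ≤ I.card) :
    (familyA n k (singletons J) (singletons I)).card +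
        (I.card - t - 1) * Nat.stirlingSecond (n - t - 2) (k - t - 2) ≤
      (I.card - t) * Nat.stirlingSecond (n - t - 1) (k - t - 1) := by
  have hs : (I \ J).card = I.card - t := by rw [card_sdiff_of_subset hJI, hJ]
  obtain ⟨w, hw⟩ : (I \ J).Nonempty := card_pos.1 (by omega)
  set a₁ := Nat.stirlingSecond (n - t - 1) (k - t - 1) with ha₁
  set a₂ := Nat.stirlingSecond (n - t - 2) (k - t - 2) with ha₂
  set S : Fin n → Finset (Finset (Finset (Fin n))) :=
    fun i => familyC n k (singletons (insert i J)) with hS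
  have h1 : ∀ i ∈ I \ J, (S i).card = a₁ := fun i hi => by
    have hc : (insert i J).card = t + 1 := by
      rw [card_insert_of_notMem (mem_sdiff.1 hi).2, hJ]
    rw [hS, card_familyC_singletons (by omega), hc, ha₁, Nat.sub_sub, Nat.sub_sub]
  have h2 : ∀ i ∈ (I \ J).erase w, (S i \ S w).card + a₂ = a₁ := fun i hi => by
    obtain ⟨hiw, hi⟩ := mem_erase.1 hi
    have hsub : insert w (insert i J) ⊆ I :=
      insert_subset (mem_sdiff.1 hw).1 (insert_subset (mem_sdiff.1 hi).1 hJI)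
    have hc : (insert w (insert i J)).card = t + 2 := by
      rw [card_insert_of_notMem, card_insert_of_notMem (mem_sdiff.1 hi).2, hJ]
      rw [mem_insert, not_or]
      exact ⟨hiw.symm, (mem_sdiff.1 hw).2⟩
    have hle := card_le_card hsub
    have h3 : S i ∩ S w = familyC n k (singletons (insert w (insert i J))) := by
      ext F
      simp only [hS, familyC, mem_inter, mem_filter, singletons, image_insert, insert_subset_iff]
      tauto
    have h4 := card_sdiff_add_card_inter (S i) (S w)
    rw [h3, card_familyC_singletons (by omega), hc, ← Nat.sub_sub, ← Nat.sub_sub, h1 i hi] at h4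
    exact h4
  have h3 : (I \ J).biUnion S ⊆ S w ∪ ((I \ J).erase w).biUnion fun i => S i \ S w := by
    intro F hF
    by_cases hFw : F ∈ S w
    · exact mem_union_left _ hFw
    · obtain ⟨i, hi, hFi⟩ := mem_biUnion.1 hF
      refine mem_union_right _ (mem_biUnion.2 ⟨i, mem_erase.2 ⟨?_, hi⟩, mem_sdiff.2 ⟨hFi, hFw⟩⟩)
      rintro rfl
      exact hFw hFi
  have h4 := (card_le_card h3).trans ((card_union_le _ _).trans
    (Nat.add_le_add_left card_biUnion_le _))
  rw [h1 w hw] at h4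
  have h5 : ∑ i ∈ (I \ J).erase w, (S i \ S w).card + (I.card - t - 1) * a₂ =
      (I.card - t - 1) * a₁ := by
    rw [← hs, ← card_erase_of_mem hw, ← smul_eq_mul, ← smul_eq_mul, ← sum_const, ← sum_const,
      ← sum_add_distrib]
    exact sum_congr rfl h2
  rw [familyA_singletons_eq, ← hS]
  have h6 : (I.card - t) * a₁ = (I.card - t - 1) * a₁ + a₁ := by
    obtain ⟨d, hd⟩ : ∃ d, I.card - t = d + 1 := ⟨I.card - t - 1, by omega⟩
    rw [hd, Nat.add_sub_cancel]; ring
  omega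

end

section

variable {n k l t : ℕ}

theorem card_stdA (htl : t + 1 ≤ l) (hlk : l ≤ k) (hln : l ≤ n) :
    ((stdA n k l t).card : ℤ) = ∑ j ∈ Icc 1 (l - t), (-1 : ℤ) ^ (j - 1) *
      ((l - t).choose j : ℤ) * (Nat.stirlingSecond (n - t - j) (k - t - j) : ℤ) := by
  have hl := card_initialPoints hln
  have h := card_familyA_singletons (k := k) (initialPoints_subset n (by omega : t ≤ l))
    (card_initialPoints (by omega : t ≤ n)) (by rw [hl]; exact hlk)
  rw [hl] at h
  exact h

theorem card_stdB (htl : t ≤ l) (hln : l < n) :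
    (stdB n l t).card = Nat.stirlingSecond (n - t) (l - t) + t := by
  have h := card_familyB_singletons (l := l) (initialPoints_subset n htl)
    (card_initialPoints (by omega : t ≤ n)) htl (by rw [card_initialPoints hln.le]; exact hln)
  exact h

theorem card_stdC (htk : t + 1 ≤ k) (htn : t + 1 ≤ n) :
    (stdC n k t).card = Nat.stirlingSecond (n - t - 1) (k - t - 1) := by
  have hc := card_initialPoints htn
  have h := card_familyC_singletons (n := n) (k := k) (I := initialPoints n (t + 1))
    (by rw [hc]; exact htk)
  rw [hc, ← Nat.sub_sub, ← Nat.sub_sub] at h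
  exact h

theorem card_stdD (htl : t + 1 ≤ l) (htn : t + 1 ≤ n) :
    (stdD n l t).card + t * Nat.stirlingSecond (n - t - 1) (l - t - 1) =
      (t + 1) * Nat.stirlingSecond (n - t) (l - t) :=
  card_familyD_singletons (card_initialPoints htn) htl

end

/-! ### Comparison with the extremal pairs -/

section

variable {n k l t : ℕ} {𝓕 𝓖 𝓕' 𝓖' : Finset (Finset (Finset (Fin n)))}

theorem PairIso.swap (h : PairIso 𝓕 𝓖 𝓕' 𝓖') : PairIso 𝓖 𝓕 𝓖' 𝓕' := by
  obtain ⟨σ, h1, h2⟩ := h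
  exact ⟨σ, h2, h1⟩

theorem PairIso.card_mul_card (h : PairIso 𝓕 𝓖 𝓕' 𝓖') :
    𝓕.card * 𝓖.card = 𝓕'.card * 𝓖'.card := by
  obtain ⟨σ, rfl, rfl⟩ := h
  rw [card_permuteFamily, card_permuteFamily]

/-- One permutation of the ground set carries the first pair into the second. -/
def PairEmbeds (𝓕 𝓖 𝓕' 𝓖' : Finset (Finset (Finset (Fin n)))) : Prop :=
  ∃ σ : Equiv.Perm (Fin n), permuteFamily σ 𝓕 ⊆ 𝓕' ∧ permuteFamily σ 𝓖 ⊆ 𝓖'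

theorem PairEmbeds.card_mul_card_le (h : PairEmbeds 𝓕 𝓖 𝓕' 𝓖') :
    𝓕.card * 𝓖.card ≤ 𝓕'.card * 𝓖'.card := by
  obtain ⟨σ, h1, h2⟩ := h
  rw [← card_permuteFamily σ 𝓕, ← card_permuteFamily σ 𝓖]
  exact Nat.mul_le_mul (card_le_card h1) (card_le_card h2)

theorem PairEmbeds.pairIso (h : PairEmbeds 𝓕 𝓖 𝓕' 𝓖') (hpos : 0 < 𝓕'.card * 𝓖'.card)
    (heq : 𝓕.card * 𝓖.card = 𝓕'.card * 𝓖'.card) : PairIso 𝓕 𝓖 𝓕' 𝓖' := by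
  obtain ⟨σ, h1, h2⟩ := h
  have h3 := card_le_card h1
  have h4 := card_le_card h2
  rw [← card_permuteFamily σ 𝓕, ← card_permuteFamily σ 𝓖] at heq
  have h5 := Nat.pos_of_mul_pos_left hpos
  have h6 := Nat.pos_of_mul_pos_right hpos
  refine ⟨σ, eq_of_subset_of_card_le h1 ?_, eq_of_subset_of_card_le h2 ?_⟩ <;>
  · by_contra! hlt
    first
    | exact absurd heq (Nat.mul_lt_mul_of_lt_of_le hlt h4 (by assumption)).ne
    | exact absurd heq (Nat.mul_lt_mul_of_le_of_lt h3 hlt (by assumption)).ne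

theorem InsideAB.pairEmbeds (h : InsideAB k l t 𝓕 𝓖) (htl : t ≤ l) (hln : l ≤ n) :
    PairEmbeds 𝓕 𝓖 (stdA n k l t) (stdB n l t) := by
  obtain ⟨J, I, hJI, hJ, hI, h1, h2⟩ := h
  obtain ⟨σ, h3, h4⟩ := exists_perm_stdA_stdB (k := k) htl hln hJI hJ hI
  exact ⟨σ, h3 ▸ image_subset_image h1, h4 ▸ image_subset_image h2⟩

theorem InsideCD.pairEmbeds (h : InsideCD k l t 𝓕 𝓖) (htn : t + 1 ≤ n) :
    PairEmbeds 𝓕 𝓖 (stdC n k t) (stdD n l t) := by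
  obtain ⟨I, hI, h1, h2⟩ := h
  obtain ⟨σ, h3, h4⟩ := exists_perm_stdC_stdD (k := k) (l := l) htn hI
  exact ⟨σ, h3 ▸ image_subset_image h1, h4 ▸ image_subset_image h2⟩

end

section

variable {n t K L M c : ℕ} {𝓕 𝓖 : Finset (Finset (Finset (Fin n)))}

theorem AboveThreshold.stirlingSecond_mul_pos (h : AboveThreshold t K M) (ht : 1 ≤ t)
    (hL : 2 ≤ L) (hLK : L ≤ K) :
    0 < Nat.stirlingSecond M (K - 1) * Nat.stirlingSecond (M + 1) L := by
  have hlt := h.lt ht (by omega)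
  have h1 := stirlingSecond_pos (m := M - 1) (k := K - 2) (by omega)
  have h2 := stirlingSecond_pos (m := M) (k := L - 1) (by omega)
  rw [show K - 2 + 1 = K - 1 by omega, show M - 1 + 1 = M by omega] at h1
  rw [show L - 1 + 1 = L by omega] at h2
  exact Nat.mul_pos h1 h2

/-- The structural dichotomy: a non-trivial pair lies in one of the extremal pairs (with the
roles exchanged only if the parameters agree), or its product is smaller by a definite
factor than what the extremal pairs attain. -/
theorem embeds_or_lt (hn : n = t + M + 1) (h : AboveThreshold t K M) (ht : 1 ≤ t)
    (hL : 2 ≤ L) (hLK : L ≤ K) (hK : K = 2 → 2 ≤ t) (hc : t + 1 ≤ c) (hcL : L ≤ c)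
    (h𝓕 : 𝓕 ⊆ kPartitions n (t + K)) (h𝓖 : 𝓖 ⊆ kPartitions n (t + L))
    (hcross : CrossIntersecting t 𝓕 𝓖) (hnt : NonTrivialPair t 𝓕 𝓖) :
    PairEmbeds 𝓕 𝓖 (stdC n (t + K) t) (stdD n (t + L) t) ∨
    PairEmbeds 𝓕 𝓖 (stdA n (t + K) (t + L) t) (stdB n (t + L) t) ∨
    (K = L ∧ (PairEmbeds 𝓖 𝓕 (stdC n (t + L) t) (stdD n (t + K) t) ∨
      PairEmbeds 𝓖 𝓕 (stdA n (t + L) (t + K) t) (stdB n (t + K) t))) ∨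
    4 * (𝓕.card * 𝓖.card) <
      (4 * c - 1) * (Nat.stirlingSecond M (K - 1) * Nat.stirlingSecond (M + 1) L) := by
  have hlt := h.lt ht (by omega)
  have hpos := h.stirlingSecond_mul_pos ht hL hLK
  rcases 𝓕.eq_empty_or_nonempty with rfl | hneF
  · right; right; right
    rw [card_empty, zero_mul, mul_zero]
    exact Nat.mul_pos (by omega) hpos
  rcases 𝓖.eq_empty_or_nonempty with rfl | hneG
  · right; right; right
    rw [card_empty, mul_zero, mul_zero]
    exact Nat.mul_pos (by omega) hpos
  rcases Nat.lt_or_ge 2 K with hK3 | hK2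
  · obtain ⟨F₀, hF₀⟩ := id hneF
    obtain ⟨G₀, hG₀⟩ := id hneG
    obtain ⟨X, hX, hXmin⟩ := exists_min_cover (hcross.symm.covers hG₀)
    obtain ⟨Z, hZ, hZmin⟩ := exists_min_cover (hcross.covers hF₀)
    obtain ⟨α, hα⟩ := Nat.exists_eq_add_of_le (hX.le_card hneF)
    obtain ⟨β, hβ⟩ := Nat.exists_eq_add_of_le (hZ.le_card hneG)
    by_cases hαβ : α = 0 ∨ 1 ≤ β
    · rcases inside_or_lt hn h ht hK3 le_rfl hL hLK hc hcL h𝓕 h𝓖 hcross hnt hneF hneG hX hα hXmin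
        hZ hβ hZmin hαβ with h1 | h1 | h1
      · exact Or.inl (h1.pairEmbeds (by omega))
      · exact Or.inr (Or.inl (h1.pairEmbeds (by omega) (by omega)))
      · exact Or.inr (Or.inr (Or.inr h1))
    · obtain ⟨hα0, rfl⟩ : 1 ≤ α ∧ β = 0 := by omega
      right; right
      rcases Nat.eq_or_lt_of_le hLK with rfl | hlt'
      · rcases inside_or_lt hn h ht hK3 le_rfl hL le_rfl hc hcL h𝓖 h𝓕 hcross.symm hnt.symm hneG
          hneF hZ hβ hZmin hX hα hXmin (Or.inl rfl) with h1 | h1 | h1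
        · exact Or.inl ⟨rfl, Or.inl (h1.pairEmbeds (by omega))⟩
        · exact Or.inl ⟨rfl, Or.inr (h1.pairEmbeds (by omega) (by omega))⟩
        · exact Or.inr (by rwa [mul_comm 𝓕.card])
      · exact Or.inr (lt_of_common_right hn h ht hL hlt' hc hcL h𝓕 h𝓖 hcross hnt hneG hX hα hXmin
          hZ hβ hα0)
  · obtain rfl : K = 2 := by omega
    obtain rfl : L = 2 := by omega
    rcases insideCD_or_lt_two hn h (hK rfl) h𝓕 h𝓖 hcross hnt hneF hneG with h1 | h1 | h1
    · exact Or.inl (h1.pairEmbeds (by omega))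
    · exact Or.inr (Or.inr (Or.inl ⟨rfl, Or.inl (h1.pairEmbeds (by omega))⟩))
    · right; right; right
      have hone : Nat.stirlingSecond M (2 - 1) = 1 := by
        rw [show M = M - 1 + 1 by omega]; exact Nat.stirlingSecond_one_right _
      rw [hone, one_mul]
      exact h1.trans_le (Nat.mul_le_mul_right _ (by omega))

theorem AboveThreshold.le_four_mul_card_stdA (h : AboveThreshold t K M) (hn : n = t + M + 1)
    (ht : 1 ≤ t) (hL : 2 ≤ L) (hLK : L ≤ K) :
    (4 * L - 1) * Nat.stirlingSecond M (K - 1) ≤ 4 * (stdA n (t + K) (t + L) t).card := by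
  have hlt := h.lt ht (by omega)
  have hl : (initialPoints n (t + L)).card = t + L := card_initialPoints (by omega)
  have h1 := card_mul_le_card_familyA_add (k := t + K)
    (initialPoints_subset n (Nat.le_add_right t L)) (card_initialPoints (by omega : t ≤ n))
    (by rw [hl]; omega) (by rw [hl]; omega)
  rw [hl, Nat.add_sub_cancel_left, show n - t - 1 = M by omega, show t + K - t - 1 = K - 1 by omega,
    show n - t - 2 = M - 1 by omega, show t + K - t - 2 = K - 2 by omega] at h1
  have h2 := h.sq_mul_stirlingSecond_le ht (by omega) (i := 1) (j := K - 2) (by omega)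
  rw [show K - 2 + 1 = K - 1 by omega, show M - 1 + 1 = M by omega] at h2
  have h3 : 4 * (L * (L - 1)) ≤ ((t + 1) * (K + 1)) ^ 2 := by
    calc 4 * (L * (L - 1)) ≤ 4 * ((K + 1) * (K + 1)) := by gcongr <;> omega
      _ = (2 * (K + 1)) ^ 2 := by ring
      _ ≤ _ := by gcongr; omega
  have h4 := (Nat.mul_le_mul_right (Nat.stirlingSecond (M - 1) (K - 2)) h3).trans h2
  have h5 : (4 * L - 1) * Nat.stirlingSecond M (K - 1) + Nat.stirlingSecond M (K - 1) =
      4 * (L * Nat.stirlingSecond M (K - 1)) := by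
    obtain ⟨d, rfl⟩ : ∃ d, L = d + 1 := ⟨L - 1, by omega⟩
    rw [show 4 * (d + 1) - 1 = 4 * d + 3 by omega]; ring
  rw [mul_assoc] at h4
  change _ ≤ (stdA n (t + K) (t + L) t).card + _ at h1
  omega

theorem card_stdC_mul_card_stdD_le (hn : n = t + M + 1) (hK : 1 ≤ K) (hL : 1 ≤ L) :
    (stdC n (t + K) t).card * (stdD n (t + L) t).card ≤
      (t + 1) * (Nat.stirlingSecond M (K - 1) * Nat.stirlingSecond (M + 1) L) := by
  have h1 := card_stdC (n := n) (k := t + K) (t := t) (by omega) (by omega)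
  have h2 := card_stdD (n := n) (l := t + L) (t := t) (by omega) (by omega)
  rw [show n - t - 1 = M by omega, show t + K - t - 1 = K - 1 by omega] at h1
  rw [show n - t = M + 1 by omega, show t + L - t = L by omega] at h2
  rw [h1, mul_left_comm]
  exact Nat.mul_le_mul_left _ (by omega)

/-- If `L ≥ t + 2` then the pair `(𝓐, 𝓑)` beats the pair `(𝓒, 𝓓)` and all other pairs. -/
theorem AboveThreshold.card_stdC_mul_card_stdD_lt (h : AboveThreshold t K M)
    (hn : n = t + M + 1) (ht : 1 ≤ t) (hL : t + 2 ≤ L) (hLK : L ≤ K) :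
    (stdC n (t + K) t).card * (stdD n (t + L) t).card <
      (stdA n (t + K) (t + L) t).card * (stdB n (t + L) t).card ∧
    (4 * L - 1) * (Nat.stirlingSecond M (K - 1) * Nat.stirlingSecond (M + 1) L) ≤
      4 * ((stdA n (t + K) (t + L) t).card * (stdB n (t + L) t).card) := by
  have hlt := h.lt ht (by omega)
  have hpos := h.stirlingSecond_mul_pos ht (by omega) hLK
  have h1 := h.le_four_mul_card_stdA hn ht (by omega) hLK
  have h2 : Nat.stirlingSecond (M + 1) L ≤ (stdB n (t + L) t).card := by
    rw [card_stdB (by omega) (by omega), show n - t = M + 1 by omega, Nat.add_sub_cancel_left]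
    omega
  have h3 := Nat.mul_le_mul h1 h2
  rw [mul_assoc, mul_assoc] at h3
  refine ⟨?_, h3⟩
  have h4 := card_stdC_mul_card_stdD_le (K := K) (L := L) hn (by omega) (by omega)
  have h5 : (4 * (t + 1) + 1) * (Nat.stirlingSecond M (K - 1) * Nat.stirlingSecond (M + 1) L) ≤
      (4 * L - 1) * (Nat.stirlingSecond M (K - 1) * Nat.stirlingSecond (M + 1) L) :=
    Nat.mul_le_mul_right _ (by omega)
  have h6 : (4 * (t + 1) + 1) * (Nat.stirlingSecond M (K - 1) * Nat.stirlingSecond (M + 1) L) =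
      4 * ((t + 1) * (Nat.stirlingSecond M (K - 1) * Nat.stirlingSecond (M + 1) L)) +
      Nat.stirlingSecond M (K - 1) * Nat.stirlingSecond (M + 1) L := by ring
  omega

/-- If `L ≤ t + 1` then the pair `(𝓒, 𝓓)` beats the pair `(𝓐, 𝓑)` and all other pairs. For
`L = t + 1` the leading terms of the two products agree and the next ones decide. -/
theorem AboveThreshold.card_stdA_mul_card_stdB_lt (h : AboveThreshold t K M)
    (hn : n = t + M + 1) (ht : 1 ≤ t) (hL : 2 ≤ L) (hLK : L ≤ K)
    (hcase : L ≤ t ∨ L = t + 1 ∧ t + 1 < K ∧ (t = 1 → K ≠ 3)) :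
    (stdA n (t + K) (t + L) t).card * (stdB n (t + L) t).card <
      (stdC n (t + K) t).card * (stdD n (t + L) t).card ∧
    (4 * (t + 1) - 1) * (Nat.stirlingSecond M (K - 1) * Nat.stirlingSecond (M + 1) L) ≤
      4 * ((stdC n (t + K) t).card * (stdD n (t + L) t).card) := by
  have hlt := h.lt ht (by omega)
  have hpos := h.stirlingSecond_mul_pos ht hL hLK
  have hl : (initialPoints n (t + L)).card = t + L := card_initialPoints (by omega)
  have hA := card_familyA_add_le (k := t + K)
    (initialPoints_subset n (Nat.le_add_right t L)) (card_initialPoints (by omega : t ≤ n))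
    (by rw [hl]; omega) (by rw [hl]; omega)
  rw [hl, Nat.add_sub_cancel_left, show n - t - 1 = M by omega, show t + K - t - 1 = K - 1 by omega,
    show n - t - 2 = M - 1 by omega, show t + K - t - 2 = K - 2 by omega] at hA
  change (stdA n (t + K) (t + L) t).card + _ ≤ _ at hA
  have hB := card_stdB (n := n) (l := t + L) (t := t) (by omega) (by omega)
  rw [show n - t = M + 1 by omega, Nat.add_sub_cancel_left] at hB
  have hC := card_stdC (n := n) (k := t + K) (t := t) (by omega) (by omega)
  rw [show n - t - 1 = M by omega, show t + K - t - 1 = K - 1 by omega] at hC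
  have hD := card_stdD (n := n) (l := t + L) (t := t) (by omega) (by omega)
  rw [show n - t - 1 = M by omega, show n - t = M + 1 by omega,
    show t + L - t - 1 = L - 1 by omega, show t + L - t = L by omega] at hD
  have hb := h.sq_mul_stirlingSecond_le ht (by omega) (i := 0) (j := L - 1) (by omega)
  rw [Nat.sub_zero, show L - 1 + 1 = L by omega] at hb
  have hb₁ : 1 ≤ Nat.stirlingSecond M (L - 1) := by
    have := stirlingSecond_pos (m := M - 1) (k := L - 2) (by omega)
    rwa [show L - 2 + 1 = L - 1 by omega, show M - 1 + 1 = M by omega] at this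
  have ha₁ := Nat.pos_of_mul_pos_right hpos
  have hmain := fun hL' : L = t + 1 => fun hK : t + 1 < K => h.mul_add_lt ht hK
  rw [hB, hC]
  generalize (stdA n (t + K) (t + L) t).card = A at *
  generalize (stdD n (t + L) t).card = D at *
  have hQ : 4 * (t + 1) ^ 2 ≤ ((t + 1) * (K + 1)) ^ 2 := by
    calc 4 * (t + 1) ^ 2 = ((t + 1) * 2) ^ 2 := by ring
      _ ≤ _ := by gcongr; omega
  have hb' := (Nat.mul_le_mul_right (Nat.stirlingSecond M (L - 1)) hQ).trans hb
  constructor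
  · rcases hcase with hLt | ⟨rfl, hK, h43⟩
    · have hA' : A ≤ t * Nat.stirlingSecond M (K - 1) :=
        (Nat.le_of_add_right_le hA).trans (Nat.mul_le_mul_right _ hLt)
      have hlt' : t * (Nat.stirlingSecond (M + 1) L + t) < D := by
        generalize Nat.stirlingSecond (M + 1) L = b₀ at *
        generalize Nat.stirlingSecond M (L - 1) = b₁ at *
        have h1 : t * t * 1 ≤ t * t * b₁ := Nat.mul_le_mul_left _ hb₁
        nlinarith [Nat.zero_le (t * b₁), Nat.zero_le (t * t * b₁)]
      calc A * (Nat.stirlingSecond (M + 1) L + t)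
          ≤ t * Nat.stirlingSecond M (K - 1) * (Nat.stirlingSecond (M + 1) L + t) :=
            Nat.mul_le_mul_right _ hA'
        _ = Nat.stirlingSecond M (K - 1) * (t * (Nat.stirlingSecond (M + 1) L + t)) := by ring
        _ < _ := Nat.mul_lt_mul_of_pos_left hlt' ha₁
    · have h1 := hmain rfl hK h43
      rw [Nat.add_sub_cancel] at hA hD
      generalize Nat.stirlingSecond (M + 1) (t + 1) = b₀ at *
      generalize Nat.stirlingSecond M t = b₁ at *
      generalize Nat.stirlingSecond M (K - 1) = a₁ at *
      generalize Nat.stirlingSecond (M - 1) (K - 2) = a₂ at *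
      have h2 := Nat.mul_le_mul_right (b₀ + t) hA
      have h3 : t * (a₁ * (b₁ + t + 1)) < t * (a₂ * b₀) := Nat.mul_lt_mul_of_pos_left h1 (by omega)
      have h4 : a₁ * (D + t * b₁) = a₁ * ((t + 1) * b₀) := by rw [hD]
      have h5 : 0 ≤ t * t * a₂ := Nat.zero_le _
      by_contra! h6
      ring_nf at h2 h3 h4 h5 h6
      omega
  · rw [show 4 * (t + 1) - 1 = 4 * t + 3 by omega]
    have h1 : (4 * t + 3) * Nat.stirlingSecond (M + 1) L ≤ 4 * D := by
      generalize Nat.stirlingSecond (M + 1) L = b₀ at *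
      generalize Nat.stirlingSecond M (L - 1) = b₁ at *
      nlinarith
    calc _ = Nat.stirlingSecond M (K - 1) * ((4 * t + 3) * Nat.stirlingSecond (M + 1) L) := by ring
      _ ≤ Nat.stirlingSecond M (K - 1) * (4 * D) := Nat.mul_le_mul_left _ h1
      _ = _ := by ring

end

/-- The shape of both parts: if every pair either embeds into one of two pairs of families whose
sizes have product `m`, or has a product below `m`, then `m` is the maximum, attained only by
copies of these two pairs. -/
theorem card_mul_card_le_and_eq_iff {n m : ℕ} {p : Prop}
    {𝓕 𝓖 𝓟 𝓠 𝓟' 𝓠' : Finset (Finset (Finset (Fin n)))} (hpos : 0 < m)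
    (hm : 𝓟.card * 𝓠.card = m) (hm' : p → 𝓟'.card * 𝓠'.card = m)
    (h : PairEmbeds 𝓕 𝓖 𝓟 𝓠 ∨ (p ∧ PairEmbeds 𝓖 𝓕 𝓟' 𝓠') ∨ 𝓕.card * 𝓖.card < m) :
    𝓕.card * 𝓖.card ≤ m ∧
      (𝓕.card * 𝓖.card = m ↔ PairIso 𝓕 𝓖 𝓟 𝓠 ∨ (p ∧ PairIso 𝓕 𝓖 𝓠' 𝓟')) := by
  refine ⟨?_, fun heq => ?_, ?_⟩
  · rcases h with h | ⟨hp, h⟩ | h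
    · exact h.card_mul_card_le.trans_eq hm
    · rw [mul_comm]
      exact h.card_mul_card_le.trans_eq (hm' hp)
    · exact h.le
  · rcases h with h | ⟨hp, h⟩ | h
    · exact Or.inl (h.pairIso (hm ▸ hpos) (heq.trans hm.symm))
    · exact Or.inr ⟨hp, (h.pairIso (hm' hp ▸ hpos)
        ((mul_comm _ _).trans (heq.trans (hm' hp).symm))).swap⟩
    · exact absurd heq h.ne
  · rintro (h | ⟨hp, h⟩)
    · exact h.card_mul_card.trans hm
    · exact h.card_mul_card.trans ((mul_comm _ _).trans (hm' hp))

theorem theorem1p5 (n t k₁ k₂ : ℕ) (ht : 1 ≤ t) (hk : k₂ ≤ k₁) (hk₂ : t + 2 ≤ k₂)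
    (hn : 2 * thresholdL k₁ t ≤ (n : ℝ))
    (𝓕₁ 𝓕₂ : Finset (Finset (Finset (Fin n))))
    (h𝓕₁ : 𝓕₁ ⊆ kPartitions n k₁) (h𝓕₂ : 𝓕₂ ⊆ kPartitions n k₂)
    (hcross : CrossIntersecting t 𝓕₁ 𝓕₂) (hnontriv : NonTrivialPair t 𝓕₁ 𝓕₂) :
    (2 * t + 2 ≤ k₂ → t + 1 + (k₁ - t) * (k₂ - t) ≤ n →
      ((𝓕₁.card : ℤ) * (𝓕₂.card : ℤ) ≤
        (∑ j ∈ Finset.Icc 1 (k₂ - t), (-1 : ℤ) ^ (j - 1) * ((k₂ - t).choose j : ℤ) *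
            (Nat.stirlingSecond (n - t - j) (k₁ - t - j) : ℤ)) *
          ((Nat.stirlingSecond (n - t) (k₂ - t) : ℤ) + (t : ℤ))) ∧
      ((𝓕₁.card : ℤ) * (𝓕₂.card : ℤ) =
        (∑ j ∈ Finset.Icc 1 (k₂ - t), (-1 : ℤ) ^ (j - 1) * ((k₂ - t).choose j : ℤ) *
            (Nat.stirlingSecond (n - t - j) (k₁ - t - j) : ℤ)) *
          ((Nat.stirlingSecond (n - t) (k₂ - t) : ℤ) + (t : ℤ)) ↔
        PairIso 𝓕₁ 𝓕₂ (stdA n k₁ k₂ t) (stdB n k₂ t) ∨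
          (k₁ = k₂ ∧ PairIso 𝓕₁ 𝓕₂ (stdB n k₁ t) (stdA n k₂ k₁ t)))) ∧
    (k₂ ≤ 2 * t + 1 → (k₁, k₂) ≠ (2 * t + 1, 2 * t + 1) → (k₁, k₂) ≠ (4, 3) →
      ((𝓕₁.card : ℤ) * (𝓕₂.card : ℤ) ≤
        (Nat.stirlingSecond (n - t - 1) (k₁ - t - 1) : ℤ) *
          (((t : ℤ) + 1) * (Nat.stirlingSecond (n - t) (k₂ - t) : ℤ) -
            (t : ℤ) * (Nat.stirlingSecond (n - t - 1) (k₂ - t - 1) : ℤ))) ∧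
      ((𝓕₁.card : ℤ) * (𝓕₂.card : ℤ) =
        (Nat.stirlingSecond (n - t - 1) (k₁ - t - 1) : ℤ) *
          (((t : ℤ) + 1) * (Nat.stirlingSecond (n - t) (k₂ - t) : ℤ) -
            (t : ℤ) * (Nat.stirlingSecond (n - t - 1) (k₂ - t - 1) : ℤ)) ↔
        PairIso 𝓕₁ 𝓕₂ (stdC n k₁ t) (stdD n k₂ t) ∨
          (k₁ = k₂ ∧ PairIso 𝓕₁ 𝓕₂ (stdD n k₁ t) (stdC n k₂ t)))) := by
  have htn : t + 1 ≤ n := by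
    have hkt : (t : ℝ) + 2 ≤ k₁ := by exact_mod_cast hk₂.trans hk
    have ht0 : (0 : ℝ) ≤ t := Nat.cast_nonneg t
    have hlog : 0 ≤ Real.logb 2 (((t : ℝ) + 1) * ((k₁ : ℝ) - t + 1)) :=
      Real.logb_nonneg (by norm_num) (by nlinarith)
    have h1 : 0 ≤ ((k₁ : ℝ) - t + 1) * Real.logb 2 (((t : ℝ) + 1) * ((k₁ : ℝ) - t + 1)) :=
      mul_nonneg (by linarith) hlog
    unfold thresholdL at hn
    have h2 : ((t + 1 : ℕ) : ℝ) ≤ n := by push_cast; linarith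
    exact_mod_cast h2
  have h := aboveThreshold_of_two_mul_thresholdL_le htn (by omega) hn
  clear hn
  obtain ⟨M, hM⟩ : ∃ M, n = t + M + 1 := ⟨n - t - 1, by omega⟩
  obtain ⟨K, rfl⟩ : ∃ K, k₁ = t + K := ⟨k₁ - t, by omega⟩
  obtain ⟨L, rfl⟩ : ∃ L, k₂ = t + L := ⟨k₂ - t, by omega⟩
  rw [show t + K - t = K by omega, show n - t - 1 = M by omega] at h
  have hlt := h.lt ht (by omega)
  constructor
  · intro hL _
    rw [← card_stdA (n := n) (k := t + K) (l := t + L) (t := t) (by omega) hk (by omega),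
      ← Nat.cast_add, ← card_stdB (n := n) (l := t + L) (t := t) (by omega) (by omega)]
    obtain ⟨hCD, hbig⟩ := h.card_stdC_mul_card_stdD_lt hM ht (by omega : t + 2 ≤ L) (by omega)
    have key := card_mul_card_le_and_eq_iff (p := t + K = t + L) (𝓕 := 𝓕₁) (𝓖 := 𝓕₂)
      (𝓟' := stdA n (t + L) (t + K) t) (𝓠' := stdB n (t + K) t) (pos_of_gt hCD) rfl
      (fun hp => by rw [hp]) (by
        rcases embeds_or_lt hM h ht (by omega) (by omega) (by omega) (by omega) le_rfl h𝓕₁ h𝓕₂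
          hcross hnontriv with h1 | h1 | ⟨rfl, h1 | h1⟩ | h1
        · exact Or.inr (Or.inr (h1.card_mul_card_le.trans_lt hCD))
        · exact Or.inl h1
        · exact Or.inr (Or.inr ((mul_comm _ _).trans_le h1.card_mul_card_le |>.trans_lt hCD))
        · exact Or.inr (Or.inl ⟨rfl, h1⟩)
        · exact Or.inr (Or.inr (by omega)))
    exact_mod_cast key
  · intro hL hne hne43
    rw [Ne, Prod.mk.injEq] at hne hne43
    have hD := card_stdD (n := n) (l := t + L) (t := t) (by omega) (by omega)
    have hD' : ((t : ℤ) + 1) * (Nat.stirlingSecond (n - t) (t + L - t) : ℤ) -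
        (t : ℤ) * (Nat.stirlingSecond (n - t - 1) (t + L - t - 1) : ℤ) =
        ((stdD n (t + L) t).card : ℤ) := by
      rw [sub_eq_iff_eq_add]; exact_mod_cast hD.symm
    rw [hD', ← card_stdC (n := n) (k := t + K) (t := t) (by omega) (by omega)]
    obtain ⟨hAB, hbig⟩ := h.card_stdA_mul_card_stdB_lt hM ht (by omega : 2 ≤ L) (by omega)
      (by omega)
    have key := card_mul_card_le_and_eq_iff (p := t + K = t + L) (𝓕 := 𝓕₁) (𝓖 := 𝓕₂)
      (𝓟' := stdC n (t + L) t) (𝓠' := stdD n (t + K) t) (pos_of_gt hAB) rfl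
      (fun hp => by rw [hp]) (by
        rcases embeds_or_lt hM h ht (by omega) (by omega) (by omega) le_rfl (by omega) h𝓕₁ h𝓕₂
          hcross hnontriv with h1 | h1 | ⟨rfl, h1 | h1⟩ | h1
        · exact Or.inl h1
        · exact Or.inr (Or.inr (h1.card_mul_card_le.trans_lt hAB))
        · exact Or.inr (Or.inl ⟨rfl, h1⟩)
        · exact Or.inr (Or.inr ((mul_comm _ _).trans_le h1.card_mul_card_le |>.trans_lt hAB))
        · exact Or.inr (Or.inr (by omega)))
    exact_mod_cast key
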